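/- **Setting.** Let $d,n$ be positive integers, $A$ a commutative ring, $\mathcal K$ a finite set partitioned as $\mathcal K=\bigsqcup_{j=1}^d\mathcal K_j$, and $Q=(Q_{k,k'})_{k,k'\in\mathcal K}$ a matrix of polynomials in $A[u,v]$ with $Q_{k,k'}(u,v)=Q_{k',k}(v,u)$, $Q_{k,k}=0$, and $Q_{k,k'}=1$ whenever $k\in\mathcal K_j$, $k'\in\mathcal K_{j'}$ with $j\ne j'$. Put $Q^j=(Q_{k,k'})_{k,k'\in\mathcal K_j}$. The symmetric group $\mathfrak S_n$ acts on $n$-tuples by $(w\cdot x)_a=x_{w^{-1}(a)}$, and $s_a=(a,a+1)$. For $n\ge 0$, the quiver Hecke algebra $H_n(Q)$ is the unital associative $A$-algebra with generators $e(\mathbf k)$ ($\mathbf k\in\mathcal K^n$), $y_1,\dots,y_n$, $\psi_1,\dots,\psi_{n-1}$ and relations: $\sum_{\mathbf k}e(\mathbf k)=1$; $e(\mathbf k)e(\mathbf k')=\delta_{\mathbf k,\mathbf k'}e(\mathbf k)$; $y_ae(\mathbf k)=e(\mathbf k)y_a$; $\psi_ae(\mathbf k)=e(s_a\cdot\mathbf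 k)\psi_a$; $y_ay_b=y_by_a$; $\psi_ay_b=y_b\psi_a$ if $b\ne a,a+1$; $\psi_a\psi_b=\psi_b\psi_a$ if $|a-b|>1$; $\psi_ay_{a+1}e(\mathbf k)=(y_a\psi_a+\delta_{k_a,k_{a+1}})e(\mathbf k)$; $y_{a+1}\psi_ae(\mathbf k)=(\psi_ay_a+\delta_{k_a,k_{a+1}})e(\mathbf k)$; $\psi_a^2e(\mathbf k)=Q_{k_a,k_{a+1}}(y_a,y_{a+1})e(\mathbf k)$; and $\psi_{a+1}\psi_a\psi_{a+1}e(\mathbf k)=\psi_a\psi_{a+1}\psi_ae(\mathbf k)+\delta_{k_a,k_{a+2}}\frac{Q_{k_a,k_{a+1}}(y_a,y_{a+1})-Q_{k_{a+2},k_{a+1}}(y_{a+2},y_{a+1})}{y_a-y_{a+2}}e(\mathbf k)$ (the fraction being the polynomial divided difference). Let $\Lambda=(\Lambda_k)_{k\in\mathcal K}\in\mathbb N^{\mathcal K}$ and, for each $k\in\mathcal K$, let $c_{k,0},\dots,c_{k,\Lambda_k}\in A$ with $c_{k,\Lambda_k}=1$. The cyclotomic quiver Hecke algebra $H_n^\Lambda(Q)$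 is the quotient of $H_n(Q)$ by the two-sided ideal $\mathfrak I$ generated by the elements $\sum_{m=0}^{\Lambda_{k_1}}c_{k_1,m}\,y_1^m e(\mathbf k)$, $\mathbf k\in\mathcal K^n$ ($\mathfrak I=0$ if $n=0$). Let $\Lambda^j$ be the restriction of $\Lambda$ to $\mathcal K_j$, and define $H^{\Lambda^j}_{m}(Q^j)$ using the restricted coefficients. For $\lambda=(\lambda_1,\dots,\lambda_d)\in\mathbb N^d$ with $\sum_j\lambda_j=n$ (written $\lambda\models_d n$), let $J^\lambda$ be the set of $\mathfrak t\in\{1,\dots,d\}^n$ in which each $j$ occurs exactly $\lambda_j$ times, $m_\lambda=\frac{n!}{\lambda_1!\cdots\lambda_d!}$, $\mathfrak t^\lambda=(1,\dots,1,\dots,d,\dots,d)\in J^\lambda$, $e_\lambda=\sum e(\mathbf k)$ over the $\mathbf k\in\mathcal K^n$ with $k_a\in\mathcal K_{\mathfrak t^\lambda_a}$ for all $a$, and, for $\mathfrak t\in J^\lambda$, let $\pi_{\mathfrak t}\in\mathfrak S_n$ be the minimal length element with $\pi_{\mathfrak t}\cdot\mathfrak t=\mathfrak t^\lambda$. Put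 $$H_\lambda(Q)=\bigotimes_{j=1}^dH_{\lambda_j}(Q^j),\qquad H^\Lambda_\lambda(Q)=\bigotimes_{j=1}^dH^{\Lambda^j}_{\lambda_j}(Q^j).$$ Let $\mathfrak I_\lambda\subseteq H_\lambda(Q)$ be the two-sided ideal generated by the elements $\sum_{m=0}^{\Lambda_{k}}c_{k,m}\,y_{1,j}^m\,(e(\mathbf k^1)\otimes\cdots\otimes e(\mathbf k^d))$ for all $j$ with $\lambda_j>0$ and all $\mathbf k^i\in\mathcal K_i^{\lambda_i}$ $(1\le i\le d)$, where $k=k^j_1$ and $y_{1,j}$ is the element $y_1$ of the $j$-th tensor factor. **Theorem.** For every $\lambda\models_dn$ one has $|J^\lambda|=m_\lambda$; label the rows and columns of matrices in $\mathrm{Mat}_{m_\lambda}$ by $J^\lambda$, with matrix units $E_{\mathfrak t',\mathfrak t}$. There is an isomorphism of $A$-algebras $$\Psi:\ H_n(Q)\ \xrightarrow{\ \sim\ }\ \bigoplus_{\lambda\models_dn}\mathrm{Mat}_{m_\lambda}H_\lambda(Q)$$ whose inverse is given by $vE_{\mathfrak t',\mathfrak t}\mapsto\psi_{\pi_{\mathfrak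 t'}^{-1}}\,\iota_\lambda(v)\,\psi_{\pi_{\mathfrak t}}$ for $v\in H_\lambda(Q)$ and $\mathfrak t,\mathfrak t'\in J^\lambda$. Here $\psi_w=\psi_{a_1}\cdots\psi_{a_r}$ for any choice of a reduced expression $w=s_{a_1}\cdots s_{a_r}$, and $\iota_\lambda:H_\lambda(Q)\to H_n(Q)$ is the (non-unital) algebra homomorphism which sends $e(\mathbf k^1)\otimes\cdots\otimes e(\mathbf k^d)$ to $e(\mathbf k^1,\dots,\mathbf k^d)$ and the generators $y_b$, $\psi_b$ of the $j$-th tensor factor to $y_{\lambda_1+\cdots+\lambda_{j-1}+b}\,e_\lambda$ and $\psi_{\lambda_1+\cdots+\lambda_{j-1}+b}\,e_\lambda$. This isomorphism satisfies $$\Psi(\mathfrak I)=\bigoplus_{\lambda\models_dn}\mathrm{Mat}_{m_\lambda}\mathfrak I_\lambda ,$$ and it descends to the cyclotomic quotients: there is an isomorphism of $A$-algebras $$\Psi^\Lambda:\ H_n^\Lambda(Q)\ \xrightarrow{\ \sim\ }\ \bigoplus_{\lambda\models_dn}\mathrm{Mat}_{m_\lambda}\bigl(H^{\Lambda^1}_{\lambda_1}(Q^1)\otimes\cdots\otimes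 H^{\Lambda^d}_{\lambda_d}(Q^d)\bigr)$$ such that $\Psi^\Lambda$ composed with the quotient map $H_n(Q)\to H_n^\Lambda(Q)$ equals $\Psi$ followed by the entrywise quotient maps $H_\lambda(Q)\to H_\lambda^\Lambda(Q)$. -/

import Mathlib

open scoped TensorProduct

noncomputable section

namespace QuiverHecke

/-! ### Symmetric group combinatorics on `n` letters (positions are numbered from `0`) -/

/-- Indices of the simple transpositions: `a` stands for the transposition `s_a` of the positions
`a` and `a + 1`. -/
abbrev SimpleIdx (n : ℕ) : Type := {a : ℕ // a + 1 < n}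

/-- The position `a`. -/
def SimpleIdx.fst {n : ℕ} (a : SimpleIdx n) : Fin n := ⟨a.1, Nat.lt_of_succ_lt a.2⟩

/-- The position `a + 1`. -/
def SimpleIdx.snd {n : ℕ} (a : SimpleIdx n) : Fin n := ⟨a.1 + 1, a.2⟩

/-- The simple transposition `s_a`. -/
def simplePerm {n : ℕ} (a : SimpleIdx n) : Equiv.Perm (Fin n) := Equiv.swap a.fst a.snd

/-- The left action on tuples, `(w · x)_a = x_{w⁻¹(a)}`. -/
def permAct {n : ℕ} {X : Type*} (w : Equiv.Perm (Fin n)) (x : Fin n → X) : Fin n → X :=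
  fun a => x (w⁻¹ a)

/-- The product `s_{a_1} ⋯ s_{a_r}`. -/
def wordPerm {n : ℕ} (w : List (SimpleIdx n)) : Equiv.Perm (Fin n) := (w.map simplePerm).prod

/-- The Coxeter length of a permutation. -/
def permLength {n : ℕ} (σ : Equiv.Perm (Fin n)) : ℕ :=
  sInf {r : ℕ | ∃ w : List (SimpleIdx n), wordPerm w = σ ∧ w.length = r}

/-- `w` is a reduced expression of `σ`. -/
def IsReducedExpr {n : ℕ} (w : List (SimpleIdx n)) (σ : Equiv.Perm (Fin n)) : Prop :=
  wordPerm w = σ ∧ w.length = permLength σ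

/-! ### Quiver Hecke algebras -/

section Polynomials

variable {A : Type*} [CommRing A] {B : Type*} [Ring B] [Algebra A B]

/-- `P(u, v)` for `P ∈ A[u, v]`, at elements `u, v` of an `A`-algebra
(only used when the values commute). -/
def polyEval (P : MvPolynomial (Fin 2) A) (u v : B) : B :=
  ∑ m ∈ P.support, P.coeff m • (u ^ m 0 * v ^ m 1)

/-- `(P(u, v) - P(w, v)) / (u - w)`, expanded as a polynomial in `u, v, w` by means of
`(u ^ i - w ^ i) / (u - w) = ∑_{p < i} u ^ p w ^ (i - 1 - p)`. -/
def polyDivDiff (P : MvPolynomial (Fin 2) A) (u v w : B) : B :=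
  ∑ m ∈ P.support, P.coeff m •
    ((∑ p ∈ Finset.range (m 0), u ^ p * w ^ (m 0 - 1 - p)) * v ^ m 1)

/-- In a commutative algebra `polyDivDiff` is the divided difference. -/
theorem polyDivDiff_mul_sub {C : Type*} [CommRing C] [Algebra A C]
    (P : MvPolynomial (Fin 2) A) (u v w : C) :
    polyDivDiff P u v w * (u - w) = polyEval P u v - polyEval P w v := by
  unfold polyDivDiff polyEval
  rw [← Finset.sum_sub_distrib, Finset.sum_mul]
  refine Finset.sum_congr rfl fun m _ => ?_
  rw [← smul_sub, ← sub_mul, smul_mul_assoc, mul_right_comm, Commute.geom_sum₂_mul (mul_comm u w)]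

end Polynomials

/-- The generators of `H_n(Q)`: `e(k)`, `y_a` and `ψ_a`. -/
inductive Gen (K : Type*) (n : ℕ) : Type _
  | e (k : Fin n → K) : Gen K n
  | y (a : Fin n) : Gen K n
  | psi (a : SimpleIdx n) : Gen K n

section Algebras

variable {A : Type*} [CommRing A] {K : Type*}

/-- `e(k)` in the free algebra. -/
def fe (A : Type*) [CommRing A] {K : Type*} {n : ℕ} (k : Fin n → K) : FreeAlgebra A (Gen K n) :=
  FreeAlgebra.ι A (Gen.e k)

/-- `y_a` in the free algebra. -/
def fy (A : Type*) [CommRing A] (K : Type*) {n : ℕ} (a : Fin n) : FreeAlgebra A (Gen K n) :=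
  FreeAlgebra.ι A (Gen.y a)

/-- `ψ_a` in the free algebra. -/
def fpsi (A : Type*) [CommRing A] (K : Type*) {n : ℕ} (a : SimpleIdx n) :
    FreeAlgebra A (Gen K n) :=
  FreeAlgebra.ι A (Gen.psi a)

/-- The defining relations of `H_n(Q)`. -/
inductive Rel [Fintype K] (Q : K → K → MvPolynomial (Fin 2) A) (n : ℕ) :
    FreeAlgebra A (Gen K n) → FreeAlgebra A (Gen K n) → Prop
  | sum_e : Rel Q n (∑ k : Fin n → K, fe A k) 1
  | e_mul_self (k : Fin n → K) : Rel Q n (fe A k * fe A k) (fe A k)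
  | e_mul_ne (k k' : Fin n → K) (h : k ≠ k') : Rel Q n (fe A k * fe A k') 0
  | y_e (a : Fin n) (k : Fin n → K) : Rel Q n (fy A K a * fe A k) (fe A k * fy A K a)
  | psi_e (a : SimpleIdx n) (k : Fin n → K) :
      Rel Q n (fpsi A K a * fe A k) (fe A (permAct (simplePerm a) k) * fpsi A K a)
  | y_y (a b : Fin n) : Rel Q n (fy A K a * fy A K b) (fy A K b * fy A K a)
  | psi_y (a : SimpleIdx n) (b : Fin n) (h : b ≠ a.fst) (h' : b ≠ a.snd) :
      Rel Q n (fpsi A K a * fy A K b) (fy A K b * fpsi A K a)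
  | psi_psi (a b : SimpleIdx n) (h : a.1 + 1 < b.1 ∨ b.1 + 1 < a.1) :
      Rel Q n (fpsi A K a * fpsi A K b) (fpsi A K b * fpsi A K a)
  | psi_y_snd_eq (a : SimpleIdx n) (k : Fin n → K) (h : k a.fst = k a.snd) :
      Rel Q n (fpsi A K a * fy A K a.snd * fe A k)
        ((fy A K a.fst * fpsi A K a + 1) * fe A k)
  | psi_y_snd_ne (a : SimpleIdx n) (k : Fin n → K) (h : k a.fst ≠ k a.snd) :
      Rel Q n (fpsi A K a * fy A K a.snd * fe A k)
        (fy A K a.fst * fpsi A K a * fe A k)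
  | y_snd_psi_eq (a : SimpleIdx n) (k : Fin n → K) (h : k a.fst = k a.snd) :
      Rel Q n (fy A K a.snd * fpsi A K a * fe A k)
        ((fpsi A K a * fy A K a.fst + 1) * fe A k)
  | y_snd_psi_ne (a : SimpleIdx n) (k : Fin n → K) (h : k a.fst ≠ k a.snd) :
      Rel Q n (fy A K a.snd * fpsi A K a * fe A k)
        (fpsi A K a * fy A K a.fst * fe A k)
  | psi_sq (a : SimpleIdx n) (k : Fin n → K) :
      Rel Q n (fpsi A K a * fpsi A K a * fe A k)
        (polyEval (Q (k a.fst) (k a.snd)) (fy A K a.fst) (fy A K a.snd) * fe A k)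
  | braid_eq (a b : SimpleIdx n) (hab : b.1 = a.1 + 1) (k : Fin n → K)
      (h : k a.fst = k b.snd) :
      Rel Q n (fpsi A K b * fpsi A K a * fpsi A K b * fe A k)
        (fpsi A K a * fpsi A K b * fpsi A K a * fe A k +
          polyDivDiff (Q (k a.fst) (k a.snd)) (fy A K a.fst) (fy A K a.snd) (fy A K b.snd) *
            fe A k)
  | braid_ne (a b : SimpleIdx n) (hab : b.1 = a.1 + 1) (k : Fin n → K)
      (h : k a.fst ≠ k b.snd) :
      Rel Q n (fpsi A K b * fpsi A K a * fpsi A K b * fe A k)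
        (fpsi A K a * fpsi A K b * fpsi A K a * fe A k)

variable [Fintype K]

/-- The quiver Hecke algebra `H_n(Q)`. -/
def Hecke (Q : K → K → MvPolynomial (Fin 2) A) (n : ℕ) : Type _ := RingQuot (Rel Q n)

instance (Q : K → K → MvPolynomial (Fin 2) A) (n : ℕ) : Ring (Hecke Q n) :=
  inferInstanceAs (Ring (RingQuot (Rel Q n)))

instance (Q : K → K → MvPolynomial (Fin 2) A) (n : ℕ) : Algebra A (Hecke Q n) :=
  inferInstanceAs (Algebra A (RingQuot (Rel Q n)))

/-- The projection from the free algebra. -/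
def Hecke.mk (Q : K → K → MvPolynomial (Fin 2) A) (n : ℕ) :
    FreeAlgebra A (Gen K n) →ₐ[A] Hecke Q n :=
  RingQuot.mkAlgHom A (Rel Q n)

/-- The generator `e(k)` of `H_n(Q)`. -/
def Hecke.e (Q : K → K → MvPolynomial (Fin 2) A) {n : ℕ} (k : Fin n → K) : Hecke Q n :=
  Hecke.mk Q n (fe A k)

/-- The generator `y_a` of `H_n(Q)`. -/
def Hecke.y (Q : K → K → MvPolynomial (Fin 2) A) {n : ℕ} (a : Fin n) : Hecke Q n :=
  Hecke.mk Q n (fy A K a)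

/-- The generator `ψ_a` of `H_n(Q)`. -/
def Hecke.psi (Q : K → K → MvPolynomial (Fin 2) A) {n : ℕ} (a : SimpleIdx n) : Hecke Q n :=
  Hecke.mk Q n (fpsi A K a)

/-- `ψ_{a_1} ⋯ ψ_{a_r}`. -/
def Hecke.psiWord (Q : K → K → MvPolynomial (Fin 2) A) {n : ℕ} (w : List (SimpleIdx n)) :
    Hecke Q n :=
  (w.map (Hecke.psi Q)).prod

/-- The cyclotomic ideal of `H_n(Q)`: the two-sided ideal generated by the elements
`∑_{m ≤ Λ_{k_1}} c_{k_1, m} y_1 ^ m e(k)`, for all `k` (no element if `n = 0`). -/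
def cycIdeal (Q : K → K → MvPolynomial (Fin 2) A) (Λ : K → ℕ) (c : K → ℕ → A) (n : ℕ) :
    TwoSidedIdeal (Hecke Q n) :=
  TwoSidedIdeal.span {x | ∃ (hn : 0 < n) (k : Fin n → K),
    x = ∑ m ∈ Finset.range (Λ (k ⟨0, hn⟩) + 1),
      c (k ⟨0, hn⟩) m • (Hecke.y Q ⟨0, hn⟩ ^ m * Hecke.e Q k)}

/-- The cyclotomic quiver Hecke algebra `H_n^Λ(Q)`. -/
abbrev CycHecke (Q : K → K → MvPolynomial (Fin 2) A) (Λ : K → ℕ) (c : K → ℕ → A) (n : ℕ) :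
    Type _ :=
  (cycIdeal Q Λ c n).ringCon.Quotient

/-- The quotient map `H_n(Q) → H_n^Λ(Q)`. -/
def cycMk (Q : K → K → MvPolynomial (Fin 2) A) (Λ : K → ℕ) (c : K → ℕ → A) (n : ℕ) :
    Hecke Q n →ₐ[A] CycHecke Q Λ c n :=
  RingCon.mkₐ A (cycIdeal Q Λ c n).ringCon

end Algebras

/-! ### Compositions, tableaux and shapes -/

/-- The compositions `λ = (λ_1, …, λ_d)` of `n` into `d` parts, zero parts allowed. -/
abbrev Comp (d n : ℕ) : Type := {l : Fin d → ℕ // ∑ j, l j = n}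

/-- `J^λ`: the tuples `t ∈ {1, …, d}^n` in which each `j` occurs exactly `λ_j` times. -/
abbrev Shape {d n : ℕ} (l : Comp d n) : Type :=
  {t : Fin n → Fin d // ∀ j, (Finset.univ.filter fun a => t a = j).card = l.1 j}

/-- The decomposition of `{1, …, n}` into consecutive blocks of lengths `λ_1, …, λ_d`: the pair
`(j, b)` is sent to the `b`-th position of the `j`-th block, `λ_1 + ⋯ + λ_{j - 1} + b`. -/
def blockEquiv {d n : ℕ} (l : Comp d n) : ((j : Fin d) × Fin (l.1 j)) ≃ Fin n :=
  finSigmaFinEquiv.trans (finCongr l.2)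

theorem blockEquiv_val {d n : ℕ} (l : Comp d n) (j : Fin d) (b : Fin (l.1 j)) :
    (blockEquiv l ⟨j, b⟩ : ℕ) = ∑ i : Fin j, l.1 (Fin.castLE j.2.le i) + b := by
  simp [blockEquiv, finSigmaFinEquiv_apply]

/-- The tuple `t^λ = (1, …, 1, …, d, …, d)`. -/
def trivialTuple {d n : ℕ} (l : Comp d n) : Fin n → Fin d := fun a => ((blockEquiv l).symm a).1

/-- The simple transposition of `𝔖_{λ_j}` with index `b`, viewed in `𝔖_n` through the `j`-th
block. -/
def blockSimple {d n : ℕ} (l : Comp d n) (j : Fin d) (b : SimpleIdx (l.1 j)) : SimpleIdx n :=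
  ⟨blockEquiv l ⟨j, b.fst⟩, by
    have h := (blockEquiv l ⟨j, b.snd⟩).2
    rw [blockEquiv_val] at h ⊢
    exact h⟩

/-- `π` is the minimal length element `π_t` with `π · t = t^λ`. -/
def IsSortingPerm {d n : ℕ} {l : Comp d n} (t : Shape l) (π : Equiv.Perm (Fin n)) : Prop :=
  permAct π t.1 = trivialTuple l ∧
    ∀ π' : Equiv.Perm (Fin n), permAct π' t.1 = trivialTuple l → permLength π ≤ permLength π'

section Disjoint

variable {A : Type*} [CommRing A] {K : Type*} [Fintype K] {d n : ℕ}

/-- The part `K_j` of the partition of `K` given by the fibres of `p`. -/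
abbrev Part (p : K → Fin d) (j : Fin d) : Type _ := {k : K // p k = j}

/-- The submatrix `Q^j` of `Q` indexed by `K_j`. -/
def subQ (p : K → Fin d) (Q : K → K → MvPolynomial (Fin 2) A) (j : Fin d) :
    Part p j → Part p j → MvPolynomial (Fin 2) A :=
  fun k k' => Q k.1 k'.1

/-- `H_λ(Q) = H_{λ_1}(Q^1) ⊗ ⋯ ⊗ H_{λ_d}(Q^d)`. -/
abbrev TensorHecke (p : K → Fin d) (Q : K → K → MvPolynomial (Fin 2) A) (l : Comp d n) :
    Type _ :=
  ⨂[A] j : Fin d, Hecke (subQ p Q j) (l.1 j)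

/-- `H_λ^Λ(Q) = H_{λ_1}^{Λ^1}(Q^1) ⊗ ⋯ ⊗ H_{λ_d}^{Λ^d}(Q^d)`. -/
abbrev TensorCycHecke (p : K → Fin d) (Q : K → K → MvPolynomial (Fin 2) A) (Λ : K → ℕ)
    (c : K → ℕ → A) (l : Comp d n) : Type _ :=
  ⨂[A] j : Fin d,
    CycHecke (subQ p Q j) (fun k : Part p j => Λ k.1) (fun k : Part p j => c k.1) (l.1 j)

/-- The tensor product `H_λ(Q) → H_λ^Λ(Q)` of the quotient maps. -/
def tensorCycMk (p : K → Fin d) (Q : K → K → MvPolynomial (Fin 2) A) (Λ : K → ℕ)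
    (c : K → ℕ → A) (l : Comp d n) :
    TensorHecke p Q l →ₗ[A] TensorCycHecke p Q Λ c l :=
  PiTensorProduct.map fun j =>
    (cycMk (subQ p Q j) (fun k : Part p j => Λ k.1) (fun k : Part p j => c k.1)
      (l.1 j)).toLinearMap

/-- `e^⊗(k^1, …, k^d) = e(k^1) ⊗ ⋯ ⊗ e(k^d)`. -/
def tensorE (p : K → Fin d) (Q : K → K → MvPolynomial (Fin 2) A) (l : Comp d n)
    (k : (j : Fin d) → Fin (l.1 j) → Part p j) : TensorHecke p Q l :=
  PiTensorProduct.tprod A fun j => Hecke.e (subQ p Q j) (k j)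

/-- The generator `y_b` of the `j`-th tensor factor, as an element of `H_λ(Q)`. -/
def tensorY (p : K → Fin d) (Q : K → K → MvPolynomial (Fin 2) A) (l : Comp d n)
    (j : Fin d) (b : Fin (l.1 j)) : TensorHecke p Q l :=
  PiTensorProduct.singleAlgHom (R := A) (A := fun j => Hecke (subQ p Q j) (l.1 j)) j
    (Hecke.y (subQ p Q j) b)

/-- The generator `ψ_b` of the `j`-th tensor factor, as an element of `H_λ(Q)`. -/
def tensorPsi (p : K → Fin d) (Q : K → K → MvPolynomial (Fin 2) A) (l : Comp d n)
    (j : Fin d) (b : SimpleIdx (l.1 j)) : TensorHecke p Q l :=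
  PiTensorProduct.singleAlgHom (R := A) (A := fun j => Hecke (subQ p Q j) (l.1 j)) j
    (Hecke.psi (subQ p Q j) b)

/-- The two-sided ideal of `H_λ(Q)` generated by the elements
`∑_{m ≤ Λ_{k^j_1}} c_{k^j_1, m} y_1 ^ m e^⊗(k^1, …, k^d)`, where `y_1` is the first `y` of the
`j`-th tensor factor and `j` runs over the indices with `λ_j > 0`. -/
def tensorCycIdeal (p : K → Fin d) (Q : K → K → MvPolynomial (Fin 2) A) (Λ : K → ℕ)
    (c : K → ℕ → A) (l : Comp d n) : TwoSidedIdeal (TensorHecke p Q l) :=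
  TwoSidedIdeal.span {x | ∃ (j : Fin d) (hj : 0 < l.1 j)
      (k : (j : Fin d) → Fin (l.1 j) → Part p j),
    x = ∑ m ∈ Finset.range (Λ (k j ⟨0, hj⟩).1 + 1),
      c (k j ⟨0, hj⟩).1 m • (tensorY p Q l j ⟨0, hj⟩ ^ m * tensorE p Q l k)}

/-- The concatenation of `(k^1, …, k^d) ∈ K_1^{λ_1} × ⋯ × K_d^{λ_d}`, an element of `K^n`. -/
def concat (p : K → Fin d) (l : Comp d n) (k : (j : Fin d) → Fin (l.1 j) → Part p j) :
    Fin n → K :=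
  fun a => (k ((blockEquiv l).symm a).1 ((blockEquiv l).symm a).2).1

/-- The idempotent `e_λ = e(t^λ)`, the sum of the `e(k)` with `k_a ∈ K_{t^λ_a}` for all `a`. -/
def eTrivial (p : K → Fin d) (Q : K → K → MvPolynomial (Fin 2) A) (l : Comp d n) :
    Hecke Q n :=
  ∑ k : {k : Fin n → K // ∀ a, p (k a) = trivialTuple l a}, Hecke.e Q k.1

/-- `f` is the (non-unital) algebra homomorphism `H_λ(Q) → H_n(Q)` identifying `H_λ(Q)` with
`e_λ H_n(Q) e_λ`. -/
def IsBlockEmbedding (p : K → Fin d) (Q : K → K → MvPolynomial (Fin 2) A) (l : Comp d n)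
    (f : TensorHecke p Q l →ₙₐ[A] Hecke Q n) : Prop :=
  (∀ k, f (tensorE p Q l k) = Hecke.e Q (concat p l k)) ∧
  (∀ j b, f (tensorY p Q l j b) = Hecke.y Q (blockEquiv l ⟨j, b⟩) * eTrivial p Q l) ∧
  (∀ j b, f (tensorPsi p Q l j b) = Hecke.psi Q (blockSimple l j b) * eTrivial p Q l)

/-- `Ψ` is the isomorphism `H_n(Q) ≃ ⊕_λ Mat_{J^λ} H_λ(Q)` whose inverse sends `v E_{t', t}` to
`ψ_{π_{t'}⁻¹} v ψ_{π_t}`, where `H_λ(Q)` is identified with `e_λ H_n(Q) e_λ` and arbitrary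
reduced expressions of `π_{t'}⁻¹` and `π_t` are used. -/
def IsDisjointIso (p : K → Fin d) (Q : K → K → MvPolynomial (Fin 2) A)
    (Ψ : Hecke Q n ≃ₐ[A]
      ((l : Comp d n) → Matrix (Shape l) (Shape l) (TensorHecke p Q l))) : Prop :=
  ∀ l : Comp d n, ∃ f : TensorHecke p Q l →ₙₐ[A] Hecke Q n, IsBlockEmbedding p Q l f ∧
    ∀ (t' t : Shape l) (π' π : Equiv.Perm (Fin n)), IsSortingPerm t' π' → IsSortingPerm t π →
    ∀ w' w : List (SimpleIdx n), IsReducedExpr w' π'⁻¹ → IsReducedExpr w π →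
    ∀ v : TensorHecke p Q l,
      Ψ.symm (Pi.single l (Matrix.single t' t v)) =
        Hecke.psiWord Q w' * f v * Hecke.psiWord Q w

end Disjoint

end QuiverHecke

end

open QuiverHecke
open scoped Nat

open scoped TensorProduct

noncomputable section

namespace QuiverHecke

/-! ### Families satisfying the quiver Hecke relations, and the universal property of `H_n(Q)`. -/

section Representations

variable {A : Type*} [CommRing A] {K : Type*} {B C : Type*} [Ring B] [Algebra A B]
  [Ring C] [Algebra A C]

/-! The map `Ψ` is constructed as a representation. Fix `λ` and let `π_t` be the stable sorting
permutation of `t ∈ J^λ`. On the free right `H_λ(Q)`-module with basis `J^λ`, let `e(k)` and `y_i`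
act diagonally, at `t` by the elements of `H_λ(Q)` attached to `π_t · k` and `π_t(i)`. Let `ψ_a`
send `t` to `s_a · t`, with coefficient `1` if `t_a ≠ t_{a+1}`, and with coefficient `ψ_{π_t(a)}`
otherwise; this makes sense because equal neighbours remain neighbours, inside one block, under
stable sorting. The matrix of `e(k)` vanishes outside the column `t` given by the colours of `k`, so
each relation has to be checked in that column only. Between equal colours it is a relation of
`H_λ(Q)`; between distinct colours the Kronecker symbols vanish and `Q = 1`, so `ψ_a` squares to `1`
and braid corrections disappear (`IsBlockRep.matRep`, `IsBlockRep.mat_braid`).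

Surjectivity: the universal property of `H_λ(Q)` (`IsBlockRep.tensorLift`), applied to the corner
`e_λ H_n(Q) e_λ`, yields the embedding `blockEmb`, and `Ψ` maps the image of `v` to `v E` at the
diagonal place `t^λ`. A word of minimal length that sorts `t` never exchanges equal letters, so all
its matrix coefficients along the way are `1` (`wordCoeff_eq_one`). Hence `psiHom_word`, which
produces all the matrices with one entry and at the same time proves the formula for the inverse for
arbitrary reduced expressions.

Injectivity needs no basis of `H_n(Q)`. With `θ_t = thetaL` and `θ'_t = thetaR`, products of `ψ`s
along a chosen sorting of `t`, the linear map `invHom : M ↦ ∑ θ_{t'} ι_λ(M_{t',t}) θ'_t` satisfies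
`x · invHom M = invHom (Ψ(x) M)` and `invHom 1 = 1`, so that `x = invHom (Ψ x)`. The first identity
amounts to moving the generators past `θ_t`. It rests on the independence of `θ_t` from the order in
which descents are removed (`psi_thetaL_descent`, a diamond argument) and on `psi_thetaL_of_eq`.

Cyclotomic quotients: stable sorting sends the first position to the start of its block
(`sortPos_zero`). So `Ψ` maps the cyclotomic generator at `k` to a matrix whose only possibly
nonzero entry is a generator of `𝔍_λ`. Every generator of `𝔍_λ` arises in this way, and matrix units
move it to all other entries (`mem_cycIdeal_iff`). Finally `𝔍_λ` is the kernel of `H_λ(Q) →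
H_λ^Λ(Q)`, by comparing universal properties (`tensorCycHom_eq_zero_iff`). -/

theorem map_polyEval (f : B →ₐ[A] C) (P : MvPolynomial (Fin 2) A) (u v : B) :
    f (polyEval P u v) = polyEval P (f u) (f v) := by
  simp [polyEval]

theorem map_polyDivDiff (f : B →ₐ[A] C) (P : MvPolynomial (Fin 2) A) (u v w : B) :
    f (polyDivDiff P u v w) = polyDivDiff P (f u) (f v) (f w) := by
  simp [polyDivDiff]

theorem polyEval_one (u v : B) : polyEval (1 : MvPolynomial (Fin 2) A) u v = 1 := by
  -- Over the zero ring the support of `1` is empty instead of `{0}`, but then `B` is zero as well.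
  rcases subsingleton_or_nontrivial A with h | h
  · have : Subsingleton B := Module.subsingleton A B
    exact Subsingleton.elim _ _
  · have hs : (1 : MvPolynomial (Fin 2) A).support = {0} := MvPolynomial.support_one
    simp [polyEval, hs]

theorem polyDivDiff_one (u v w : B) :
    polyDivDiff (1 : MvPolynomial (Fin 2) A) u v w = 0 := by
  rcases subsingleton_or_nontrivial A with h | h
  · have : Subsingleton B := Module.subsingleton A B
    exact Subsingleton.elim _ _
  · have hs : (1 : MvPolynomial (Fin 2) A).support = {0} := MvPolynomial.support_one
    simp [polyDivDiff, hs]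

open Classical in
/-- The Kronecker symbol with values in a ring. -/
def kron (B : Type*) [Ring B] (x y : K) : B := if x = y then 1 else 0

theorem kron_eq {x y : K} (h : x = y) : kron B x y = 1 := by simp [kron, h]

theorem kron_ne {x y : K} (h : x ≠ y) : kron B x y = 0 := by simp [kron, h]

@[simp] theorem map_kron (f : B →ₐ[A] C) (x y : K) : f (kron B x y) = kron C x y := by
  unfold kron; split_ifs <;> simp

/-- Elements of an `A`-algebra satisfying the relations of `H_n(Q)`, where the relations
involving `ψ_a` are only imposed for the indices `a` with `inner a`. -/
structure IsRep [Fintype K] (Q : K → K → MvPolynomial (Fin 2) A) {n : ℕ}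
    (inner : SimpleIdx n → Prop) (E : (Fin n → K) → B) (Y : Fin n → B) (P : SimpleIdx n → B) :
    Prop where
  sum_e : ∑ k, E k = 1
  e_mul_self (k) : E k * E k = E k
  e_mul_ne (k k') : k ≠ k' → E k * E k' = 0
  y_e (a k) : Y a * E k = E k * Y a
  psi_e (a k) : inner a → P a * E k = E (permAct (simplePerm a) k) * P a
  y_y (a b) : Y a * Y b = Y b * Y a
  psi_y (a b) : inner a → b ≠ a.fst → b ≠ a.snd → P a * Y b = Y b * P a
  psi_psi (a b) : inner a → inner b → (a.1 + 1 < b.1 ∨ b.1 + 1 < a.1) → P a * P b = P b * P a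
  psi_y_snd (a k) : inner a → P a * Y a.snd * E k =
    (Y a.fst * P a + kron B (k a.fst) (k a.snd)) * E k
  y_snd_psi (a k) : inner a → Y a.snd * P a * E k =
    (P a * Y a.fst + kron B (k a.fst) (k a.snd)) * E k
  psi_sq (a k) : inner a → P a * P a * E k =
    polyEval (Q (k a.fst) (k a.snd)) (Y a.fst) (Y a.snd) * E k
  braid (a b : SimpleIdx n) (k) : b.1 = a.1 + 1 → inner a → inner b →
    P b * P a * P b * E k = (P a * P b * P a + kron B (k a.fst) (k b.snd) *
      polyDivDiff (Q (k a.fst) (k a.snd)) (Y a.fst) (Y a.snd) (Y b.snd)) * E k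

variable [Fintype K] {Q : K → K → MvPolynomial (Fin 2) A} {n : ℕ}

theorem Hecke.mk_rel {x y : FreeAlgebra A (Gen K n)} (h : Rel Q n x y) :
    Hecke.mk Q n x = Hecke.mk Q n y :=
  RingQuot.mkAlgHom_rel A h

theorem Hecke.isRep (Q : K → K → MvPolynomial (Fin 2) A) (n : ℕ) :
    IsRep Q (fun _ : SimpleIdx n => True) (Hecke.e Q) (Hecke.y Q) (Hecke.psi Q) where
  sum_e := by simpa [Hecke.e] using Hecke.mk_rel (Rel.sum_e (Q := Q) (n := n))
  e_mul_self k := by simpa [Hecke.e] using Hecke.mk_rel (Rel.e_mul_self (Q := Q) k)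
  e_mul_ne k k' h := by simpa [Hecke.e] using Hecke.mk_rel (Rel.e_mul_ne (Q := Q) k k' h)
  y_e a k := by simpa [Hecke.e, Hecke.y] using Hecke.mk_rel (Rel.y_e (Q := Q) a k)
  psi_e a k _ := by simpa [Hecke.e, Hecke.psi] using Hecke.mk_rel (Rel.psi_e (Q := Q) a k)
  y_y a b := by simpa [Hecke.y] using Hecke.mk_rel (Rel.y_y (Q := Q) a b)
  psi_y a b _ h h' := by
    simpa [Hecke.y, Hecke.psi] using Hecke.mk_rel (Rel.psi_y (Q := Q) a b h h')
  psi_psi a b _ _ h := by simpa [Hecke.psi] using Hecke.mk_rel (Rel.psi_psi (Q := Q) a b h)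
  psi_y_snd a k _ := by
    by_cases h : k a.fst = k a.snd
    · simpa [Hecke.e, Hecke.y, Hecke.psi, kron_eq h] using
        Hecke.mk_rel (Rel.psi_y_snd_eq (Q := Q) a k h)
    · simpa [Hecke.e, Hecke.y, Hecke.psi, kron_ne h] using
        Hecke.mk_rel (Rel.psi_y_snd_ne (Q := Q) a k h)
  y_snd_psi a k _ := by
    by_cases h : k a.fst = k a.snd
    · simpa [Hecke.e, Hecke.y, Hecke.psi, kron_eq h] using
        Hecke.mk_rel (Rel.y_snd_psi_eq (Q := Q) a k h)
    · simpa [Hecke.e, Hecke.y, Hecke.psi, kron_ne h] using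
        Hecke.mk_rel (Rel.y_snd_psi_ne (Q := Q) a k h)
  psi_sq a k _ := by
    simpa [Hecke.e, Hecke.y, Hecke.psi, map_polyEval] using
      Hecke.mk_rel (Rel.psi_sq (Q := Q) a k)
  braid a b k hab _ _ := by
    by_cases h : k a.fst = k b.snd
    · simpa [Hecke.e, Hecke.y, Hecke.psi, kron_eq h, map_polyDivDiff, add_mul] using
        Hecke.mk_rel (Rel.braid_eq (Q := Q) a b hab k h)
    · simpa [Hecke.e, Hecke.y, Hecke.psi, kron_ne h, add_mul] using
        Hecke.mk_rel (Rel.braid_ne (Q := Q) a b hab k h)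

/-- The map on generators given by three families. -/
def genMap (E : (Fin n → K) → B) (Y : Fin n → B) (P : SimpleIdx n → B) : Gen K n → B
  | .e k => E k
  | .y a => Y a
  | .psi a => P a

variable {E : (Fin n → K) → B} {Y : Fin n → B} {P : SimpleIdx n → B}

section lift

variable (h : IsRep Q (fun _ : SimpleIdx n => True) E Y P)
include h

theorem IsRep.lift_rel ⦃x y : FreeAlgebra A (Gen K n)⦄ (hxy : Rel Q n x y) :
    FreeAlgebra.lift A (genMap E Y P) x = FreeAlgebra.lift A (genMap E Y P) y := by
  induction hxy with
  | sum_e => simpa [fe, genMap] using h.sum_e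
  | e_mul_self k => simpa [fe, genMap] using h.e_mul_self k
  | e_mul_ne k k' hk => simpa [fe, genMap] using h.e_mul_ne k k' hk
  | y_e a k => simpa [fe, fy, genMap] using h.y_e a k
  | psi_e a k => simpa [fe, fpsi, genMap] using h.psi_e a k trivial
  | y_y a b => simpa [fy, genMap] using h.y_y a b
  | psi_y a b h1 h2 => simpa [fy, fpsi, genMap] using h.psi_y a b trivial h1 h2
  | psi_psi a b hab => simpa [fpsi, genMap] using h.psi_psi a b trivial trivial hab
  | psi_y_snd_eq a k hk =>
    simpa [fe, fy, fpsi, genMap, kron_eq hk] using h.psi_y_snd a k trivial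
  | psi_y_snd_ne a k hk =>
    simpa [fe, fy, fpsi, genMap, kron_ne hk] using h.psi_y_snd a k trivial
  | y_snd_psi_eq a k hk =>
    simpa [fe, fy, fpsi, genMap, kron_eq hk] using h.y_snd_psi a k trivial
  | y_snd_psi_ne a k hk =>
    simpa [fe, fy, fpsi, genMap, kron_ne hk] using h.y_snd_psi a k trivial
  | psi_sq a k => simpa [fe, fy, fpsi, genMap, map_polyEval] using h.psi_sq a k trivial
  | braid_eq a b hab k hk =>
    simpa [fe, fy, fpsi, genMap, kron_eq hk, map_polyDivDiff, add_mul] using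
      h.braid a b k hab trivial trivial
  | braid_ne a b hab k hk =>
    simpa [fe, fy, fpsi, genMap, kron_ne hk, add_mul] using h.braid a b k hab trivial trivial

/-- The universal property of `H_n(Q)`. -/
def IsRep.lift : Hecke Q n →ₐ[A] B :=
  RingQuot.liftAlgHom A ⟨FreeAlgebra.lift A (genMap E Y P), h.lift_rel⟩

theorem IsRep.lift_mk (x : FreeAlgebra A (Gen K n)) :
    h.lift (Hecke.mk Q n x) = FreeAlgebra.lift A (genMap E Y P) x :=
  RingQuot.liftAlgHom_mkAlgHom_apply A _ h.lift_rel x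

@[simp] theorem IsRep.lift_e (k : Fin n → K) : h.lift (Hecke.e Q k) = E k := by
  simp [Hecke.e, fe, h.lift_mk, genMap]

@[simp] theorem IsRep.lift_y (a : Fin n) : h.lift (Hecke.y Q a) = Y a := by
  simp [Hecke.y, fy, h.lift_mk, genMap]

@[simp] theorem IsRep.lift_psi (a : SimpleIdx n) : h.lift (Hecke.psi Q a) = P a := by
  simp [Hecke.psi, fpsi, h.lift_mk, genMap]

end lift

theorem Hecke.mk_surjective (Q : K → K → MvPolynomial (Fin 2) A) (n : ℕ) :
    Function.Surjective (Hecke.mk Q n) :=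
  RingQuot.mkAlgHom_surjective A _

/-- `H_n(Q)` is generated by the `e(k)`, `y_a` and `ψ_a`. -/
theorem Hecke.mem_of_gen (S : Subalgebra A (Hecke Q n)) (he : ∀ k, Hecke.e Q k ∈ S)
    (hy : ∀ a, Hecke.y Q a ∈ S) (hpsi : ∀ a, Hecke.psi Q a ∈ S) (x : Hecke Q n) : x ∈ S := by
  obtain ⟨x, rfl⟩ := Hecke.mk_surjective Q n x
  induction x using FreeAlgebra.induction with
  | grade0 r => rw [AlgHom.commutes]; exact S.algebraMap_mem r
  | grade1 g =>
    cases g with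
    | e k => exact he k
    | y a => exact hy a
    | psi a => exact hpsi a
  | mul x y hx hy => rw [map_mul]; exact S.mul_mem hx hy
  | add x y hx hy => rw [map_add]; exact S.add_mem hx hy

/-- The centralizer of `b` is a subalgebra, so its preimage under `f` is everything once it contains
the generators. Used to show that the images of distinct tensor factors commute. -/
theorem Hecke.commute_of_gen (f : Hecke Q n →ₐ[A] B) (b : B)
    (he : ∀ k, Commute (f (Hecke.e Q k)) b) (hy : ∀ a, Commute (f (Hecke.y Q a)) b)
    (hpsi : ∀ a, Commute (f (Hecke.psi Q a)) b) (x : Hecke Q n) : Commute (f x) b := by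
  have hS := Hecke.mem_of_gen (Q := Q) (n := n) ((Subalgebra.centralizer A {b}).comap f)
  have := hS (fun k => ?_) (fun a => ?_) (fun a => ?_) x
  · exact ((Subalgebra.mem_centralizer_iff A).1 this b rfl).symm
  all_goals
    refine (Subalgebra.mem_centralizer_iff A).2 fun c hc => ?_
    obtain rfl := hc
  · exact (he k).symm
  · exact (hy a).symm
  · exact (hpsi a).symm

end Representations

/-! ### Block combinatorics -/

section Blocks

variable {d n : ℕ} (l : Comp d n)

theorem simplePerm_inv {n : ℕ} (a : SimpleIdx n) : (simplePerm a)⁻¹ = simplePerm a := by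
  simp [simplePerm]

theorem simplePerm_fst {n : ℕ} (a : SimpleIdx n) : simplePerm a a.fst = a.snd := by
  simp [simplePerm]

theorem simplePerm_snd {n : ℕ} (a : SimpleIdx n) : simplePerm a a.snd = a.fst := by
  simp [simplePerm]

theorem simplePerm_of_ne {n : ℕ} (a : SimpleIdx n) {i : Fin n} (h : i ≠ a.fst) (h' : i ≠ a.snd) :
    simplePerm a i = i := Equiv.swap_apply_of_ne_of_ne h h'

theorem SimpleIdx.fst_ne_snd {n : ℕ} (a : SimpleIdx n) : a.fst ≠ a.snd := by
  simp [SimpleIdx.fst, SimpleIdx.snd, Fin.ext_iff]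

theorem permAct_simplePerm {n : ℕ} {X : Type*} (a : SimpleIdx n) (x : Fin n → X) (i : Fin n) :
    permAct (simplePerm a) x i = x (simplePerm a i) := by
  rw [permAct, simplePerm_inv]

theorem blockSimple_fst (j : Fin d) (b : SimpleIdx (l.1 j)) :
    (blockSimple l j b).fst = blockEquiv l ⟨j, b.fst⟩ := rfl

theorem blockSimple_snd (j : Fin d) (b : SimpleIdx (l.1 j)) :
    (blockSimple l j b).snd = blockEquiv l ⟨j, b.snd⟩ := by
  ext
  simp only [SimpleIdx.snd, blockSimple, blockEquiv_val, SimpleIdx.fst]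
  ring

theorem trivialTuple_blockEquiv (j : Fin d) (b : Fin (l.1 j)) :
    trivialTuple l (blockEquiv l ⟨j, b⟩) = j := by
  simp [trivialTuple]

/-- The positions `a` and `a + 1` lie in the same block. -/
def InBlock (a : SimpleIdx n) : Prop := trivialTuple l a.fst = trivialTuple l a.snd

theorem inBlock_blockSimple (j : Fin d) (b : SimpleIdx (l.1 j)) : InBlock l (blockSimple l j b) := by
  rw [InBlock, blockSimple_fst, blockSimple_snd, trivialTuple_blockEquiv, trivialTuple_blockEquiv]

theorem exists_blockEquiv (i : Fin n) : ∃ j b, blockEquiv l ⟨j, b⟩ = i :=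
  ⟨((blockEquiv l).symm i).1, ((blockEquiv l).symm i).2, by simp⟩

/-- Neighbouring positions of one block have consecutive indices within that block. All relations
for in-block `ψ_a` are thereby moved to a single tensor factor. -/
theorem InBlock.exists_blockSimple {l : Comp d n} {a : SimpleIdx n} (h : InBlock l a) :
    ∃ j b, blockSimple l j b = a := by
  obtain ⟨j, x, hx⟩ := exists_blockEquiv l a.fst
  obtain ⟨j', x', hx'⟩ := exists_blockEquiv l a.snd
  rw [InBlock, ← hx, ← hx', trivialTuple_blockEquiv, trivialTuple_blockEquiv] at h
  subst h
  have h1 := congrArg Fin.val hx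
  have h2 := congrArg Fin.val hx'
  rw [blockEquiv_val] at h1 h2
  simp only [SimpleIdx.fst, SimpleIdx.snd] at h1 h2
  refine ⟨j, ⟨x, by have := x'.2; omega⟩, Subtype.ext ?_⟩
  simp only [blockSimple, SimpleIdx.fst, blockEquiv_val]
  exact h1

theorem blockSimple_injective : Function.Injective
    (fun jb : (j : Fin d) × SimpleIdx (l.1 j) => blockSimple l jb.1 jb.2) := by
  rintro ⟨j, b⟩ ⟨j', b'⟩ h
  have h := congrArg SimpleIdx.fst h
  simp only [blockSimple_fst, EmbeddingLike.apply_eq_iff_eq] at h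
  obtain ⟨rfl, h⟩ := Sigma.mk.inj_iff.1 h
  have h := congrArg Fin.val (eq_of_heq h)
  simp only [SimpleIdx.fst] at h
  rw [Subtype.ext h]

variable {K : Type*} (p : K → Fin d)

theorem concat_blockEquiv (k : (j : Fin d) → Fin (l.1 j) → Part p j) (j : Fin d)
    (b : Fin (l.1 j)) : concat p l k (blockEquiv l ⟨j, b⟩) = (k j b).1 := by
  rw [concat, Equiv.symm_apply_apply]

theorem p_concat (k : (j : Fin d) → Fin (l.1 j) → Part p j) (i : Fin n) :
    p (concat p l k i) = trivialTuple l i :=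
  (k ((blockEquiv l).symm i).1 ((blockEquiv l).symm i).2).2

theorem concat_injective : Function.Injective (concat p l) := by
  intro k k' h
  ext j b
  rw [← concat_blockEquiv, h, concat_blockEquiv]

theorem exists_concat (k : Fin n → K) (h : ∀ i, p (k i) = trivialTuple l i) :
    ∃ kk, concat p l kk = k := by
  refine ⟨fun j b => ⟨k (blockEquiv l ⟨j, b⟩), by rw [h, trivialTuple_blockEquiv]⟩, ?_⟩
  ext i
  obtain ⟨j, b, rfl⟩ := exists_blockEquiv l i
  rw [concat_blockEquiv]

theorem simplePerm_blockSimple (j : Fin d) (b : SimpleIdx (l.1 j)) (x : Fin (l.1 j)) :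
    simplePerm (blockSimple l j b) (blockEquiv l ⟨j, x⟩) = blockEquiv l ⟨j, simplePerm b x⟩ := by
  rcases eq_or_ne x b.fst with rfl | h1
  · rw [← blockSimple_fst, simplePerm_fst, simplePerm_fst, blockSimple_snd]
  rcases eq_or_ne x b.snd with rfl | h2
  · rw [← blockSimple_snd, simplePerm_snd, simplePerm_snd, blockSimple_fst]
  rw [simplePerm_of_ne b h1 h2, simplePerm_of_ne]
  · simpa [blockSimple_fst] using h1
  · simpa [blockSimple_snd] using h2

theorem simplePerm_blockSimple_of_ne {j j' : Fin d} (hj : j' ≠ j) (b : SimpleIdx (l.1 j))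
    (x : Fin (l.1 j')) :
    simplePerm (blockSimple l j b) (blockEquiv l ⟨j', x⟩) = blockEquiv l ⟨j', x⟩ := by
  rw [simplePerm_of_ne]
  · simp [blockSimple_fst, hj]
  · simp [blockSimple_snd, hj]

theorem permAct_concat (k : (j : Fin d) → Fin (l.1 j) → Part p j) (j : Fin d)
    (b : SimpleIdx (l.1 j)) :
    permAct (simplePerm (blockSimple l j b)) (concat p l k) =
      concat p l (Function.update k j (permAct (simplePerm b) (k j))) := by
  ext i
  obtain ⟨j', x, rfl⟩ := exists_blockEquiv l i
  rw [permAct_simplePerm, concat_blockEquiv]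
  rcases eq_or_ne j' j with rfl | h
  · rw [simplePerm_blockSimple, concat_blockEquiv, Function.update_self, permAct_simplePerm]
  · rw [simplePerm_blockSimple_of_ne l h, concat_blockEquiv, Function.update_of_ne h]

/-- An in-block transposition exchanges two positions at which `t^λ` has the same value, so it
preserves the property of having colours `t^λ`. -/
theorem p_permAct_of_inBlock {a : SimpleIdx n} (ha : InBlock l a) (k : Fin n → K)
    (h : ∀ i, p (permAct (simplePerm a) k i) = trivialTuple l i) (i : Fin n) :
    p (k i) = trivialTuple l i := by
  have h2 := h (simplePerm a i)
  rw [permAct_simplePerm] at h2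
  have hs : simplePerm a (simplePerm a i) = i := by simp [simplePerm]
  rw [hs] at h2
  rw [h2]
  rcases eq_or_ne i a.fst with rfl | h1
  · rw [simplePerm_fst, ha]
  rcases eq_or_ne i a.snd with rfl | h3
  · rw [simplePerm_snd, ha]
  rw [simplePerm_of_ne a h1 h3]

end Blocks

theorem kron_val {K B : Type*} [Ring B] {q : K → Prop} (x y : Subtype q) :
    kron B x.1 y.1 = kron B x y := by
  by_cases h : x = y
  · rw [kron_eq h, kron_eq (congrArg _ h)]
  · rw [kron_ne h, kron_ne (fun h' => h (Subtype.ext h'))]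

/-! ### Tensor products and representations of blocks -/

section Tensor

variable {A : Type*} [CommRing A] {K : Type*} [Fintype K] {d n : ℕ}

/-- The relations of `H_n(Q)` that only involve the blocks of `λ`, with `e(k) = 0` unless the
colours of `k` are `t^λ`. -/
structure IsBlockRep {B : Type*} [Ring B] [Algebra A B] (p : K → Fin d)
    (Q : K → K → MvPolynomial (Fin 2) A) (l : Comp d n)
    (E : (Fin n → K) → B) (Y : Fin n → B) (P : SimpleIdx n → B) : Prop
    extends IsRep Q (InBlock l) E Y P where
  supp (k) : ¬ (∀ i, p (k i) = trivialTuple l i) → E k = 0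

section single

variable {H : Fin d → Type*} [∀ j, Ring (H j)] [∀ j, Algebra A (H j)]

theorem singleAlgHom_mul_tprod (j : Fin d) (x : H j) (z : ∀ j, H j) :
    PiTensorProduct.singleAlgHom (R := A) j x * PiTensorProduct.tprod A z =
      PiTensorProduct.tprod A (Function.update z j (x * z j)) := by
  rw [PiTensorProduct.singleAlgHom_apply, PiTensorProduct.tprod_mul_tprod]
  congr 1
  funext i
  rcases eq_or_ne i j with rfl | h
  · simp
  · simp [h]

theorem tprod_mul_singleAlgHom (j : Fin d) (x : H j) (z : ∀ j, H j) :
    PiTensorProduct.tprod A z * PiTensorProduct.singleAlgHom (R := A) j x =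
      PiTensorProduct.tprod A (Function.update z j (z j * x)) := by
  rw [PiTensorProduct.singleAlgHom_apply, PiTensorProduct.tprod_mul_tprod]
  congr 1
  funext i
  rcases eq_or_ne i j with rfl | h
  · simp
  · simp [h]

theorem commute_singleAlgHom {i j : Fin d} (h : i ≠ j) (x : H i) (y : H j) :
    Commute (PiTensorProduct.singleAlgHom (R := A) i x)
      (PiTensorProduct.singleAlgHom (R := A) j y) := by
  rw [PiTensorProduct.singleAlgHom_apply, PiTensorProduct.singleAlgHom_apply]
  exact Commute.tprod (Pi.mulSingle_commute h x y)

variable {B : Type*} [Ring B] [Algebra A B]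

/-- The algebra homomorphism from a tensor product defined by homomorphisms with commuting
images. -/
def liftCommuting (g : ∀ j, H j →ₐ[A] B)
    (hg : Pairwise fun i j => ∀ x y, Commute (g i x) (g j y)) :
    (⨂[A] j, H j) →ₐ[A] B :=
  let F := MonoidHom.noncommPiCoprod (fun j => (g j : H j →* B)) hg
  -- Splitting off the `i`-th coordinate makes `F` visibly linear in it: the remaining factor does
  -- not depend on `x`.
  have key (m : ∀ j, H j) (i : Fin d) (x : H i) : F (Function.update m i x) =
      F (Function.update m i 1) * g i x := by
    have : Function.update m i x = Function.update m i 1 * Pi.mulSingle i x := by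
      funext j
      rcases eq_or_ne j i with rfl | h
      · simp
      · simp [h]
    rw [this, map_mul]
    congr 1
    exact MonoidHom.noncommPiCoprod_mulSingle _ _ _
  PiTensorProduct.liftAlgHom
    { toFun := F
      map_update_add' := by
        intro _ m i x y
        -- Multilinearity is required for an arbitrary decidability instance, whereas `key` is
        -- stated for the standard one.
        have hd : ‹DecidableEq (Fin d)› = instDecidableEqFin d := Subsingleton.elim _ _
        subst hd
        rw [key, map_add, mul_add, ← key, ← key]
      map_update_smul' := by
        intro _ m i c x
        have hd : ‹DecidableEq (Fin d)› = instDecidableEqFin d := Subsingleton.elim _ _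
        subst hd
        rw [key, map_smul, mul_smul_comm, ← key] }
    (map_one F) (map_mul F)

theorem liftCommuting_single (g : ∀ j, H j →ₐ[A] B)
    (hg : Pairwise fun i j => ∀ x y, Commute (g i x) (g j y)) (j : Fin d) (x : H j) :
    liftCommuting g hg (PiTensorProduct.singleAlgHom (R := A) j x) = g j x := by
  simp only [liftCommuting, PiTensorProduct.singleAlgHom_apply, PiTensorProduct.liftAlgHom_apply,
    PiTensorProduct.lift.tprod]
  exact MonoidHom.noncommPiCoprod_mulSingle (fun j => (g j : H j →* B)) (hcomm := hg) j x

/-- A subalgebra of a tensor product that contains the images of all factors is everything. -/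
theorem tensor_mem_of_single (S : Subalgebra A (⨂[A] j, H j))
    (h : ∀ j x, PiTensorProduct.singleAlgHom (R := A) j x ∈ S) (x : ⨂[A] j, H j) : x ∈ S := by
  have hx : ∀ z : ∀ j, H j, PiTensorProduct.tprod A z ∈ S := by
    intro z
    have hs : ∀ s : Finset (Fin d),
        PiTensorProduct.tprod A (fun j => if j ∈ s then z j else 1) ∈ S := by
      intro s
      induction s using Finset.induction_on with
      | empty => simp only [Finset.notMem_empty, if_false]; exact S.one_mem
      | insert i s hi ih =>
        have h1 := S.mul_mem (h i (z i)) ih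
        rw [singleAlgHom_mul_tprod] at h1
        convert h1 using 2
        funext j
        rcases eq_or_ne j i with rfl | hj
        · simp [hi]
        · simp [hj]
    simpa using hs Finset.univ
  induction x using PiTensorProduct.induction_on with
  | smul_tprod r z => exact S.smul_mem (hx z) r
  | add x y hx hy => exact S.add_mem hx hy

end single

variable (p : K → Fin d) (Q : K → K → MvPolynomial (Fin 2) A) (l : Comp d n)

/-- The element of `H_λ(Q)` corresponding to `e(k)`, for `k ∈ K^n`. -/
def flatE : (Fin n → K) → TensorHecke p Q l := Function.extend (concat p l) (tensorE p Q l) 0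

/-- The element of `H_λ(Q)` corresponding to `y_i`. -/
def flatY (i : Fin n) : TensorHecke p Q l :=
  tensorY p Q l ((blockEquiv l).symm i).1 ((blockEquiv l).symm i).2

/-- The element of `H_λ(Q)` corresponding to `ψ_a`, or `0` if `s_a` does not preserve the
blocks. -/
def flatPsi : SimpleIdx n → TensorHecke p Q l :=
  Function.extend (fun jb : (j : Fin d) × SimpleIdx (l.1 j) => blockSimple l jb.1 jb.2)
    (fun jb => tensorPsi p Q l jb.1 jb.2) 0

theorem flatE_concat (k) : flatE p Q l (concat p l k) = tensorE p Q l k :=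
  (concat_injective l p).extend_apply _ _ _

theorem flatE_supp (k : Fin n → K) (h : ¬ ∀ i, p (k i) = trivialTuple l i) :
    flatE p Q l k = 0 :=
  Function.extend_apply' _ _ _ fun ⟨kk, hk⟩ => h fun i => hk ▸ p_concat l p kk i

theorem flatY_blockEquiv (j b) : flatY p Q l (blockEquiv l ⟨j, b⟩) = tensorY p Q l j b := by
  simp only [flatY]
  rw [Equiv.symm_apply_apply]

theorem flatPsi_blockSimple (j b) :
    flatPsi p Q l (blockSimple l j b) = tensorPsi p Q l j b :=
  (blockSimple_injective l).extend_apply _ _ ⟨j, b⟩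

variable {p Q l}

theorem single_e_mul_tensorE (j : Fin d) (k : (j : Fin d) → Fin (l.1 j) → Part p j) :
    PiTensorProduct.singleAlgHom (R := A) (A := fun j => Hecke (subQ p Q j) (l.1 j)) j
      (Hecke.e (subQ p Q j) (k j)) * tensorE p Q l k = tensorE p Q l k := by
  rw [tensorE, singleAlgHom_mul_tprod, (Hecke.isRep _ _).e_mul_self, Function.update_eq_self]

/-- `e^⊗(k)` absorbs the idempotent `e(k^j)` of its `j`-th factor. This carries each relation of
`H_{λ_j}(Q^j)` that involves an `e(k^j)` over to the tensor product. -/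
theorem single_mul_tensorE_congr {j : Fin d} {k : (j : Fin d) → Fin (l.1 j) → Part p j}
    {x y : Hecke (subQ p Q j) (l.1 j)}
    (h : x * Hecke.e (subQ p Q j) (k j) = y * Hecke.e (subQ p Q j) (k j)) :
    PiTensorProduct.singleAlgHom (R := A) (A := fun j => Hecke (subQ p Q j) (l.1 j)) j x *
        tensorE p Q l k =
      PiTensorProduct.singleAlgHom (R := A) (A := fun j => Hecke (subQ p Q j) (l.1 j)) j y *
        tensorE p Q l k := by
  rw [← single_e_mul_tensorE j, ← mul_assoc, ← map_mul, h, map_mul, mul_assoc]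

theorem tensorPsi_mul_tensorE (j : Fin d) (b : SimpleIdx (l.1 j))
    (k : (j : Fin d) → Fin (l.1 j) → Part p j) :
    tensorPsi p Q l j b * tensorE p Q l k =
      tensorE p Q l (Function.update k j (permAct (simplePerm b) (k j))) * tensorPsi p Q l j b := by
  rw [tensorE, tensorPsi, singleAlgHom_mul_tprod, tensorE, tprod_mul_singleAlgHom]
  congr 1
  funext i
  rcases eq_or_ne i j with rfl | h
  · simp [(Hecke.isRep _ _).psi_e]
  · simp [h]

theorem sum_tensorE : ∑ k, tensorE p Q l k = 1 := by
  classical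
  have := (PiTensorProduct.tprod A (s := fun j => Hecke (subQ p Q j) (l.1 j))).map_sum
    (fun j (k : Fin (l.1 j) → Part p j) => Hecke.e (subQ p Q j) k)
  simp only [(Hecke.isRep _ _).sum_e] at this
  rw [PiTensorProduct.one_def]
  exact this.symm

theorem tensorY_mul_tensorE (j : Fin d) (b : Fin (l.1 j))
    (k : (j : Fin d) → Fin (l.1 j) → Part p j) :
    tensorY p Q l j b * tensorE p Q l k = tensorE p Q l k * tensorY p Q l j b := by
  rw [tensorE, tensorY, singleAlgHom_mul_tprod, tprod_mul_singleAlgHom, (Hecke.isRep _ _).y_e]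

theorem tensorE_mul_self (k) : tensorE p Q l k * tensorE p Q l k = tensorE p Q l k := by
  rw [tensorE, PiTensorProduct.tprod_mul_tprod]
  congr 1
  funext j
  exact (Hecke.isRep _ _).e_mul_self _

theorem tensorE_mul_ne (k k') (h : k ≠ k') : tensorE p Q l k * tensorE p Q l k' = 0 := by
  obtain ⟨j, hj⟩ := Function.ne_iff.1 h
  rw [tensorE, tensorE, PiTensorProduct.tprod_mul_tprod]
  refine (PiTensorProduct.tprod A).map_coord_zero j ?_
  exact (Hecke.isRep _ _).e_mul_ne _ _ hj

variable (p Q l) in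
-- Each relation lives either in a single tensor factor, where it is a defining relation, or in two
-- distinct factors, which commute. Inserting this family into `IsBlockRep.matRep` gives the
-- component of `Ψ` at `λ`.
theorem flat_isBlockRep : IsBlockRep p Q l (flatE p Q l) (flatY p Q l) (flatPsi p Q l) where
  supp := flatE_supp p Q l
  sum_e := by
    classical
    rw [← sum_tensorE]
    refine (Fintype.sum_of_injective (concat p l) (concat_injective l p) _ _ ?_ ?_).symm
    · intro k hk
      exact flatE_supp p Q l k fun h => hk (exists_concat l p k h)
    · intro k; rw [flatE_concat]
  e_mul_self k := by
    by_cases h : ∀ i, p (k i) = trivialTuple l i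
    · obtain ⟨k, rfl⟩ := exists_concat l p k h
      rw [flatE_concat, tensorE_mul_self]
    · rw [flatE_supp p Q l k h, zero_mul]
  e_mul_ne k k' hk := by
    by_cases h : ∀ i, p (k i) = trivialTuple l i
    · by_cases h' : ∀ i, p (k' i) = trivialTuple l i
      · obtain ⟨k, rfl⟩ := exists_concat l p k h
        obtain ⟨k', rfl⟩ := exists_concat l p k' h'
        rw [flatE_concat, flatE_concat, tensorE_mul_ne _ _ fun h => hk (congrArg _ h)]
      · rw [flatE_supp p Q l k' h', mul_zero]
    · rw [flatE_supp p Q l k h, zero_mul]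
  y_e i k := by
    by_cases h : ∀ i, p (k i) = trivialTuple l i
    · obtain ⟨k, rfl⟩ := exists_concat l p k h
      rw [flatE_concat, flatY, tensorY_mul_tensorE]
    · rw [flatE_supp p Q l k h, zero_mul, mul_zero]
  psi_e a k ha := by
    by_cases h : ∀ i, p (k i) = trivialTuple l i
    · obtain ⟨k, rfl⟩ := exists_concat l p k h
      obtain ⟨j, b, rfl⟩ := ha.exists_blockSimple
      rw [permAct_concat, flatE_concat, flatE_concat, flatPsi_blockSimple, tensorPsi_mul_tensorE]
    · rw [flatE_supp p Q l k h, mul_zero, flatE_supp p Q l _ fun h' =>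
        h (p_permAct_of_inBlock l p ha k h'), zero_mul]
  y_y i i' := by
    rw [flatY, flatY, tensorY, tensorY]
    generalize (blockEquiv l).symm i = x
    generalize (blockEquiv l).symm i' = x'
    obtain ⟨j, b⟩ := x
    obtain ⟨j', b'⟩ := x'
    rcases eq_or_ne j j' with rfl | h
    · rw [← map_mul, (Hecke.isRep _ _).y_y, map_mul]
    · exact commute_singleAlgHom h _ _
  psi_y a i ha h h' := by
    obtain ⟨j, b, rfl⟩ := ha.exists_blockSimple
    obtain ⟨j', x, rfl⟩ := exists_blockEquiv l i
    rw [flatPsi_blockSimple, flatY_blockEquiv, tensorPsi, tensorY]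
    rcases eq_or_ne j j' with rfl | hj
    · rw [blockSimple_fst] at h
      rw [blockSimple_snd] at h'
      rw [← map_mul, (Hecke.isRep _ _).psi_y b x trivial (by simpa using h) (by simpa using h'),
        map_mul]
    · exact commute_singleAlgHom hj _ _
  psi_psi a a' ha ha' h := by
    obtain ⟨j, b, rfl⟩ := ha.exists_blockSimple
    obtain ⟨j', b', rfl⟩ := ha'.exists_blockSimple
    rw [flatPsi_blockSimple, flatPsi_blockSimple, tensorPsi, tensorPsi]
    rcases eq_or_ne j j' with rfl | hj
    · simp only [blockSimple, blockEquiv_val, SimpleIdx.fst] at h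
      rw [← map_mul, (Hecke.isRep _ _).psi_psi b b' trivial trivial (by omega), map_mul]
    · exact commute_singleAlgHom hj _ _
  psi_y_snd a k ha := by
    by_cases h : ∀ i, p (k i) = trivialTuple l i
    · obtain ⟨k, rfl⟩ := exists_concat l p k h
      obtain ⟨j, b, rfl⟩ := ha.exists_blockSimple
      rw [flatE_concat, blockSimple_fst, blockSimple_snd, flatPsi_blockSimple, flatY_blockEquiv,
        flatY_blockEquiv, concat_blockEquiv, concat_blockEquiv, tensorPsi, tensorY, tensorY]
      have := single_mul_tensorE_congr (k := k)
        ((Hecke.isRep (subQ p Q j) (l.1 j)).psi_y_snd b (k j) trivial)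
      rwa [map_mul, map_add, map_mul, map_kron, ← kron_val] at this
    · rw [flatE_supp p Q l k h, mul_zero, mul_zero]
  y_snd_psi a k ha := by
    by_cases h : ∀ i, p (k i) = trivialTuple l i
    · obtain ⟨k, rfl⟩ := exists_concat l p k h
      obtain ⟨j, b, rfl⟩ := ha.exists_blockSimple
      rw [flatE_concat, blockSimple_fst, blockSimple_snd, flatPsi_blockSimple, flatY_blockEquiv,
        flatY_blockEquiv, concat_blockEquiv, concat_blockEquiv, tensorPsi, tensorY, tensorY]
      have := single_mul_tensorE_congr (k := k)
        ((Hecke.isRep (subQ p Q j) (l.1 j)).y_snd_psi b (k j) trivial)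
      rwa [map_mul, map_add, map_mul, map_kron, ← kron_val] at this
    · rw [flatE_supp p Q l k h, mul_zero, mul_zero]
  psi_sq a k ha := by
    by_cases h : ∀ i, p (k i) = trivialTuple l i
    · obtain ⟨k, rfl⟩ := exists_concat l p k h
      obtain ⟨j, b, rfl⟩ := ha.exists_blockSimple
      rw [flatE_concat, blockSimple_fst, blockSimple_snd, flatPsi_blockSimple, flatY_blockEquiv,
        flatY_blockEquiv, concat_blockEquiv, concat_blockEquiv, tensorPsi, tensorY, tensorY]
      have := single_mul_tensorE_congr (k := k)
        ((Hecke.isRep (subQ p Q j) (l.1 j)).psi_sq b (k j) trivial)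
      rwa [map_mul, map_polyEval] at this
    · rw [flatE_supp p Q l k h, mul_zero, mul_zero]
  braid a a' k haa' ha ha' := by
    by_cases h : ∀ i, p (k i) = trivialTuple l i
    · obtain ⟨k, rfl⟩ := exists_concat l p k h
      obtain ⟨j, b, rfl⟩ := ha.exists_blockSimple
      obtain ⟨j', b', rfl⟩ := ha'.exists_blockSimple
      -- The two transpositions share the position `a + 1`, which lies in both blocks.
      have hj : j = j' := by
        have h1 := trivialTuple_blockEquiv l j b.snd
        have h2 := trivialTuple_blockEquiv l j' b'.fst
        have h3 : blockEquiv l ⟨j, b.snd⟩ = blockEquiv l ⟨j', b'.fst⟩ := by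
          rw [← blockSimple_snd, ← blockSimple_fst]
          exact Fin.ext haa'.symm
        rw [← h1, h3, h2]
      subst hj
      have hb : b'.1 = b.1 + 1 := by
        simp only [blockSimple, blockEquiv_val, SimpleIdx.fst] at haa'
        omega
      simp only [flatE_concat, blockSimple_fst, blockSimple_snd, flatPsi_blockSimple,
        flatY_blockEquiv, concat_blockEquiv, tensorPsi, tensorY]
      have := single_mul_tensorE_congr (k := k)
        ((Hecke.isRep (subQ p Q j) (l.1 j)).braid b b' (k j) hb trivial trivial)
      rwa [map_mul, map_mul, map_add, map_mul, map_mul, map_mul, map_kron, map_polyDivDiff,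
        ← kron_val] at this
    · rw [flatE_supp p Q l k h, mul_zero, mul_zero]

end Tensor

/-! ### The universal property of `H_λ(Q)` -/

section BlockRep

variable {A : Type*} [CommRing A] {K : Type*} [Fintype K] {d n : ℕ} {B : Type*} [Ring B]
  [Algebra A B] {p : K → Fin d} {Q : K → K → MvPolynomial (Fin 2) A} {l : Comp d n}
  {E : (Fin n → K) → B} {Y : Fin n → B} {P : SimpleIdx n → B}

open Classical in
/-- The image of the generator `e(κ)` of the `j`-th tensor factor. -/
def blockE (p : K → Fin d) (l : Comp d n) (E : (Fin n → K) → B) (j : Fin d)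
    (κ : Fin (l.1 j) → Part p j) : B :=
  ∑ k : (j : Fin d) → Fin (l.1 j) → Part p j, if k j = κ then E (concat p l k) else 0

/-- The image of the generator `y_b` of the `j`-th tensor factor. -/
def blockY (l : Comp d n) (Y : Fin n → B) (j : Fin d) (b : Fin (l.1 j)) : B :=
  Y (blockEquiv l ⟨j, b⟩)

/-- The image of the generator `ψ_b` of the `j`-th tensor factor. -/
def blockPsi (l : Comp d n) (P : SimpleIdx n → B) (j : Fin d) (b : SimpleIdx (l.1 j)) : B :=
  P (blockSimple l j b)

namespace IsBlockRep

variable (h : IsBlockRep p Q l E Y P)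
include h

theorem sum_concat : ∑ k, E (concat p l k) = 1 := by
  classical
  rw [← h.sum_e]
  refine Fintype.sum_of_injective (concat p l) (concat_injective l p) _ _ ?_ fun k => rfl
  intro k hk
  exact h.supp k fun h => hk (exists_concat l p k h)

/-- The idempotents attached to colour `t^λ` already sum to `1`, so equalities may be tested on each
of them. -/
theorem ext_right {x y : B} (hxy : ∀ k, x * E (concat p l k) = y * E (concat p l k)) : x = y := by
  rw [← mul_one x, ← mul_one y, ← h.sum_concat, Finset.mul_sum, Finset.mul_sum]
  exact Finset.sum_congr rfl fun k _ => hxy k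

open Classical in
theorem blockE_mul (j : Fin d) (κ : Fin (l.1 j) → Part p j)
    (k : (j : Fin d) → Fin (l.1 j) → Part p j) :
    blockE p l E j κ * E (concat p l k) = if k j = κ then E (concat p l k) else 0 := by
  rw [blockE, Finset.sum_mul, Finset.sum_eq_single k]
  · split_ifs
    · exact h.e_mul_self _
    · rw [zero_mul]
  · intro k' _ hk
    split_ifs
    · exact h.e_mul_ne _ _ fun h' => hk (concat_injective l p h')
    · rw [zero_mul]
  · simp

theorem blockE_mul_self (k : (j : Fin d) → Fin (l.1 j) → Part p j) (j : Fin d) :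
    blockE p l E j (k j) * E (concat p l k) = E (concat p l k) := by
  rw [h.blockE_mul, if_pos rfl]

theorem blockE_mul_ne {j : Fin d} {κ : Fin (l.1 j) → Part p j}
    {k : (j : Fin d) → Fin (l.1 j) → Part p j} (hk : k j ≠ κ) :
    blockE p l E j κ * E (concat p l k) = 0 := by
  rw [h.blockE_mul, if_neg hk]

theorem blockPsi_mul (j : Fin d) (b : SimpleIdx (l.1 j))
    (k : (j : Fin d) → Fin (l.1 j) → Part p j) :
    blockPsi l P j b * E (concat p l k) =
      E (concat p l (Function.update k j (permAct (simplePerm b) (k j)))) * blockPsi l P j b := by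
  rw [blockPsi, h.psi_e _ _ (inBlock_blockSimple l j b), permAct_concat]

theorem commute_y_blockE (i : Fin n) (j : Fin d) (κ : Fin (l.1 j) → Part p j) :
    Y i * blockE p l E j κ = blockE p l E j κ * Y i := by
  refine h.ext_right fun k => ?_
  rw [mul_assoc, mul_assoc, h.y_e, ← mul_assoc (blockE p l E j κ)]
  by_cases hk : k j = κ
  · subst hk
    rw [h.blockE_mul_self, h.y_e]
  · rw [h.blockE_mul_ne hk, mul_zero, zero_mul]

theorem commute_blockPsi_blockE {i j : Fin d} (hij : i ≠ j) (b : SimpleIdx (l.1 i))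
    (κ : Fin (l.1 j) → Part p j) :
    blockPsi l P i b * blockE p l E j κ = blockE p l E j κ * blockPsi l P i b := by
  refine h.ext_right fun k => ?_
  rw [mul_assoc, mul_assoc, h.blockPsi_mul, ← mul_assoc (blockE p l E j κ)]
  have hu : Function.update k i (permAct (simplePerm b) (k i)) j = k j :=
    Function.update_of_ne hij.symm _ _
  by_cases hk : k j = κ
  · subst hk
    have h1 := h.blockE_mul_self (Function.update k i (permAct (simplePerm b) (k i))) j
    rw [hu] at h1
    rw [h.blockE_mul_self, h.blockPsi_mul, h1]
  · rw [h.blockE_mul_ne hk, mul_zero, h.blockE_mul_ne (by rwa [hu]), zero_mul]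

theorem commute_blockE_blockE (i j : Fin d) (κ : Fin (l.1 i) → Part p i)
    (κ' : Fin (l.1 j) → Part p j) :
    blockE p l E i κ * blockE p l E j κ' = blockE p l E j κ' * blockE p l E i κ := by
  classical
  refine h.ext_right fun k => ?_
  rw [mul_assoc, mul_assoc, h.blockE_mul, h.blockE_mul]
  split_ifs <;> simp_all [h.blockE_mul]

/-- The image of `e(κ)` is the sum of the `E(k)` whose `j`-th component is `κ`. A relation of the
`j`-th factor is therefore read off from the relations at these `k`. -/
theorem blockRep_of_mul {j : Fin d} {κ : Fin (l.1 j) → Part p j} {x y : B}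
    (hk : ∀ k : (j : Fin d) → Fin (l.1 j) → Part p j, k j = κ →
      x * E (concat p l k) = y * E (concat p l k)) :
    x * blockE p l E j κ = y * blockE p l E j κ := by
  refine h.ext_right fun k => ?_
  rw [mul_assoc, mul_assoc]
  by_cases hk' : k j = κ
  · subst hk'
    rw [h.blockE_mul_self, hk _ rfl]
  · rw [h.blockE_mul_ne hk', mul_zero, mul_zero]

/-- The representation of a tensor factor. -/
theorem blockRep (j : Fin d) : IsRep (subQ p Q j) (fun _ : SimpleIdx (l.1 j) => True)
    (blockE p l E j) (blockY l Y j) (blockPsi l P j) where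
  sum_e := by
    classical
    refine h.ext_right fun k => ?_
    rw [Finset.sum_mul, Finset.sum_eq_single (k j), h.blockE_mul_self, one_mul]
    · exact fun κ _ hκ => h.blockE_mul_ne hκ.symm
    · simp
  e_mul_self κ := by
    conv_rhs => rw [← one_mul (blockE p l E j κ)]
    refine h.blockRep_of_mul fun k hk => ?_
    rw [← hk, h.blockE_mul_self, one_mul]
  e_mul_ne κ κ' hκ := by
    rw [← zero_mul (blockE p l E j κ')]
    refine h.blockRep_of_mul fun k hk => ?_
    rw [h.blockE_mul_ne (by rw [hk]; exact hκ.symm), zero_mul]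
  y_e b κ := h.commute_y_blockE _ _ _
  psi_e b κ _ := by
    refine h.ext_right fun k => ?_
    rw [mul_assoc, mul_assoc, h.blockPsi_mul, ← mul_assoc (blockE p l E j _)]
    have hu : Function.update k j (permAct (simplePerm b) (k j)) j =
      permAct (simplePerm b) (k j) := Function.update_self _ _ _
    have hinv : Function.Injective (permAct (simplePerm b) :
        (Fin (l.1 j) → Part p j) → Fin (l.1 j) → Part p j) := by
      intro x y hxy
      funext i
      have := congrFun hxy (simplePerm b i)
      rw [permAct_simplePerm, permAct_simplePerm] at this
      simpa [simplePerm] using this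
    by_cases hk : k j = κ
    · subst hk
      rw [h.blockE_mul_self, h.blockPsi_mul]
      nth_rw 2 [← hu]
      rw [h.blockE_mul_self]
    · rw [h.blockE_mul_ne hk, mul_zero,
        h.blockE_mul_ne (by rw [hu]; exact fun h' => hk (hinv h')), zero_mul]
  y_y b b' := h.y_y _ _
  psi_y b b' _ h1 h2 := h.psi_y _ _ (inBlock_blockSimple l j b)
    (by simpa [blockSimple_fst] using h1) (by simpa [blockSimple_snd] using h2)
  psi_psi b b' _ _ hb := h.psi_psi _ _ (inBlock_blockSimple l j b) (inBlock_blockSimple l j b')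
    (by simp only [blockSimple, blockEquiv_val, SimpleIdx.fst]; omega)
  psi_y_snd b κ _ := h.blockRep_of_mul fun k hk => by
    have := h.psi_y_snd _ (concat p l k) (inBlock_blockSimple l j b)
    rwa [blockSimple_fst, blockSimple_snd, concat_blockEquiv, concat_blockEquiv, kron_val,
      hk] at this
  y_snd_psi b κ _ := h.blockRep_of_mul fun k hk => by
    have := h.y_snd_psi _ (concat p l k) (inBlock_blockSimple l j b)
    rwa [blockSimple_fst, blockSimple_snd, concat_blockEquiv, concat_blockEquiv, kron_val,
      hk] at this
  psi_sq b κ _ := h.blockRep_of_mul fun k hk => by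
    have := h.psi_sq _ (concat p l k) (inBlock_blockSimple l j b)
    rwa [blockSimple_fst, blockSimple_snd, concat_blockEquiv, concat_blockEquiv, hk] at this
  braid b b' κ hb _ _ := h.blockRep_of_mul fun k hk => by
    have := h.braid (blockSimple l j b) (blockSimple l j b') (concat p l k)
      (by simp only [blockSimple, blockEquiv_val, SimpleIdx.fst]; omega)
      (inBlock_blockSimple l j b) (inBlock_blockSimple l j b')
    rwa [blockSimple_fst, blockSimple_snd, blockSimple_snd, concat_blockEquiv, concat_blockEquiv,
      concat_blockEquiv, kron_val, hk] at this

/-- It suffices to treat the nine pairs of generators, since distinct blocks involve disjoint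
positions. -/
theorem commute_factors {i j : Fin d} (hij : i ≠ j) (x : Hecke (subQ p Q i) (l.1 i))
    (y : Hecke (subQ p Q j) (l.1 j)) :
    Commute ((h.blockRep i).lift x) ((h.blockRep j).lift y) := by
  refine Hecke.commute_of_gen _ _ (fun κ => ?_) (fun a => ?_) (fun a => ?_) x <;>
    refine Commute.symm (Hecke.commute_of_gen _ _ (fun κ' => ?_) (fun b => ?_) (fun b => ?_) y) <;>
    simp only [IsRep.lift_e, IsRep.lift_y, IsRep.lift_psi]
  · exact h.commute_blockE_blockE _ _ _ _
  · exact h.commute_y_blockE _ _ _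
  · exact h.commute_blockPsi_blockE hij.symm _ _
  · exact (h.commute_y_blockE _ _ _).symm
  · exact h.y_y _ _
  · exact h.psi_y _ _ (inBlock_blockSimple l j b) (by simp [blockSimple_fst, hij])
      (by simp [blockSimple_snd, hij])
  · exact (h.commute_blockPsi_blockE hij _ _).symm
  · exact (h.psi_y _ _ (inBlock_blockSimple l i a) (by simp [blockSimple_fst, hij.symm])
      (by simp [blockSimple_snd, hij.symm])).symm
  · refine h.psi_psi _ _ (inBlock_blockSimple l j b) (inBlock_blockSimple l i a) ?_
    -- Disjointness of the blocks excludes `a = b`, `a + 1 = b` and `a = b + 1`, which leaves the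
    -- distance greater than `1` needed for commuting `ψ`s.
    have key (x : Fin (l.1 i)) (y : Fin (l.1 j)) :
        (blockEquiv l ⟨i, x⟩ : ℕ) ≠ blockEquiv l ⟨j, y⟩ := by
      simp [← Fin.ext_iff, hij]
    have h1 := key a.fst b.fst
    have h2 := key a.snd b.fst
    have h3 := key a.fst b.snd
    have e1 : (blockEquiv l ⟨i, a.snd⟩ : ℕ) = blockEquiv l ⟨i, a.fst⟩ + 1 :=
      congrArg Fin.val (blockSimple_snd l i a).symm
    have e2 : (blockEquiv l ⟨j, b.snd⟩ : ℕ) = blockEquiv l ⟨j, b.fst⟩ + 1 :=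
      congrArg Fin.val (blockSimple_snd l j b).symm
    simp only [blockSimple]
    omega

/-- The universal property of `H_λ(Q)`. -/
def tensorLift : TensorHecke p Q l →ₐ[A] B :=
  liftCommuting (fun j => (h.blockRep j).lift) fun _ _ hij => h.commute_factors hij

theorem tensorLift_single (j : Fin d) (x : Hecke (subQ p Q j) (l.1 j)) :
    h.tensorLift (PiTensorProduct.singleAlgHom (R := A)
      (A := fun j => Hecke (subQ p Q j) (l.1 j)) j x) = (h.blockRep j).lift x :=
  liftCommuting_single (H := fun j => Hecke (subQ p Q j) (l.1 j))
    (fun j => (h.blockRep j).lift) (fun _ _ hij => h.commute_factors hij) j x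

theorem tensorLift_tensorY (j : Fin d) (b : Fin (l.1 j)) :
    h.tensorLift (tensorY p Q l j b) = Y (blockEquiv l ⟨j, b⟩) := by
  rw [tensorY, tensorLift_single, IsRep.lift_y, blockY]

theorem tensorLift_tensorPsi (j : Fin d) (b : SimpleIdx (l.1 j)) :
    h.tensorLift (tensorPsi p Q l j b) = P (blockSimple l j b) := by
  rw [tensorPsi, tensorLift_single, IsRep.lift_psi, blockPsi]

end IsBlockRep

/-- Tested against `E(k')`: if `k' = k`, every factor `e(k^j)` acts as the identity; if `k'` differs
from `k` in the component `j`, the factor `e(k^j)` kills it. -/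
theorem IsBlockRep.tensorLift_tensorE (h : IsBlockRep p Q l E Y P)
    (k : (j : Fin d) → Fin (l.1 j) → Part p j) :
    h.tensorLift (tensorE p Q l k) = E (concat p l k) := by
  classical
  have h1 : ∀ s : Finset (Fin d), h.tensorLift (PiTensorProduct.tprod A
      fun j => if j ∈ s then Hecke.e (subQ p Q j) (k j) else 1) * E (concat p l k) =
        E (concat p l k) := by
    intro s
    induction s using Finset.induction_on with
    | empty =>
      simp only [Finset.notMem_empty, if_false]
      exact (congrArg (· * E (concat p l k)) (map_one h.tensorLift)).trans (one_mul _)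
    | insert i s hi ih =>
      have h2 := singleAlgHom_mul_tprod (A := A) (H := fun j => Hecke (subQ p Q j) (l.1 j))
        i (Hecke.e (subQ p Q i) (k i)) fun j => if j ∈ s then Hecke.e (subQ p Q j) (k j) else 1
      have h3 : (fun j => if j ∈ insert i s then Hecke.e (subQ p Q j) (k j) else 1) =
          Function.update (fun j => if j ∈ s then Hecke.e (subQ p Q j) (k j) else 1) i
          (Hecke.e (subQ p Q i) (k i) * if i ∈ s then Hecke.e (subQ p Q i) (k i) else 1) := by
        funext j
        rcases eq_or_ne j i with rfl | hj
        · simp [hi]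
        · simp [hj]
      rw [h3, ← h2, map_mul, mul_assoc, ih, h.tensorLift_single, IsRep.lift_e, h.blockE_mul_self]
  refine h.ext_right fun k' => ?_
  rcases eq_or_ne k k' with rfl | hk
  · rw [h.e_mul_self]
    simpa [tensorE] using h1 Finset.univ
  · rw [h.e_mul_ne _ _ fun h' => hk (concat_injective l p h')]
    obtain ⟨j, hj⟩ := Function.ne_iff.1 hk
    have h2 := tprod_mul_singleAlgHom (A := A) (H := fun j => Hecke (subQ p Q j) (l.1 j))
        j (Hecke.e (subQ p Q j) (k j)) fun j => Hecke.e (subQ p Q j) (k j)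
    rw [(Hecke.isRep _ _).e_mul_self, Function.update_eq_self] at h2
    rw [tensorE, ← h2, map_mul, mul_assoc, h.tensorLift_single, IsRep.lift_e,
      h.blockE_mul_ne hj.symm, mul_zero]

/-- `H_λ(Q)` is generated by the elements `e^⊗(k)`, `y_b` and `ψ_b`. -/
theorem tensorHecke_mem_of_gen (S : Subalgebra A (TensorHecke p Q l))
    (he : ∀ k, tensorE p Q l k ∈ S) (hy : ∀ j b, tensorY p Q l j b ∈ S)
    (hpsi : ∀ j b, tensorPsi p Q l j b ∈ S) (x : TensorHecke p Q l) : x ∈ S := by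
  classical
  refine tensor_mem_of_single S (fun j x => ?_) x
  refine Hecke.mem_of_gen (S.comap (PiTensorProduct.singleAlgHom (R := A)
    (A := fun j => Hecke (subQ p Q j) (l.1 j)) j)) (fun κ => ?_) (hy j) (hpsi j) x
  rw [Subalgebra.mem_comap]
  -- Multiplying by `1 = ∑ e^⊗(k)` writes `e(κ)` in one factor as the sum of the `e^⊗(k)` with `k^j
  -- = κ`.
  rw [← mul_one (PiTensorProduct.singleAlgHom j _), ← sum_tensorE, Finset.mul_sum]
  refine S.sum_mem fun k _ => ?_
  by_cases hk : k j = κ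
  · subst hk
    rw [single_e_mul_tensorE]
    exact he k
  · rw [tensorE, singleAlgHom_mul_tprod, (Hecke.isRep _ _).e_mul_ne _ _ (Ne.symm hk),
      MultilinearMap.map_update_zero]
    exact S.zero_mem

end BlockRep

/-! ### Stable sorting -/

section Sorting

variable {d n : ℕ}

/-- The permutation sending every position of `t` to its position in the stably sorted tuple. -/
def sortPos (t : Fin n → Fin d) : Equiv.Perm (Fin n) := (Tuple.sort t)⁻¹

theorem simplePerm_simplePerm (a : SimpleIdx n) (i : Fin n) :
    simplePerm a (simplePerm a i) = i := by simp [simplePerm]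

theorem permAct_simplePerm_of_eq {X : Type*} {t : Fin n → X} {a : SimpleIdx n}
    (h : t a.fst = t a.snd) : permAct (simplePerm a) t = t := by
  funext i
  rw [permAct_simplePerm]
  rcases eq_or_ne i a.fst with rfl | h1
  · rw [simplePerm_fst, h]
  rcases eq_or_ne i a.snd with rfl | h2
  · rw [simplePerm_snd, h]
  rw [simplePerm_of_ne a h1 h2]

theorem SimpleIdx.fst_lt_snd (a : SimpleIdx n) : a.fst < a.snd := by
  simp [SimpleIdx.fst, SimpleIdx.snd]

/-- A stable sort is characterised by monotonicity of the result and by keeping equal entries in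
order. Exchanging two unequal neighbours does not affect the relative order of equal entries. -/
theorem sort_permAct {t : Fin n → Fin d} {a : SimpleIdx n} (h : t a.fst ≠ t a.snd) :
    Tuple.sort (permAct (simplePerm a) t) = simplePerm a * Tuple.sort t := by
  symm
  obtain ⟨h1, h2⟩ := (Tuple.eq_sort_iff (f := t) (σ := Tuple.sort t)).1 rfl
  rw [Tuple.eq_sort_iff]
  refine ⟨?_, fun i j hij heq => ?_⟩
  · convert h1 using 1
    funext i
    simp [permAct_simplePerm, simplePerm_simplePerm]
  · simp only [Equiv.Perm.coe_mul, Function.comp_apply, permAct_simplePerm,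
      simplePerm_simplePerm] at heq ⊢
    have h3 := h2 i j hij heq
    generalize Tuple.sort t i = x at *
    generalize Tuple.sort t j = y at *
    have hv : ∀ z, (simplePerm a z = z ∧ z ≠ a.fst ∧ z ≠ a.snd) ∨
        (z = a.fst ∧ simplePerm a z = a.snd) ∨ (z = a.snd ∧ simplePerm a z = a.fst) := by
      intro z
      rcases eq_or_ne z a.fst with rfl | h1
      · exact Or.inr (Or.inl ⟨rfl, simplePerm_fst a⟩)
      rcases eq_or_ne z a.snd with rfl | h2
      · exact Or.inr (Or.inr ⟨rfl, simplePerm_snd a⟩)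
      exact Or.inl ⟨simplePerm_of_ne a h1 h2, h1, h2⟩
    have hx := hv x
    have hy := hv y
    -- The only increasing pair of positions that `s_a` reverses is `(a, a + 1)`, and there the
    -- entries differ.
    have hxy : ¬ (x = a.fst ∧ y = a.snd) := fun h' => h (by rw [← h'.1, ← h'.2, heq])
    simp only [Fin.ext_iff, Fin.lt_def, SimpleIdx.fst, SimpleIdx.snd, ne_eq] at *
    omega

theorem sortPos_permAct_of_ne {t : Fin n → Fin d} {a : SimpleIdx n} (h : t a.fst ≠ t a.snd)
    (i : Fin n) : sortPos (permAct (simplePerm a) t) i = sortPos t (simplePerm a i) := by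
  rw [sortPos, sort_permAct h, mul_inv_rev, simplePerm_inv]
  rfl

theorem sortPos_permAct_of_fixed (t : Fin n → Fin d) {a : SimpleIdx n} {i : Fin n}
    (h1 : i ≠ a.fst) (h2 : i ≠ a.snd) :
    sortPos (permAct (simplePerm a) t) i = sortPos t i := by
  by_cases h : t a.fst = t a.snd
  · rw [permAct_simplePerm_of_eq h]
  · rw [sortPos_permAct_of_ne h, simplePerm_of_ne a h1 h2]

/-- An entry sorted strictly between the two would have the same value by monotonicity. By stability
it would come from a position strictly between `a` and `a + 1`. -/
theorem sortPos_succ {t : Fin n → Fin d} {a : SimpleIdx n} (h : t a.fst = t a.snd) :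
    (sortPos t a.snd : ℕ) = sortPos t a.fst + 1 := by
  obtain ⟨h1, h2⟩ := (Tuple.eq_sort_iff (f := t) (σ := Tuple.sort t)).1 rfl
  have e1 : Tuple.sort t (sortPos t a.fst) = a.fst := by simp [sortPos]
  have e2 : Tuple.sort t (sortPos t a.snd) = a.snd := by simp [sortPos]
  have hne : sortPos t a.fst ≠ sortPos t a.snd := fun h' => a.fst_ne_snd ((sortPos t).injective h')
  have hlt : sortPos t a.fst < sortPos t a.snd := by
    by_contra hcon
    have := h2 _ _ (lt_of_le_of_ne (not_lt.1 hcon) hne.symm) (by rw [e1, e2, h])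
    rw [e1, e2] at this
    exact absurd this (not_lt.2 a.fst_lt_snd.le)
  by_contra hcon
  have hm : (sortPos t a.fst : ℕ) + 1 < n := by
    have := (sortPos t a.snd).2
    have h3 : (sortPos t a.fst : ℕ) < sortPos t a.snd := hlt
    omega
  have l1 : sortPos t a.fst < (⟨sortPos t a.fst + 1, hm⟩ : Fin n) := by simp [Fin.lt_def]
  have l2 : (⟨sortPos t a.fst + 1, hm⟩ : Fin n) < sortPos t a.snd := by
    have h3 : (sortPos t a.fst : ℕ) < sortPos t a.snd := hlt
    simp only [Fin.lt_def]
    omega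
  generalize (⟨sortPos t a.fst + 1, hm⟩ : Fin n) = m at *
  have t1 : t a.fst ≤ t (Tuple.sort t m) := by
    have := h1 l1.le
    simpa [e1] using this
  have t2 : t (Tuple.sort t m) ≤ t a.snd := by
    have := h1 l2.le
    simpa [e2] using this
  have t3 : t a.fst = t (Tuple.sort t m) := le_antisymm t1 (h ▸ t2)
  have g1 := h2 _ _ l1 (by rw [e1, t3])
  have g2 := h2 _ _ l2 (by rw [e2, ← t3, h])
  rw [e1] at g1
  rw [e2] at g2
  simp only [SimpleIdx.fst, SimpleIdx.snd, Fin.lt_def] at g1 g2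
  omega

theorem blockOffset_eq (l : Comp d n) (j : Fin d) :
    ∑ i : Fin j, l.1 (Fin.castLE j.2.le i) =
      ∑ i ∈ Finset.range j, if h : i < d then l.1 ⟨i, h⟩ else 0 := by
  rw [Finset.sum_range]
  refine Finset.sum_congr rfl fun i _ => ?_
  rw [dif_pos (i.2.trans j.2)]
  rfl

theorem monotone_trivialTuple (l : Comp d n) : Monotone (trivialTuple l) := by
  intro i i' hi
  obtain ⟨j, b, rfl⟩ := exists_blockEquiv l i
  obtain ⟨j', b', rfl⟩ := exists_blockEquiv l i'
  rw [trivialTuple_blockEquiv, trivialTuple_blockEquiv]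
  by_contra hcon
  have hlt : (j' : ℕ) < j := not_le.1 hcon
  have hi : (blockEquiv l ⟨j, b⟩ : ℕ) ≤ blockEquiv l ⟨j', b'⟩ := hi
  rw [blockEquiv_val, blockEquiv_val, blockOffset_eq, blockOffset_eq] at hi
  have h1 : ∑ i ∈ Finset.range (j' + 1), (if h : i < d then l.1 ⟨i, h⟩ else 0) ≤
      ∑ i ∈ Finset.range j, if h : i < d then l.1 ⟨i, h⟩ else 0 :=
    Finset.sum_le_sum_of_subset (Finset.range_mono hlt)
  rw [Finset.sum_range_succ, dif_pos j'.2] at h1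
  have := b'.2
  simp only [Fin.eta] at h1
  omega

theorem card_trivialTuple (l : Comp d n) (j : Fin d) :
    (Finset.univ.filter fun a => trivialTuple l a = j).card = l.1 j := by
  rw [← Fintype.card_fin (l.1 j), ← Finset.card_univ]
  refine (Finset.card_bij (fun b _ => blockEquiv l ⟨j, b⟩) ?_ ?_ ?_).symm
  · intro b _
    simp [trivialTuple_blockEquiv]
  · intro b _ b' _ h
    simpa using h
  · intro a ha
    obtain ⟨j', b, rfl⟩ := exists_blockEquiv l a
    rw [Finset.mem_filter, trivialTuple_blockEquiv] at ha
    obtain rfl := ha.2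
    exact ⟨b, Finset.mem_univ _, rfl⟩

/-- `t^λ` as an element of `J^λ`. -/
def trivialShape (l : Comp d n) : Shape l := ⟨trivialTuple l, card_trivialTuple l⟩

theorem exists_perm_comp {t t' : Fin n → Fin d}
    (h : ∀ j, (Finset.univ.filter fun a => t a = j).card =
      (Finset.univ.filter fun a => t' a = j).card) :
    ∃ σ : Equiv.Perm (Fin n), t ∘ σ = t' := by
  have e : ∀ j, Nonempty ({a // t' a = j} ≃ {a // t a = j}) := fun j =>
    Fintype.card_eq.1 (by rw [Fintype.card_subtype, Fintype.card_subtype, h])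
  refine ⟨(Equiv.sigmaFiberEquiv t').symm.trans
    ((Equiv.sigmaCongrRight fun j => (e j).some).trans (Equiv.sigmaFiberEquiv t)), ?_⟩
  funext i
  exact ((e (t' i)).some ⟨i, rfl⟩).2

/-- The sorted tuple and `t^λ` are both monotone rearrangements of `t`, hence equal. -/
theorem trivialTuple_sortPos {l : Comp d n} (t : Shape l) (i : Fin n) :
    trivialTuple l (sortPos t.1 i) = t.1 i := by
  obtain ⟨σ, hσ⟩ := exists_perm_comp (t := t.1) (t' := trivialTuple l)
    fun j => by rw [t.2 j, card_trivialTuple l j]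
  have h1 : t.1 ∘ Tuple.sort t.1 = t.1 ∘ σ :=
    Tuple.unique_monotone (Tuple.monotone_sort t.1) (hσ ▸ monotone_trivialTuple l)
  rw [hσ] at h1
  rw [← h1]
  simp [sortPos]

theorem sortPos_of_monotone {t : Fin n → Fin d} (h : Monotone t) : sortPos t = 1 := by
  rw [sortPos, Tuple.sort_eq_refl_iff_monotone.2 h]
  rfl

/-- The action of the symmetric group on `J^λ`. -/
def shapeAct {l : Comp d n} (w : Equiv.Perm (Fin n)) (t : Shape l) : Shape l :=
  ⟨permAct w t.1, fun j => by
    rw [← t.2 j]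
    refine Finset.card_bij (fun a _ => w⁻¹ a) ?_ ?_ ?_
    · intro a ha
      rw [Finset.mem_filter] at ha ⊢
      exact ⟨Finset.mem_univ _, ha.2⟩
    · intro a _ b _ h
      exact w⁻¹.injective h
    · intro b hb
      rw [Finset.mem_filter] at hb
      refine ⟨w b, ?_, by simp⟩
      rw [Finset.mem_filter]
      exact ⟨Finset.mem_univ _, by simpa [permAct] using hb.2⟩⟩

theorem permAct_mul {X : Type*} (w w' : Equiv.Perm (Fin n)) (x : Fin n → X) :
    permAct (w * w') x = permAct w (permAct w' x) := by
  funext i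
  simp [permAct]

theorem permAct_one {X : Type*} (x : Fin n → X) : permAct 1 x = x := by
  funext i
  simp [permAct]

theorem shapeAct_mul {l : Comp d n} (w w' : Equiv.Perm (Fin n)) (t : Shape l) :
    shapeAct (w * w') t = shapeAct w (shapeAct w' t) :=
  Subtype.ext (permAct_mul w w' t.1)

theorem shapeAct_one {l : Comp d n} (t : Shape l) : shapeAct 1 t = t :=
  Subtype.ext (permAct_one t.1)

theorem shapeAct_injective {l : Comp d n} (w : Equiv.Perm (Fin n)) :
    Function.Injective (shapeAct w : Shape l → Shape l) := by
  intro t t' h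
  rw [← shapeAct_one t, ← shapeAct_one t', ← inv_mul_cancel w, shapeAct_mul, h, shapeAct_mul]

theorem shapeAct_of_eq {l : Comp d n} {t : Shape l} {a : SimpleIdx n}
    (h : t.1 a.fst = t.1 a.snd) : shapeAct (simplePerm a) t = t :=
  Subtype.ext (permAct_simplePerm_of_eq h)

/-- If the entries of `t` at `a` and `a + 1` agree, these positions stay adjacent under
sorting. -/
theorem exists_sortIdx {l : Comp d n} {t : Shape l} {a : SimpleIdx n}
    (h : t.1 a.fst = t.1 a.snd) :
    ∃ b : SimpleIdx n, InBlock l b ∧ b.fst = sortPos t.1 a.fst ∧ b.snd = sortPos t.1 a.snd := by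
  have h1 := sortPos_succ h
  refine ⟨⟨sortPos t.1 a.fst, by rw [← h1]; exact (sortPos t.1 a.snd).2⟩, ?_, rfl, ?_⟩
  · have e : SimpleIdx.snd (⟨sortPos t.1 a.fst, by rw [← h1]; exact (sortPos t.1 a.snd).2⟩ :
        SimpleIdx n) = sortPos t.1 a.snd := Fin.ext h1.symm
    rw [InBlock, e, trivialTuple_sortPos, ← h]
    exact trivialTuple_sortPos t a.fst
  · exact Fin.ext h1.symm

theorem permAct_sortPos {X : Type*} (t : Fin n → Fin d) (k : Fin n → X) (i : Fin n) :
    permAct (sortPos t) k (sortPos t i) = k i := by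
  simp [permAct]

/-- Conjugation by the sorting permutation turns `s_a` into `s_b`. -/
theorem permAct_sortPos_simplePerm {X : Type*} {t : Fin n → Fin d} {a b : SimpleIdx n}
    (h1 : b.fst = sortPos t a.fst) (h2 : b.snd = sortPos t a.snd) (k : Fin n → X) :
    permAct (sortPos t) (permAct (simplePerm a) k) =
      permAct (simplePerm b) (permAct (sortPos t) k) := by
  rw [← permAct_mul, ← permAct_mul]
  congr 1
  rw [simplePerm, simplePerm, h1, h2, Equiv.mul_swap_eq_swap_mul]

theorem permAct_sortPos_of_ne {X : Type*} {t : Fin n → Fin d} {a : SimpleIdx n}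
    (h : t a.fst ≠ t a.snd) (k : Fin n → X) :
    permAct (sortPos (permAct (simplePerm a) t)) (permAct (simplePerm a) k) =
      permAct (sortPos t) k := by
  rw [← permAct_mul]
  congr 1
  ext i
  rw [Equiv.Perm.mul_apply, sortPos_permAct_of_ne h, simplePerm_simplePerm]

end Sorting

/-! ### Monomial matrices -/

section Monomial

variable {ι : Type*} [DecidableEq ι] {B : Type*} [Ring B]

/-- The matrix `∑ t, v_t E_{σ(t), t}`. -/
def mono (σ : ι → ι) (v : ι → B) : Matrix ι ι B := Matrix.of fun t' t => if t' = σ t then v t else 0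

theorem mono_apply (σ : ι → ι) (v : ι → B) (t' t : ι) :
    mono σ v t' t = if t' = σ t then v t else 0 := rfl

theorem mono_id (v : ι → B) : mono id v = Matrix.diagonal v := by
  ext t' t
  by_cases h : t' = t
  · subst h; simp [mono_apply]
  · simp [mono_apply, h]

variable [Fintype ι]

theorem mono_mul_mono (σ τ : ι → ι) (v w : ι → B) :
    mono σ v * mono τ w = mono (σ ∘ τ) (fun t => v (τ t) * w t) := by
  ext t' t
  rw [Matrix.mul_apply, Finset.sum_eq_single (τ t)]
  · simp only [mono_apply, if_true, Function.comp_apply]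
    split_ifs <;> simp
  · intro s _ hs
    rw [mono_apply τ, if_neg hs, mul_zero]
  · simp

theorem mono_mul_single (σ : ι → ι) (v : ι → B) (s t : ι) (x : B) :
    mono σ v * Matrix.single s t x = Matrix.single (σ s) t (v s * x) := by
  ext t' t''
  by_cases h : t'' = t
  · subst h
    rw [Matrix.mul_single_apply_same, mono_apply, Matrix.single_apply]
    by_cases h' : t' = σ s
    · simp [h']
    · simp [h', Ne.symm h']
  · rw [Matrix.mul_single_apply_of_ne (hbj := h)]
    simp [Ne.symm h]

theorem single_mul_mono {σ : ι → ι} (hσ : Function.Injective σ) (v : ι → B) (s t r : ι)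
    (hr : σ r = t) (x : B) :
    Matrix.single s t x * mono σ v = Matrix.single s r (x * v r) := by
  subst hr
  ext t' t''
  by_cases h : t' = s
  · subst h
    rw [Matrix.single_mul_apply_same, mono_apply, Matrix.single_apply]
    by_cases h' : t'' = r
    · simp [h']
    · simp [Ne.symm h', hσ.eq_iff]
  · rw [Matrix.single_mul_apply_of_ne (h := h)]
    simp [Ne.symm h]

variable {A : Type*} [CommRing A] [Algebra A B]

theorem polyEval_mono_id (P : MvPolynomial (Fin 2) A) (u v : ι → B) :
    polyEval P (mono id u) (mono id v) = mono id fun t => polyEval P (u t) (v t) := by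
  simp only [mono_id]
  have h := map_polyEval (Matrix.diagonalAlgHom (n := ι) (α := B) A) P u v
  simp only [Matrix.diagonalAlgHom_apply] at h
  rw [← h]
  congr 1
  funext t
  exact map_polyEval (Pi.evalAlgHom A (fun _ : ι => B) t) P u v

theorem polyDivDiff_mono_id (P : MvPolynomial (Fin 2) A) (u v w : ι → B) :
    polyDivDiff P (mono id u) (mono id v) (mono id w) =
      mono id fun t => polyDivDiff P (u t) (v t) (w t) := by
  simp only [mono_id]
  have h := map_polyDivDiff (Matrix.diagonalAlgHom (n := ι) (α := B) A) P u v w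
  simp only [Matrix.diagonalAlgHom_apply] at h
  rw [← h]
  congr 1
  funext t
  exact map_polyDivDiff (Pi.evalAlgHom A (fun _ : ι => B) t) P u v w

theorem kron_matrix {K : Type*} (x y : K) :
    kron (Matrix ι ι B) x y = mono id fun _ => kron B x y := by
  rw [mono_id]
  by_cases h : x = y
  · simp [kron_eq h]
  · simp [kron_ne h]

end Monomial

/-! ### The matrix representation of `H_n(Q)` -/

section MatrixRep

variable {A : Type*} [CommRing A] {K : Type*} [Fintype K] {d n : ℕ} {B : Type*} [Ring B]
  [Algebra A B] {p : K → Fin d} {Q : K → K → MvPolynomial (Fin 2) A} {l : Comp d n}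
  {E : (Fin n → K) → B} {Y : Fin n → B} {P : SimpleIdx n → B}

/-- The element `ψ` attached to the position `π_t(a)` if `t_a = t_{a + 1}`, and `1` otherwise. -/
def psiCoeff (P : SimpleIdx n → B) (a : SimpleIdx n) (t : Fin n → Fin d) : B :=
  if t a.fst = t a.snd then
    -- The value `0` never occurs: when the two entries agree, `sortPos_succ` places `a + 1` right
    -- after `a`.
    if h : (sortPos t a.fst : ℕ) + 1 < n then P ⟨sortPos t a.fst, h⟩ else 0
  else 1

theorem psiCoeff_of_ne (P : SimpleIdx n → B) {a : SimpleIdx n} {t : Fin n → Fin d}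
    (h : t a.fst ≠ t a.snd) : psiCoeff P a t = 1 := if_neg h

theorem psiCoeff_of_eq (P : SimpleIdx n → B) {a b : SimpleIdx n} {t : Fin n → Fin d}
    (h : t a.fst = t a.snd) (hb : b.fst = sortPos t a.fst) : psiCoeff P a t = P b := by
  have hb' : (sortPos t a.fst : ℕ) = b.1 := congrArg Fin.val hb.symm
  rw [psiCoeff, if_pos h, dif_pos (by rw [hb']; exact b.2)]
  congr 1
  exact Subtype.ext hb'

theorem psiCoeff_congr (P : SimpleIdx n → B) {a b : SimpleIdx n} {t s : Fin n → Fin d}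
    (ht : t a.fst = t a.snd) (hs : s b.fst = s b.snd) (h : sortPos t a.fst = sortPos s b.fst) :
    psiCoeff P a t = psiCoeff P b s := by
  rw [psiCoeff, psiCoeff, if_pos ht, if_pos hs, h]

/-- The matrix of `e(k)`. -/
def matE (l : Comp d n) (E : (Fin n → K) → B) (k : Fin n → K) : Matrix (Shape l) (Shape l) B :=
  mono id fun t => E (permAct (sortPos t.1) k)

/-- The matrix of `y_i`. -/
def matY (l : Comp d n) (Y : Fin n → B) (i : Fin n) : Matrix (Shape l) (Shape l) B :=
  mono id fun t => Y (sortPos t.1 i)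

/-- The matrix of `ψ_a`. -/
def matPsi (l : Comp d n) (P : SimpleIdx n → B) (a : SimpleIdx n) :
    Matrix (Shape l) (Shape l) B :=
  mono (shapeAct (simplePerm a)) fun t => psiCoeff P a t.1

theorem shapeAct_val (w : Equiv.Perm (Fin n)) (t : Shape l) : (shapeAct w t).1 = permAct w t.1 :=
  rfl

theorem psiCoeff_far (P : SimpleIdx n → B) {a b : SimpleIdx n}
    (hab : a.1 + 1 < b.1 ∨ b.1 + 1 < a.1) (t : Fin n → Fin d) :
    psiCoeff P a (permAct (simplePerm b) t) = psiCoeff P a t := by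
  have h1 : a.fst ≠ b.fst := by simp only [SimpleIdx.fst, ne_eq, Fin.mk.injEq]; omega
  have h2 : a.fst ≠ b.snd := by
    simp only [SimpleIdx.fst, SimpleIdx.snd, ne_eq, Fin.mk.injEq]; omega
  have h3 : a.snd ≠ b.fst := by
    simp only [SimpleIdx.fst, SimpleIdx.snd, ne_eq, Fin.mk.injEq]; omega
  have h4 : a.snd ≠ b.snd := by
    simp only [SimpleIdx.snd, ne_eq, Fin.mk.injEq]; omega
  rw [psiCoeff, psiCoeff, permAct_simplePerm, permAct_simplePerm, simplePerm_of_ne b h1 h2,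
    simplePerm_of_ne b h3 h4, sortPos_permAct_of_fixed t h1 h2]

theorem commute_simplePerm {a b : SimpleIdx n} (hab : a.1 + 1 < b.1 ∨ b.1 + 1 < a.1) :
    simplePerm a * simplePerm b = simplePerm b * simplePerm a := by
  have : (simplePerm a).Disjoint (simplePerm b) := by
    intro i
    by_cases h1 : i = a.fst ∨ i = a.snd
    · right
      apply simplePerm_of_ne <;> rcases h1 with rfl | rfl <;>
        simp only [SimpleIdx.fst, SimpleIdx.snd, ne_eq, Fin.mk.injEq] <;> omega
    · push Not at h1
      exact Or.inl (simplePerm_of_ne a h1.1 h1.2)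
  exact this.commute

theorem braid_simplePerm {a b : SimpleIdx n} (hab : b.1 = a.1 + 1) :
    simplePerm b * simplePerm a * simplePerm b = simplePerm a * simplePerm b * simplePerm a := by
  have h1 : a.snd = b.fst := Fin.ext hab.symm
  have h2 : a.fst ≠ b.snd := by
    simp only [SimpleIdx.fst, SimpleIdx.snd, ne_eq, Fin.mk.injEq]; omega
  rw [simplePerm, simplePerm, h1]
  rw [Equiv.swap_mul_swap_mul_swap (h1 ▸ a.fst_ne_snd) h2, Equiv.swap_comm a.fst b.fst,
    Equiv.swap_comm b.fst b.snd, Equiv.swap_mul_swap_mul_swap b.fst_ne_snd.symm h2.symm,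
    Equiv.swap_comm]

namespace IsBlockRep

variable (h : IsBlockRep p Q l E Y P)
include h

/-- `π_t · k` has colours `t^λ` only if `k` has colours `t`. So the matrix of `e(k)` lives in at
most one column, and relations multiplied by `e(k)` need checking there only. -/
theorem supp_sortPos {k : Fin n → K} {t : Shape l} (hk : ¬ ∀ i, p (k i) = t.1 i) :
    E (permAct (sortPos t.1) k) = 0 := by
  refine h.supp _ fun h' => hk fun i => ?_
  have := h' (sortPos t.1 i)
  rwa [permAct_sortPos, trivialTuple_sortPos] at this

theorem mono_congr_of_E {σ : Shape l → Shape l} {k : Fin n → K} {v w : Shape l → B}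
    (hvw : ∀ t : Shape l, (∀ i, p (k i) = t.1 i) →
      v t * E (permAct (sortPos t.1) k) = w t * E (permAct (sortPos t.1) k)) :
    mono σ (fun t => v t * E (permAct (sortPos t.1) k)) =
      mono σ (fun t => w t * E (permAct (sortPos t.1) k)) := by
  congr 1
  funext t
  by_cases hk : ∀ i, p (k i) = t.1 i
  · exact hvw t hk
  · rw [h.supp_sortPos hk, mul_zero, mul_zero]

/-- In the column of the colours of `k`: if `t_a = t_{a+1}` this is the relation for the in-block
transposition `π_t(a)`. Otherwise `k_a ≠ k_{a+1}`, the coefficient of `ψ_a` is `1`, and both sides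
are the same `y`. -/
theorem mat_psi_y_snd (a : SimpleIdx n)
    (k : Fin n → K) : matPsi l P a * matY l Y a.snd * matE l E k =
      (matY l Y a.fst * matPsi l P a + kron _ (k a.fst) (k a.snd)) * matE l E k := by
  rw [kron_matrix, add_mul]
  simp only [matPsi, matY, matE, mono_mul_mono, Function.comp_id, Function.id_comp, id_eq]
  ext s t
  simp only [Matrix.add_apply, mono_apply, id_eq]
  by_cases hk : ∀ i, p (k i) = t.1 i
  swap
  · rw [h.supp_sortPos hk]; simp
  by_cases ht : t.1 a.fst = t.1 a.snd
  · rw [shapeAct_of_eq ht]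
    obtain ⟨b, hb, hb1, hb2⟩ := exists_sortIdx ht
    have := h.psi_y_snd b (permAct (sortPos t.1) k) hb
    rw [add_mul, hb1, hb2, permAct_sortPos, permAct_sortPos] at this
    rw [psiCoeff_of_eq P ht hb1]
    split_ifs
    · exact this
    · simp
  · have hne : k a.fst ≠ k a.snd := fun h' => ht (by rw [← hk, ← hk, h'])
    rw [kron_ne hne, psiCoeff_of_ne P ht, shapeAct_val, sortPos_permAct_of_ne ht, simplePerm_fst]
    simp

theorem mat_y_snd_psi (a : SimpleIdx n)
    (k : Fin n → K) : matY l Y a.snd * matPsi l P a * matE l E k =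
      (matPsi l P a * matY l Y a.fst + kron _ (k a.fst) (k a.snd)) * matE l E k := by
  rw [kron_matrix, add_mul]
  simp only [matPsi, matY, matE, mono_mul_mono, Function.comp_id, Function.id_comp, id_eq]
  ext s t
  simp only [Matrix.add_apply, mono_apply, id_eq]
  by_cases hk : ∀ i, p (k i) = t.1 i
  swap
  · rw [h.supp_sortPos hk]; simp
  by_cases ht : t.1 a.fst = t.1 a.snd
  · rw [shapeAct_of_eq ht]
    obtain ⟨b, hb, hb1, hb2⟩ := exists_sortIdx ht
    have := h.y_snd_psi b (permAct (sortPos t.1) k) hb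
    rw [add_mul, hb1, hb2, permAct_sortPos, permAct_sortPos] at this
    rw [psiCoeff_of_eq P ht hb1]
    split_ifs
    · exact this
    · simp
  · have hne : k a.fst ≠ k a.snd := fun h' => ht (by rw [← hk, ← hk, h'])
    rw [kron_ne hne, psiCoeff_of_ne P ht, shapeAct_val, sortPos_permAct_of_ne ht, simplePerm_snd]
    simp

/-- For `t_a ≠ t_{a+1}` both passages have coefficient `1`, which is consistent because `Q` is `1`
between different parts. -/
theorem mat_psi_sq (hdisj : ∀ k k', p k ≠ p k' → Q k k' = 1) (a : SimpleIdx n)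
    (k : Fin n → K) : matPsi l P a * matPsi l P a * matE l E k =
      polyEval (Q (k a.fst) (k a.snd)) (matY l Y a.fst) (matY l Y a.snd) * matE l E k := by
  simp only [matPsi, matY, matE, polyEval_mono_id, mono_mul_mono, Function.comp_id, id_eq]
  have hs : (shapeAct (simplePerm a) ∘ shapeAct (simplePerm a) : Shape l → Shape l) = id := by
    funext t
    rw [Function.comp_apply, ← shapeAct_mul]
    have : simplePerm a * simplePerm a = 1 := by simp [simplePerm]
    rw [this, shapeAct_one, id]
  rw [hs]
  refine h.mono_congr_of_E fun t hk => ?_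
  by_cases ht : t.1 a.fst = t.1 a.snd
  · rw [shapeAct_of_eq ht]
    obtain ⟨b, hb, hb1, hb2⟩ := exists_sortIdx ht
    have := h.psi_sq b (permAct (sortPos t.1) k) hb
    rw [hb1, hb2, permAct_sortPos, permAct_sortPos] at this
    rw [psiCoeff_of_eq P ht hb1]
    exact this
  · rw [psiCoeff_of_ne P ht, psiCoeff_of_ne, hdisj _ _ (by rwa [hk, hk]), polyEval_one, one_mul]
    rw [shapeAct_val, permAct_simplePerm, permAct_simplePerm, simplePerm_fst, simplePerm_snd]
    exact Ne.symm ht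

/-- Let `x, y, z` be the colours at the three positions. If all agree, this is the braid relation
inside a block. If exactly two agree, both sides reduce to the same single `ψ`, since the pair of
equal letters meets once on either side and at the same sorted position. If all differ, both sides
have coefficient `1`. The correction term vanishes outside the first case: either `x ≠ z` and the
Kronecker symbol is `0`, or `x = z ≠ y` and the divided difference of `Q = 1` is `0`. -/
theorem mat_braid (hdisj : ∀ k k', p k ≠ p k' → Q k k' = 1) (a b : SimpleIdx n)
    (hab : b.1 = a.1 + 1) (k : Fin n → K) :
    matPsi l P b * matPsi l P a * matPsi l P b * matE l E k =
      (matPsi l P a * matPsi l P b * matPsi l P a + kron _ (k a.fst) (k b.snd) *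
        polyDivDiff (Q (k a.fst) (k a.snd)) (matY l Y a.fst) (matY l Y a.snd) (matY l Y b.snd)) *
          matE l E k := by
  have h1 : b.fst = a.snd := Fin.ext hab
  have h2 : a.fst ≠ b.snd := by
    simp only [SimpleIdx.fst, SimpleIdx.snd, ne_eq, Fin.mk.injEq]; omega
  have e1 : simplePerm b a.fst = a.fst := simplePerm_of_ne b (h1 ▸ a.fst_ne_snd) h2
  have e2 : simplePerm a b.snd = b.snd := simplePerm_of_ne a h2.symm (h1 ▸ b.fst_ne_snd.symm)
  have e3 : simplePerm b a.snd = b.snd := by rw [← h1, simplePerm_fst]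
  have e4 := simplePerm_fst a
  have e5 := simplePerm_snd a
  have e6 : simplePerm b b.snd = a.snd := by rw [← h1, simplePerm_snd]
  rw [kron_matrix, add_mul]
  simp only [matPsi, matY, matE, polyDivDiff_mono_id, mono_mul_mono, Function.comp_id, id_eq]
  have hs : ((shapeAct (simplePerm b) ∘ shapeAct (simplePerm a)) ∘ shapeAct (simplePerm b) :
      Shape l → Shape l) =
      (shapeAct (simplePerm a) ∘ shapeAct (simplePerm b)) ∘ shapeAct (simplePerm a) := by
    funext t
    simp only [Function.comp_apply, ← shapeAct_mul]
    rw [← mul_assoc, braid_simplePerm hab, mul_assoc]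
  rw [hs]
  ext s t
  simp only [Matrix.add_apply, mono_apply, id_eq, Function.comp_apply, shapeAct_val]
  by_cases hk : ∀ i, p (k i) = t.1 i
  swap
  · rw [h.supp_sortPos hk]; simp
  by_cases hxy : t.1 a.fst = t.1 a.snd
  · by_cases hyz : t.1 a.snd = t.1 b.snd
    · have hb' : t.1 b.fst = t.1 b.snd := by rw [h1, hyz]
      simp only [shapeAct_of_eq hxy, shapeAct_of_eq hb', permAct_simplePerm_of_eq hxy,
        permAct_simplePerm_of_eq hb']
      obtain ⟨a', ha, ha1, ha2⟩ := exists_sortIdx hxy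
      obtain ⟨b', hb, hb1, hb2⟩ := exists_sortIdx hb'
      have := h.braid a' b' (permAct (sortPos t.1) k)
        (by
          have e1 : b'.fst = a'.snd := by rw [ha2, hb1, h1]
          exact congrArg Fin.val e1) ha hb
      rw [add_mul, ha1, ha2, hb2, permAct_sortPos, permAct_sortPos, permAct_sortPos] at this
      rw [psiCoeff_of_eq P hxy ha1, psiCoeff_of_eq P hb' hb1]
      split_ifs
      · exact this
      · simp
    -- Case `x = y ≠ z`: on both sides only one factor, acting on the equal pair, has a coefficient
    -- other than `1`.
    · have hb' : t.1 b.fst ≠ t.1 b.snd := by rwa [h1]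
      have hne : k a.fst ≠ k b.snd := fun h' => hyz (by rw [← hxy, ← hk, ← hk, h'])
      have g1 : psiCoeff P a (permAct (simplePerm b) t.1) = 1 := by
        apply psiCoeff_of_ne
        simp only [permAct_simplePerm, e1, e3]
        rwa [hxy]
      have g2 : psiCoeff P b (permAct (simplePerm a) (permAct (simplePerm b) t.1)) =
          psiCoeff P a t.1 := by
        apply psiCoeff_congr
        · simp only [permAct_simplePerm, h1, e5, e2, e1, e6, hxy]
        · exact hxy
        · rw [sortPos_permAct_of_ne, sortPos_permAct_of_ne hb', h1, e5, e1]
          simp only [permAct_simplePerm, e1, e3]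
          rwa [hxy]
      rw [kron_ne hne, psiCoeff_of_ne P hb', permAct_simplePerm_of_eq hxy, g1, g2,
        psiCoeff_of_ne P hb']
      simp
  · by_cases hyz : t.1 a.snd = t.1 b.snd
    · have hb' : t.1 b.fst = t.1 b.snd := by rw [h1, hyz]
      have hne : k a.fst ≠ k b.snd := fun h' => hxy (by rw [← hk, h', hk, hyz])
      have g1 : psiCoeff P b (permAct (simplePerm a) t.1) = 1 := by
        apply psiCoeff_of_ne
        simp only [permAct_simplePerm, h1, e5, e2]
        rwa [← hyz]
      have g2 : psiCoeff P a (permAct (simplePerm b) (permAct (simplePerm a) t.1)) =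
          psiCoeff P b t.1 := by
        apply psiCoeff_congr
        · simp only [permAct_simplePerm, e1, e4, e3, e2, hyz]
        · exact hb'
        · rw [sortPos_permAct_of_ne, sortPos_permAct_of_ne hxy, h1, e1, e4]
          simp only [permAct_simplePerm, h1, e5, e2]
          rwa [← hyz]
      rw [kron_ne hne, psiCoeff_of_ne P hxy, permAct_simplePerm_of_eq hb', g1, g2,
        psiCoeff_of_ne P hxy]
      simp
    · have hb' : t.1 b.fst ≠ t.1 b.snd := by rwa [h1]
      have hQ : Q (k a.fst) (k a.snd) = 1 := hdisj _ _ (by rwa [hk, hk])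
      by_cases hxz : t.1 a.fst = t.1 b.snd
      -- Case `x = z ≠ y`: the middle factor of each side acts on the pair of equal letters, just
      -- made adjacent by the first factor.
      · have f1 : permAct (simplePerm b) t.1 a.fst = permAct (simplePerm b) t.1 a.snd := by
          simp only [permAct_simplePerm, e1, e3, hxz]
        have f2 : permAct (simplePerm a) t.1 b.fst = permAct (simplePerm a) t.1 b.snd := by
          simp only [permAct_simplePerm, h1, e5, e2, hxz]
        have g : psiCoeff P a (permAct (simplePerm b) t.1) =
            psiCoeff P b (permAct (simplePerm a) t.1) := by
          apply psiCoeff_congr P f1 f2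
          rw [sortPos_permAct_of_ne hb', sortPos_permAct_of_ne hxy, e1, h1, e5]
        rw [permAct_simplePerm_of_eq f1, permAct_simplePerm_of_eq f2, g, hQ, polyDivDiff_one,
          psiCoeff_of_ne P hb', psiCoeff_of_ne P hxy,
          psiCoeff_of_ne P (a := a) (t := permAct (simplePerm a) t.1),
          psiCoeff_of_ne P (a := b) (t := permAct (simplePerm b) t.1)]
        · simp
        · simp only [permAct_simplePerm, h1, e3, e6]
          exact Ne.symm hyz
        · simp only [permAct_simplePerm, e4, e5]
          exact Ne.symm hxy
      · have hne : k a.fst ≠ k b.snd := fun h' => hxz (by rw [← hk, h', hk])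
        rw [kron_ne hne, psiCoeff_of_ne P hb', psiCoeff_of_ne P hxy, psiCoeff_of_ne,
          psiCoeff_of_ne, psiCoeff_of_ne, psiCoeff_of_ne]
        · simp
        all_goals simp only [permAct_simplePerm, h1, e1, e2, e3, e4, e5, e6]
        all_goals tauto

theorem matRep (hdisj : ∀ k k', p k ≠ p k' → Q k k' = 1) :
    IsRep Q (fun _ : SimpleIdx n => True) (matE l E) (matY l Y) (matPsi l P) where
  sum_e := by
    classical
    have hsum : ∀ t : Shape l, ∑ k : Fin n → K, E (permAct (sortPos t.1) k) = 1 := by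
      intro t
      rw [← h.sum_e]
      exact Equiv.sum_comp (Equiv.arrowCongr (sortPos t.1) (Equiv.refl K)) E
    ext s t
    simp only [matE, Matrix.sum_apply, mono_apply, id_eq, Matrix.one_apply]
    split_ifs
    · exact hsum t
    · simp
  e_mul_self k := by
    simp only [matE, mono_mul_mono, Function.comp_id, id_eq, h.e_mul_self]
  e_mul_ne k k' hk := by
    have hk' : ∀ t : Shape l, permAct (sortPos t.1) k ≠ permAct (sortPos t.1) k' := by
      intro t h'
      refine hk (funext fun i => ?_)
      rw [← permAct_sortPos t.1 k i, h', permAct_sortPos]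
    simp only [matE, mono_mul_mono, Function.comp_id, id_eq, h.e_mul_ne _ _ (hk' _)]
    ext s t
    simp [mono_apply]
  y_e i k := by
    simp only [matE, matY, mono_mul_mono, Function.comp_id, id_eq, h.y_e]
  psi_e a k _ := by
    simp only [matE, matPsi, mono_mul_mono, Function.comp_id, Function.id_comp, id_eq]
    congr 1
    funext t
    by_cases ht : t.1 a.fst = t.1 a.snd
    · obtain ⟨b, hb, hb1, hb2⟩ := exists_sortIdx ht
      rw [shapeAct_of_eq ht, psiCoeff_of_eq P ht hb1, h.psi_e _ _ hb,
        permAct_sortPos_simplePerm hb1 hb2]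
    · rw [psiCoeff_of_ne P ht, one_mul, mul_one, shapeAct_val, permAct_sortPos_of_ne ht]
  y_y i i' := by
    simp only [matY, mono_mul_mono, Function.comp_id, id_eq]
    congr 1
    funext t
    exact h.y_y _ _
  psi_y a i _ hi hi' := by
    simp only [matY, matPsi, mono_mul_mono, Function.comp_id, Function.id_comp, id_eq]
    congr 1
    funext t
    rw [shapeAct_val, sortPos_permAct_of_fixed _ hi hi']
    by_cases ht : t.1 a.fst = t.1 a.snd
    · obtain ⟨b, hb, hb1, hb2⟩ := exists_sortIdx ht
      rw [psiCoeff_of_eq P ht hb1]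
      exact h.psi_y _ _ hb (by rw [hb1]; simpa using hi) (by rw [hb2]; simpa using hi')
    · rw [psiCoeff_of_ne P ht, one_mul, mul_one]
  psi_psi a b _ _ hab := by
    simp only [matPsi, mono_mul_mono]
    have hs : (shapeAct (simplePerm a) ∘ shapeAct (simplePerm b) : Shape l → Shape l) =
        shapeAct (simplePerm b) ∘ shapeAct (simplePerm a) := by
      funext t
      simp only [Function.comp_apply, ← shapeAct_mul, commute_simplePerm hab]
    rw [hs]
    congr 1
    funext t
    rw [shapeAct_val, shapeAct_val, psiCoeff_far P hab, psiCoeff_far P hab.symm]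
    by_cases ht : t.1 a.fst = t.1 a.snd
    · by_cases ht' : t.1 b.fst = t.1 b.snd
      · obtain ⟨a', ha, ha1, ha2⟩ := exists_sortIdx ht
        obtain ⟨b', hb, hb1, hb2⟩ := exists_sortIdx ht'
        rw [psiCoeff_of_eq P ht ha1, psiCoeff_of_eq P ht' hb1]
        refine h.psi_psi _ _ ha hb ?_
        have key (x y : Fin n) (hxy : (x : ℕ) ≠ y) :
            (sortPos t.1 x : ℕ) ≠ sortPos t.1 y := by
          rw [ne_eq, ← Fin.ext_iff] at hxy ⊢
          exact fun h' => hxy ((sortPos t.1).injective h')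
        have k1 := key a.fst b.fst (by simp only [SimpleIdx.fst]; omega)
        have k2 := key a.snd b.fst (by simp only [SimpleIdx.fst, SimpleIdx.snd]; omega)
        have k3 := key a.fst b.snd (by simp only [SimpleIdx.fst, SimpleIdx.snd]; omega)
        rw [← ha1, ← hb1] at k1
        rw [← ha2, ← hb1] at k2
        rw [← ha1, ← hb2] at k3
        simp only [SimpleIdx.fst, SimpleIdx.snd] at k1 k2 k3
        omega
      · rw [psiCoeff_of_ne P ht', one_mul, mul_one]
    · rw [psiCoeff_of_ne P ht, one_mul, mul_one]
  psi_y_snd a k _ := h.mat_psi_y_snd a k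
  y_snd_psi a k _ := h.mat_y_snd_psi a k
  psi_sq a k _ := h.mat_psi_sq hdisj a k
  braid a b k hab _ _ := h.mat_braid hdisj a b hab k

end IsBlockRep

end MatrixRep

/-! ### Corner algebras -/

section Corner

variable {A : Type*} [CommRing A] {B : Type*} [Ring B] [Algebra A B] {e : B}

/-- The inclusion of a corner. -/
def cornerVal (he : IsIdempotentElem e) : he.Corner →+ B where
  toFun x := x.1
  map_zero' := rfl
  map_add' _ _ := rfl

theorem cornerVal_injective (he : IsIdempotentElem e) : Function.Injective (cornerVal he) :=
  Subtype.val_injective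

theorem cornerVal_mul (he : IsIdempotentElem e) (x y : he.Corner) :
    cornerVal he (x * y) = cornerVal he x * cornerVal he y := rfl

theorem cornerVal_one (he : IsIdempotentElem e) : cornerVal he 1 = e := rfl

theorem mul_cornerVal (he : IsIdempotentElem e) (x : he.Corner) :
    e * cornerVal he x = cornerVal he x :=
  ((Subsemigroup.mem_corner_iff he).1 x.2).1

theorem cornerVal_mul_idem (he : IsIdempotentElem e) (x : he.Corner) :
    cornerVal he x * e = cornerVal he x :=
  ((Subsemigroup.mem_corner_iff he).1 x.2).2

instance (he : IsIdempotentElem e) : SMul A he.Corner where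
  smul a x := ⟨a • cornerVal he x, (Subsemigroup.mem_corner_iff he).2
    ⟨by rw [mul_smul_comm, mul_cornerVal], by rw [smul_mul_assoc, cornerVal_mul_idem]⟩⟩

theorem cornerVal_smul (he : IsIdempotentElem e) (a : A) (x : he.Corner) :
    cornerVal he (a • x) = a • cornerVal he x := rfl

instance (he : IsIdempotentElem e) : Module A he.Corner :=
  (cornerVal_injective he).module A (cornerVal he) (cornerVal_smul he)

instance (he : IsIdempotentElem e) : Algebra A he.Corner :=
  Algebra.ofModule
    (fun a x y => cornerVal_injective he <| by
      rw [cornerVal_mul, cornerVal_smul, cornerVal_smul, cornerVal_mul, smul_mul_assoc])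
    (fun a x y => cornerVal_injective he <| by
      rw [cornerVal_mul, cornerVal_smul, cornerVal_smul, cornerVal_mul, mul_smul_comm])

/-- The inclusion of a corner as a non-unital algebra homomorphism. -/
def cornerIncl (A : Type*) [CommRing A] [Algebra A B] (he : IsIdempotentElem e) :
    he.Corner →ₙₐ[A] B where
  toFun := cornerVal he
  map_smul' := cornerVal_smul he
  map_zero' := map_zero _
  map_add' := map_add _
  map_mul' := cornerVal_mul he

/-- The homomorphism `x ↦ x e` from the centralizer of `e` to the corner of `e`. -/
def toCorner (A : Type*) [CommRing A] [Algebra A B] (he : IsIdempotentElem e) :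
    Subalgebra.centralizer A {e} →ₐ[A] he.Corner :=
  have hc (x : Subalgebra.centralizer A {e}) : e * x.1 = x.1 * e :=
    (Subalgebra.mem_centralizer_iff A).1 x.2 e rfl
  have hmem (x : Subalgebra.centralizer A {e}) : x.1 * e ∈ Subsemigroup.corner e :=
    (Subsemigroup.mem_corner_iff he).2
      ⟨by rw [← mul_assoc, hc, mul_assoc, he.eq], by rw [mul_assoc, he.eq]⟩
  AlgHom.ofLinearMap
    { toFun := fun x => ⟨x.1 * e, hmem x⟩
      map_add' := fun x y => Subtype.ext (add_mul x.1 y.1 e)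
      map_smul' := fun a x => Subtype.ext (smul_mul_assoc a x.1 e) }
    (Subtype.ext (one_mul e))
    (fun x y => Subtype.ext <| by
      change x.1 * y.1 * e = x.1 * e * (y.1 * e)
      rw [mul_assoc x.1 e, ← mul_assoc e, hc, mul_assoc, mul_assoc, he.eq])

theorem cornerVal_toCorner (he : IsIdempotentElem e) (x : Subalgebra.centralizer A {e}) :
    cornerVal he (toCorner A he x) = x.1 * e := rfl

end Corner

/-! ### Transport of the relations along algebra homomorphisms. -/

section Transfer

variable {A : Type*} [CommRing A] {K : Type*} [Fintype K] {n : ℕ} {B C : Type*} [Ring B]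
  [Algebra A B] [Ring C] [Algebra A C] {Q : K → K → MvPolynomial (Fin 2) A}
  {inner inner' : SimpleIdx n → Prop}
  {E : (Fin n → K) → B} {Y : Fin n → B} {P P' : SimpleIdx n → B}

theorem IsRep.map (h : IsRep Q inner E Y P) (f : B →ₐ[A] C) :
    IsRep Q inner (fun k => f (E k)) (fun i => f (Y i)) (fun a => f (P a)) where
  sum_e := by rw [← map_sum, h.sum_e, map_one]
  e_mul_self k := by rw [← map_mul, h.e_mul_self]
  e_mul_ne k k' hk := by rw [← map_mul, h.e_mul_ne k k' hk, map_zero]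
  y_e a k := by rw [← map_mul, h.y_e, map_mul]
  psi_e a k ha := by rw [← map_mul, h.psi_e a k ha, map_mul]
  y_y a b := by rw [← map_mul, h.y_y, map_mul]
  psi_y a b ha h1 h2 := by rw [← map_mul, h.psi_y a b ha h1 h2, map_mul]
  psi_psi a b ha hb hab := by rw [← map_mul, h.psi_psi a b ha hb hab, map_mul]
  psi_y_snd a k ha := by simpa using congrArg f (h.psi_y_snd a k ha)
  y_snd_psi a k ha := by simpa using congrArg f (h.y_snd_psi a k ha)
  psi_sq a k ha := by simpa [map_polyEval] using congrArg f (h.psi_sq a k ha)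
  braid a b k hab ha hb := by
    simpa [map_polyDivDiff] using congrArg f (h.braid a b k hab ha hb)

theorem IsRep.of_injective (f : B →ₐ[A] C) (hf : Function.Injective f)
    (h : IsRep Q inner (fun k => f (E k)) (fun i => f (Y i)) (fun a => f (P a))) :
    IsRep Q inner E Y P where
  sum_e := hf (by simpa using h.sum_e)
  e_mul_self k := hf (by simpa using h.e_mul_self k)
  e_mul_ne k k' hk := hf (by simpa using h.e_mul_ne k k' hk)
  y_e a k := hf (by simpa using h.y_e a k)
  psi_e a k ha := hf (by simpa using h.psi_e a k ha)
  y_y a b := hf (by simpa using h.y_y a b)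
  psi_y a b ha h1 h2 := hf (by simpa using h.psi_y a b ha h1 h2)
  psi_psi a b ha hb hab := hf (by simpa using h.psi_psi a b ha hb hab)
  psi_y_snd a k ha := hf (by simpa using h.psi_y_snd a k ha)
  y_snd_psi a k ha := hf (by simpa using h.y_snd_psi a k ha)
  psi_sq a k ha := hf (by simpa [map_polyEval] using h.psi_sq a k ha)
  braid a b k hab ha hb := hf (by simpa [map_polyDivDiff] using h.braid a b k hab ha hb)

theorem IsRep.restrict (h : IsRep Q inner E Y P) (hi : ∀ a, inner' a → inner a)
    (hP : ∀ a, inner' a → P' a = P a) : IsRep Q inner' E Y P' where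
  sum_e := h.sum_e
  e_mul_self := h.e_mul_self
  e_mul_ne := h.e_mul_ne
  y_e := h.y_e
  psi_e a k ha := by rw [hP a ha]; exact h.psi_e a k (hi a ha)
  y_y := h.y_y
  psi_y a b ha h1 h2 := by rw [hP a ha]; exact h.psi_y a b (hi a ha) h1 h2
  psi_psi a b ha hb hab := by
    rw [hP a ha, hP b hb]; exact h.psi_psi a b (hi a ha) (hi b hb) hab
  psi_y_snd a k ha := by rw [hP a ha]; exact h.psi_y_snd a k (hi a ha)
  y_snd_psi a k ha := by rw [hP a ha]; exact h.y_snd_psi a k (hi a ha)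
  psi_sq a k ha := by rw [hP a ha]; exact h.psi_sq a k (hi a ha)
  braid a b k hab ha hb := by
    rw [hP a ha, hP b hb]; exact h.braid a b k hab (hi a ha) (hi b hb)

end Transfer

/-! ### The idempotents attached to colour tuples -/

section Color

variable {A : Type*} [CommRing A] {K : Type*} [Fintype K] {d n : ℕ}
  (p : K → Fin d) (Q : K → K → MvPolynomial (Fin 2) A)

/-- The sum of the `e(k)` with `k` of colour `t`. -/
def colorE (t : Fin n → Fin d) : Hecke Q n :=
  ∑ k : {k : Fin n → K // ∀ a, p (k a) = t a}, Hecke.e Q k.1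

variable {p Q}

theorem Hecke.ext_right {x y : Hecke Q n} (h : ∀ k, x * Hecke.e Q k = y * Hecke.e Q k) :
    x = y := by
  rw [← mul_one x, ← mul_one y, ← (Hecke.isRep Q n).sum_e, Finset.mul_sum, Finset.mul_sum]
  exact Finset.sum_congr rfl fun k _ => h k

theorem colorE_mul_e_of_eq {t : Fin n → Fin d} {k : Fin n → K} (h : ∀ a, p (k a) = t a) :
    colorE p Q t * Hecke.e Q k = Hecke.e Q k := by
  rw [colorE, Finset.sum_mul, Finset.sum_eq_single ⟨k, h⟩]
  · exact (Hecke.isRep Q n).e_mul_self k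
  · exact fun k' _ hk => (Hecke.isRep Q n).e_mul_ne _ _ fun h' => hk (Subtype.ext h')
  · simp

theorem colorE_mul_e_of_ne {t : Fin n → Fin d} {k : Fin n → K} (h : ¬ ∀ a, p (k a) = t a) :
    colorE p Q t * Hecke.e Q k = 0 := by
  rw [colorE, Finset.sum_mul]
  exact Finset.sum_eq_zero fun k' _ =>
    (Hecke.isRep Q n).e_mul_ne _ _ fun h' => h (h' ▸ k'.2)

theorem e_mul_colorE (t : Fin n → Fin d) (k : Fin n → K) :
    Hecke.e Q k * colorE p Q t = colorE p Q t * Hecke.e Q k := by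
  rw [colorE, Finset.sum_mul, Finset.mul_sum]
  refine Finset.sum_congr rfl fun k' _ => ?_
  by_cases h : k = k'.1
  · rw [h]
  · rw [(Hecke.isRep Q n).e_mul_ne _ _ h, (Hecke.isRep Q n).e_mul_ne _ _ (Ne.symm h)]

theorem y_mul_colorE (t : Fin n → Fin d) (i : Fin n) :
    Hecke.y Q i * colorE p Q t = colorE p Q t * Hecke.y Q i := by
  rw [colorE, Finset.sum_mul, Finset.mul_sum]
  exact Finset.sum_congr rfl fun k' _ => (Hecke.isRep Q n).y_e _ _

theorem psi_mul_colorE (t : Fin n → Fin d) (a : SimpleIdx n) :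
    Hecke.psi Q a * colorE p Q t = colorE p Q (permAct (simplePerm a) t) * Hecke.psi Q a := by
  refine Hecke.ext_right fun k => ?_
  rw [mul_assoc, mul_assoc, (Hecke.isRep Q n).psi_e a k trivial,
    ← mul_assoc (colorE p Q (permAct (simplePerm a) t))]
  by_cases h : ∀ i, p (k i) = t i
  · rw [colorE_mul_e_of_eq h, colorE_mul_e_of_eq, (Hecke.isRep Q n).psi_e a k trivial]
    intro i
    rw [permAct_simplePerm, permAct_simplePerm, h]
  · rw [colorE_mul_e_of_ne h, colorE_mul_e_of_ne, mul_zero, zero_mul]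
    intro h'
    refine h fun i => ?_
    have := h' (simplePerm a i)
    rwa [permAct_simplePerm, permAct_simplePerm, simplePerm_simplePerm] at this

theorem colorE_mul_self (t : Fin n → Fin d) : colorE p Q t * colorE p Q t = colorE p Q t := by
  refine Hecke.ext_right fun k => ?_
  rw [mul_assoc]
  by_cases h : ∀ i, p (k i) = t i
  · rw [colorE_mul_e_of_eq h, colorE_mul_e_of_eq h]
  · rw [colorE_mul_e_of_ne h, mul_zero]

theorem sum_colorE : ∑ t : Fin n → Fin d, colorE p Q t = 1 := by
  refine Hecke.ext_right fun k => ?_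
  rw [Finset.sum_mul, Finset.sum_eq_single fun i => p (k i), one_mul]
  · exact colorE_mul_e_of_eq fun _ => rfl
  · exact fun t _ ht => colorE_mul_e_of_ne fun h => ht (funext fun i => (h i).symm)
  · simp

/-- To compare two elements `x e(t)` and `y e(t)` it suffices to compare all `x e(k)` and
`y e(k)` with `k` of colour `t`. -/
theorem mul_colorE_congr {t : Fin n → Fin d} {x y : Hecke Q n}
    (h : ∀ k, (∀ i, p (k i) = t i) → x * Hecke.e Q k = y * Hecke.e Q k) :
    x * colorE p Q t = y * colorE p Q t := by
  rw [colorE, Finset.mul_sum, Finset.mul_sum]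
  exact Finset.sum_congr rfl fun k _ => h k.1 k.2

variable (p Q)

theorem colorE_idem (t : Fin n → Fin d) : IsIdempotentElem (colorE p Q t) := colorE_mul_self t

variable (l : Comp d n)

/-- The elements `e(k)` of the centralizer of `e_λ`. -/
def centE (k : Fin n → K) : Subalgebra.centralizer A {colorE p Q (trivialTuple l)} :=
  ⟨Hecke.e Q k, (Subalgebra.mem_centralizer_iff A).2 fun _ h => by
    rw [h, e_mul_colorE]⟩

/-- The elements `y_i` of the centralizer of `e_λ`. -/
def centY (i : Fin n) : Subalgebra.centralizer A {colorE p Q (trivialTuple l)} :=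
  ⟨Hecke.y Q i, (Subalgebra.mem_centralizer_iff A).2 fun _ h => by
    rw [h, y_mul_colorE]⟩

open Classical in
/-- The elements `ψ_a` of the centralizer of `e_λ`. -/
def centPsi (a : SimpleIdx n) : Subalgebra.centralizer A {colorE p Q (trivialTuple l)} :=
  if ha : InBlock l a then
    ⟨Hecke.psi Q a, (Subalgebra.mem_centralizer_iff A).2 fun _ h => by
      rw [h, psi_mul_colorE, permAct_simplePerm_of_eq ha]⟩
  else 0

theorem centPsi_val {a : SimpleIdx n} (ha : InBlock l a) :
    (centPsi p Q l a).1 = Hecke.psi Q a := by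
  rw [centPsi, dif_pos ha]

theorem cent_isRep : IsRep Q (InBlock l) (centE p Q l) (centY p Q l) (centPsi p Q l) :=
  IsRep.of_injective (Subalgebra.val _) Subtype.val_injective
    ((Hecke.isRep Q n).restrict (fun _ _ => trivial) fun _ ha => centPsi_val p Q l ha)

/-- `e_λ` commutes with all `e(k)`, `y_i` and in-block `ψ_a`. So `x ↦ x e_λ` is a unital
homomorphism from its centralizer to the corner, and it carries the relations along. It kills `e(k)`
unless `k` has colours `t^λ`. -/
theorem corner_isBlockRep : IsBlockRep p Q l
    (fun k => toCorner A (colorE_idem p Q (trivialTuple l)) (centE p Q l k))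
    (fun i => toCorner A (colorE_idem p Q (trivialTuple l)) (centY p Q l i))
    (fun a => toCorner A (colorE_idem p Q (trivialTuple l)) (centPsi p Q l a)) where
  toIsRep := (cent_isRep p Q l).map _
  supp k hk := cornerVal_injective _ <| by
    rw [cornerVal_toCorner, map_zero]
    exact (e_mul_colorE _ _).trans (colorE_mul_e_of_ne hk)

/-- The embedding of `H_λ(Q)` into `H_n(Q)` with image in the corner of `e_λ`. -/
def blockEmb : TensorHecke p Q l →ₙₐ[A] Hecke Q n :=
  (cornerIncl A (colorE_idem p Q (trivialTuple l))).comp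
    ((corner_isBlockRep p Q l).tensorLift : TensorHecke p Q l →ₙₐ[A] _)

theorem blockEmb_apply (x : TensorHecke p Q l) :
    blockEmb p Q l x = cornerVal (colorE_idem p Q (trivialTuple l))
      ((corner_isBlockRep p Q l).tensorLift x) := rfl

theorem blockEmb_one : blockEmb p Q l 1 = colorE p Q (trivialTuple l) := by
  rw [blockEmb_apply, map_one, cornerVal_one]

theorem colorE_mul_blockEmb (x : TensorHecke p Q l) :
    colorE p Q (trivialTuple l) * blockEmb p Q l x = blockEmb p Q l x := mul_cornerVal _ _

theorem blockEmb_tensorE (k) : blockEmb p Q l (tensorE p Q l k) = Hecke.e Q (concat p l k) := by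
  rw [blockEmb_apply, IsBlockRep.tensorLift_tensorE, cornerVal_toCorner]
  exact (e_mul_colorE _ _).trans (colorE_mul_e_of_eq (p_concat l p k))

theorem blockEmb_tensorY (j b) : blockEmb p Q l (tensorY p Q l j b) =
    Hecke.y Q (blockEquiv l ⟨j, b⟩) * colorE p Q (trivialTuple l) := by
  rw [blockEmb_apply, IsBlockRep.tensorLift_tensorY, cornerVal_toCorner]
  rfl

theorem blockEmb_tensorPsi (j b) : blockEmb p Q l (tensorPsi p Q l j b) =
    Hecke.psi Q (blockSimple l j b) * colorE p Q (trivialTuple l) := by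
  rw [blockEmb_apply, IsBlockRep.tensorLift_tensorPsi, cornerVal_toCorner,
    centPsi_val p Q l (inBlock_blockSimple l j b)]

theorem blockEmb_isBlockEmbedding : IsBlockEmbedding p Q l (blockEmb p Q l) :=
  ⟨blockEmb_tensorE p Q l, blockEmb_tensorY p Q l, blockEmb_tensorPsi p Q l⟩

theorem blockEmb_flatY (i : Fin n) : blockEmb p Q l (flatY p Q l i) =
    Hecke.y Q i * colorE p Q (trivialTuple l) := by
  obtain ⟨j, b, rfl⟩ := exists_blockEquiv l i
  rw [flatY_blockEquiv, blockEmb_tensorY]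

theorem blockEmb_flatPsi {a : SimpleIdx n} (ha : InBlock l a) :
    blockEmb p Q l (flatPsi p Q l a) = Hecke.psi Q a * colorE p Q (trivialTuple l) := by
  obtain ⟨j, b, rfl⟩ := ha.exists_blockSimple
  rw [flatPsi_blockSimple, blockEmb_tensorPsi]

theorem blockEmb_flatE (k : Fin n → K) :
    blockEmb p Q l (flatE p Q l k) = Hecke.e Q k * colorE p Q (trivialTuple l) := by
  by_cases h : ∀ i, p (k i) = trivialTuple l i
  · obtain ⟨k, rfl⟩ := exists_concat l p k h
    rw [flatE_concat, blockEmb_tensorE, e_mul_colorE, colorE_mul_e_of_eq h]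
  · rw [flatE_supp p Q l k h, map_zero, e_mul_colorE, colorE_mul_e_of_ne h]

end Color

/-! ### Sorting elements -/

section Theta

variable {d n : ℕ}

/-- A statistic on tuples that decreases when a descent is removed. -/
def sortMeasure (t : Fin n → Fin d) : ℕ := ∑ i, (n - i) * (t i : ℕ)

theorem sortMeasure_lt {t : Fin n → Fin d} {b : SimpleIdx n} (h : t b.snd < t b.fst) :
    sortMeasure (permAct (simplePerm b) t) < sortMeasure t := by
  -- Positions are weighted by `n - i`, so adjacent weights differ by one and the change is exactly
  -- the height of the descent.
  have key : ((sortMeasure t : ℤ) - sortMeasure (permAct (simplePerm b) t)) =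
      (t b.fst : ℤ) - t b.snd := by
    simp only [sortMeasure, Nat.cast_sum, ← Finset.sum_sub_distrib]
    rw [Fintype.sum_eq_add b.fst b.snd b.fst_ne_snd]
    · rw [permAct_simplePerm, permAct_simplePerm, simplePerm_fst, simplePerm_snd]
      have h2 : (b.fst : ℕ) ≤ n := b.fst.2.le
      have h3 : (b.snd : ℕ) ≤ n := b.snd.2.le
      have h4 : (b.snd : ℤ) = b.fst + 1 := rfl
      push_cast [h2, h3, h4]
      ring
    · rintro i ⟨h1, h2⟩
      rw [permAct_simplePerm, simplePerm_of_ne b h1 h2, sub_self]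
  have : (t b.snd : ℕ) < t b.fst := h
  omega

theorem monotone_of_no_descent {t : Fin n → Fin d} (h : ¬ ∃ b : SimpleIdx n, t b.snd < t b.fst) :
    Monotone t := by
  rcases n with _ | n
  · exact Subsingleton.monotone t
  · rw [Fin.monotone_iff_le_succ]
    intro i
    by_contra hcon
    exact h ⟨⟨i, by omega⟩, not_le.1 hcon⟩

theorem permAct_permAct_simplePerm {X : Type*} (a : SimpleIdx n) (t : Fin n → X) :
    permAct (simplePerm a) (permAct (simplePerm a) t) = t := by
  funext i
  rw [permAct_simplePerm, permAct_simplePerm, simplePerm_simplePerm]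

variable {A : Type*} [CommRing A] {K : Type*} [Fintype K]
  (p : K → Fin d) (Q : K → K → MvPolynomial (Fin 2) A)

/-- The element `ψ_{π_t⁻¹} e_λ`, for a reduced expression chosen by removing descents. -/
def thetaL (t : Fin n → Fin d) : Hecke Q n :=
  open Classical in
  if h : ∃ b : SimpleIdx n, t b.snd < t b.fst then
    Hecke.psi Q h.choose * thetaL (permAct (simplePerm h.choose) t)
  else colorE p Q t
termination_by sortMeasure t
decreasing_by exact sortMeasure_lt h.choose_spec

/-- The element `e_λ ψ_{π_t}`, for a reduced expression chosen by removing descents. -/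
def thetaR (t : Fin n → Fin d) : Hecke Q n :=
  open Classical in
  if h : ∃ b : SimpleIdx n, t b.snd < t b.fst then
    thetaR (permAct (simplePerm h.choose) t) * Hecke.psi Q h.choose
  else colorE p Q t
termination_by sortMeasure t
decreasing_by exact sortMeasure_lt h.choose_spec

variable {p Q}

theorem thetaL_of_monotone {t : Fin n → Fin d} (h : Monotone t) :
    thetaL p Q t = colorE p Q t := by
  rw [thetaL, dif_neg]
  rintro ⟨b, hb⟩
  exact absurd hb (not_lt.2 (h b.fst_lt_snd.le))

/-- Induction along the removal of descents. -/
theorem descent_induction {motive : (Fin n → Fin d) → Prop}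
    (mono : ∀ t, Monotone t → motive t)
    (step : ∀ t, (∀ s, sortMeasure s < sortMeasure t → motive s) →
      (∃ b : SimpleIdx n, t b.snd < t b.fst) → motive t) (t : Fin n → Fin d) : motive t := by
  induction hm : sortMeasure t using Nat.strong_induction_on generalizing t with
  | _ m ih =>
    by_cases h : ∃ b : SimpleIdx n, t b.snd < t b.fst
    · exact step t (fun s hs => ih _ (hm ▸ hs) s rfl) h
    · exact mono t (monotone_of_no_descent h)

theorem colorE_mul_thetaL (t : Fin n → Fin d) : colorE p Q t * thetaL p Q t = thetaL p Q t := by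
  induction t using descent_induction with
  | mono t ht => rw [thetaL_of_monotone ht, colorE_mul_self]
  | step t ih h =>
    rw [thetaL, dif_pos h]
    have h1 := psi_mul_colorE (p := p) (Q := Q) (permAct (simplePerm h.choose) t) h.choose
    rw [permAct_permAct_simplePerm] at h1
    rw [← mul_assoc, ← h1, mul_assoc, ih _ (sortMeasure_lt h.choose_spec)]

/-- Different colours force `k_a ≠ k_{a+1}`, so the correction terms in the `y`-`ψ` relations are
absent. -/
theorem y_psi_colorE {t : Fin n → Fin d} {a : SimpleIdx n} (h : t a.fst ≠ t a.snd) (i : Fin n) :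
    Hecke.y Q i * Hecke.psi Q a * colorE p Q t =
      Hecke.psi Q a * Hecke.y Q (simplePerm a i) * colorE p Q t := by
  refine mul_colorE_congr fun k hk => ?_
  have hne : k a.fst ≠ k a.snd := fun h' => h (by rw [← hk, ← hk, h'])
  rcases eq_or_ne i a.fst with rfl | h1
  · rw [simplePerm_fst, (Hecke.isRep Q n).psi_y_snd a k trivial, kron_ne hne, add_zero]
  rcases eq_or_ne i a.snd with rfl | h2
  · rw [simplePerm_snd, (Hecke.isRep Q n).y_snd_psi a k trivial, kron_ne hne, add_zero]
  rw [simplePerm_of_ne a h1 h2, (Hecke.isRep Q n).psi_y a i trivial h1 h2]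

section relations

variable (hdisj : ∀ k k', p k ≠ p k' → Q k k' = 1)
include hdisj

theorem psi_psi_colorE {t : Fin n → Fin d} {a : SimpleIdx n} (h : t a.fst ≠ t a.snd) :
    Hecke.psi Q a * Hecke.psi Q a * colorE p Q t = colorE p Q t := by
  conv_rhs => rw [← one_mul (colorE p Q t)]
  refine mul_colorE_congr fun k hk => ?_
  rw [(Hecke.isRep Q n).psi_sq a k trivial, hdisj _ _ (by rwa [hk, hk]), polyEval_one]

/-- Either alternative removes the correction: the first gives `Q = 1`, with zero divided
difference, and the second kills the Kronecker symbol. -/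
theorem braid_colorE {t : Fin n → Fin d} {a b : SimpleIdx n} (hab : b.1 = a.1 + 1)
    (h : t a.fst ≠ t a.snd ∨ t a.fst ≠ t b.snd) :
    Hecke.psi Q b * Hecke.psi Q a * Hecke.psi Q b * colorE p Q t =
      Hecke.psi Q a * Hecke.psi Q b * Hecke.psi Q a * colorE p Q t := by
  refine mul_colorE_congr fun k hk => ?_
  rw [(Hecke.isRep Q n).braid a b k hab trivial trivial]
  rcases h with h | h
  · rw [hdisj _ _ (by rwa [hk, hk]), polyDivDiff_one, mul_zero, add_zero]
  · rw [kron_ne fun h' => h (by rw [← hk, ← hk, h']), zero_mul, add_zero]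

theorem braid_thetaL {t : Fin n → Fin d} {a b : SimpleIdx n} (hab : b.1 = a.1 + 1)
    (h : t a.fst ≠ t a.snd ∨ t a.fst ≠ t b.snd) :
    Hecke.psi Q b * (Hecke.psi Q a * (Hecke.psi Q b * thetaL p Q t)) =
      Hecke.psi Q a * (Hecke.psi Q b * (Hecke.psi Q a * thetaL p Q t)) := by
  have := congrArg (· * thetaL p Q t) (braid_colorE hdisj hab h)
  simpa only [mul_assoc, colorE_mul_thetaL] using this

/-- Local confluence. Two descents far apart can be removed in either order since the `ψ`s commute.
Two adjacent descents mean `t_a > t_{a+1} > t_{a+2}`; either start leads after three removals to the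
same tuple, and the two products agree by a braid relation without correction. -/
theorem psi_thetaL_descent (t : Fin n → Fin d) : ∀ a b : SimpleIdx n,
    t a.snd < t a.fst → t b.snd < t b.fst →
    Hecke.psi Q a * thetaL p Q (permAct (simplePerm a) t) =
      Hecke.psi Q b * thetaL p Q (permAct (simplePerm b) t) := by
  induction t using descent_induction with
  | mono t ht => exact fun a _ ha _ => absurd ha (not_lt.2 (ht a.fst_lt_snd.le))
  | step t ih _ =>
    -- For smaller tuples the induction hypothesis allows any descent in the recursion of `thetaL`,
    -- not only the chosen one.
    have key : ∀ s : Fin n → Fin d, sortMeasure s < sortMeasure t → ∀ a : SimpleIdx n,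
        s a.snd < s a.fst →
        thetaL p Q s = Hecke.psi Q a * thetaL p Q (permAct (simplePerm a) s) := by
      intro s hs a ha
      have h : ∃ b : SimpleIdx n, s b.snd < s b.fst := ⟨a, ha⟩
      rw [thetaL, dif_pos h]
      exact ih s hs _ _ h.choose_spec ha
    have adj : ∀ a b : SimpleIdx n, b.1 = a.1 + 1 → t a.snd < t a.fst → t b.snd < t b.fst →
        Hecke.psi Q a * thetaL p Q (permAct (simplePerm a) t) =
          Hecke.psi Q b * thetaL p Q (permAct (simplePerm b) t) := by
      intro a b hab ha hb
      have h1 : b.fst = a.snd := Fin.ext hab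
      have h2 : a.fst ≠ b.snd := by
        simp only [SimpleIdx.fst, SimpleIdx.snd, ne_eq, Fin.mk.injEq]; omega
      have e1 : simplePerm b a.fst = a.fst := simplePerm_of_ne b (h1 ▸ a.fst_ne_snd) h2
      have e2 : simplePerm a b.snd = b.snd :=
        simplePerm_of_ne a h2.symm (h1 ▸ b.fst_ne_snd.symm)
      have e3 : simplePerm b a.snd = b.snd := by rw [← h1, simplePerm_fst]
      have e4 := simplePerm_fst a
      have e5 := simplePerm_snd a
      have e6 : simplePerm b b.snd = a.snd := by rw [← h1, simplePerm_snd]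
      rw [h1] at hb
      have hba : t b.snd < t a.fst := hb.trans ha
      have m1 := sortMeasure_lt ha
      have d1 : permAct (simplePerm a) t b.snd < permAct (simplePerm a) t b.fst := by
        simpa only [permAct_simplePerm, h1, e5, e2] using hba
      have m2 := (sortMeasure_lt d1).trans m1
      have d2 : permAct (simplePerm b) (permAct (simplePerm a) t) a.snd <
          permAct (simplePerm b) (permAct (simplePerm a) t) a.fst := by
        simpa only [permAct_simplePerm, e3, e2, e1, e4] using hb
      have m1' := sortMeasure_lt (t := t) (b := b) (by rwa [h1])
      have d1' : permAct (simplePerm b) t a.snd < permAct (simplePerm b) t a.fst := by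
        simpa only [permAct_simplePerm, e1, e3] using hba
      have m2' := (sortMeasure_lt d1').trans m1'
      have d2' : permAct (simplePerm a) (permAct (simplePerm b) t) b.snd <
          permAct (simplePerm a) (permAct (simplePerm b) t) b.fst := by
        simpa only [permAct_simplePerm, h1, e2, e6, e5, e1] using ha
      rw [key _ m1 b d1, key _ m2 a d2, key _ m1' a d1', key _ m2' b d2']
      have hs : permAct (simplePerm b) (permAct (simplePerm a) (permAct (simplePerm b) t)) =
          permAct (simplePerm a) (permAct (simplePerm b) (permAct (simplePerm a) t)) := by
        simp only [← permAct_mul]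
        rw [← mul_assoc, braid_simplePerm hab, mul_assoc]
      rw [hs]
      refine (braid_thetaL hdisj hab (Or.inr ?_)).symm
      simpa only [permAct_simplePerm, e4, e3, e2, e6, e5, e1] using hba.ne
    intro a b ha hb
    rcases lt_trichotomy a.1 b.1 with hlt | heq | hgt
    · rcases (Nat.succ_le_of_lt hlt).eq_or_lt with h1 | h1
      · exact adj a b h1.symm ha hb
      · have f1 : simplePerm a b.fst = b.fst := simplePerm_of_ne a
          (by simp only [SimpleIdx.fst, ne_eq, Fin.mk.injEq]; omega)
          (by simp only [SimpleIdx.fst, SimpleIdx.snd, ne_eq, Fin.mk.injEq]; omega)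
        have f2 : simplePerm a b.snd = b.snd := simplePerm_of_ne a
          (by simp only [SimpleIdx.fst, SimpleIdx.snd, ne_eq, Fin.mk.injEq]; omega)
          (by simp only [SimpleIdx.snd, ne_eq, Fin.mk.injEq]; omega)
        have f3 : simplePerm b a.fst = a.fst := simplePerm_of_ne b
          (by simp only [SimpleIdx.fst, ne_eq, Fin.mk.injEq]; omega)
          (by simp only [SimpleIdx.fst, SimpleIdx.snd, ne_eq, Fin.mk.injEq]; omega)
        have f4 : simplePerm b a.snd = a.snd := simplePerm_of_ne b
          (by simp only [SimpleIdx.fst, SimpleIdx.snd, ne_eq, Fin.mk.injEq]; omega)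
          (by simp only [SimpleIdx.snd, ne_eq, Fin.mk.injEq]; omega)
        rw [key _ (sortMeasure_lt ha) b (by simpa only [permAct_simplePerm, f1, f2] using hb),
          key _ (sortMeasure_lt hb) a (by simpa only [permAct_simplePerm, f3, f4] using ha),
          ← mul_assoc, ← mul_assoc, (Hecke.isRep Q n).psi_psi a b trivial trivial (Or.inl h1),
          ← permAct_mul, ← permAct_mul, commute_simplePerm (Or.inl h1)]
    · obtain rfl := Subtype.ext heq
      rfl
    · rcases (Nat.succ_le_of_lt hgt).eq_or_lt with h1 | h1
      · exact (adj b a h1.symm hb ha).symm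
      · have f1 : simplePerm a b.fst = b.fst := simplePerm_of_ne a
          (by simp only [SimpleIdx.fst, ne_eq, Fin.mk.injEq]; omega)
          (by simp only [SimpleIdx.fst, SimpleIdx.snd, ne_eq, Fin.mk.injEq]; omega)
        have f2 : simplePerm a b.snd = b.snd := simplePerm_of_ne a
          (by simp only [SimpleIdx.fst, SimpleIdx.snd, ne_eq, Fin.mk.injEq]; omega)
          (by simp only [SimpleIdx.snd, ne_eq, Fin.mk.injEq]; omega)
        have f3 : simplePerm b a.fst = a.fst := simplePerm_of_ne b
          (by simp only [SimpleIdx.fst, ne_eq, Fin.mk.injEq]; omega)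
          (by simp only [SimpleIdx.fst, SimpleIdx.snd, ne_eq, Fin.mk.injEq]; omega)
        have f4 : simplePerm b a.snd = a.snd := simplePerm_of_ne b
          (by simp only [SimpleIdx.fst, SimpleIdx.snd, ne_eq, Fin.mk.injEq]; omega)
          (by simp only [SimpleIdx.snd, ne_eq, Fin.mk.injEq]; omega)
        rw [key _ (sortMeasure_lt ha) b (by simpa only [permAct_simplePerm, f1, f2] using hb),
          key _ (sortMeasure_lt hb) a (by simpa only [permAct_simplePerm, f3, f4] using ha),
          ← mul_assoc, ← mul_assoc, (Hecke.isRep Q n).psi_psi a b trivial trivial (Or.inr h1),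
          ← permAct_mul, ← permAct_mul, commute_simplePerm (Or.inr h1)]

/-- The recursion for `thetaL` holds for every descent. -/
theorem thetaL_descent {t : Fin n → Fin d} {a : SimpleIdx n} (ha : t a.snd < t a.fst) :
    thetaL p Q t = Hecke.psi Q a * thetaL p Q (permAct (simplePerm a) t) := by
  have h : ∃ b : SimpleIdx n, t b.snd < t b.fst := ⟨a, ha⟩
  rw [thetaL, dif_pos h]
  exact psi_thetaL_descent hdisj t _ _ h.choose_spec ha

/-- For an ascent this is the recursion of `thetaL` at `s_a · t`; for a descent the leading `ψ_a` of
`thetaL` is cancelled by `ψ_a² = 1`. -/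
theorem psi_thetaL_of_ne {t : Fin n → Fin d} {a : SimpleIdx n} (h : t a.fst ≠ t a.snd) :
    Hecke.psi Q a * thetaL p Q t = thetaL p Q (permAct (simplePerm a) t) := by
  rcases lt_or_gt_of_ne h with hlt | hgt
  · rw [thetaL_descent hdisj (t := permAct (simplePerm a) t) (a := a),
      permAct_permAct_simplePerm]
    rwa [permAct_simplePerm, permAct_simplePerm, simplePerm_fst, simplePerm_snd]
  · rw [thetaL_descent hdisj hgt, ← colorE_mul_thetaL (permAct (simplePerm a) t), ← mul_assoc,
      ← mul_assoc, psi_psi_colorE hdisj]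
    rw [permAct_simplePerm, permAct_simplePerm, simplePerm_fst, simplePerm_snd]
    exact h.symm

/-- Peel off a descent `b`. If `b` is far from `a`, the `ψ`s commute. If `b` is adjacent to `a`,
then `s_b · t` has a descent at `a`, and the braid relation turns `ψ_a ψ_b ψ_a` into `ψ_b ψ_a ψ_b`.
The last `ψ_b` then acts on `s_a s_b · t`, where the pair of equal letters sits at `b`, and
induction applies with the same `a'`. -/
theorem psi_thetaL_of_eq (t : Fin n → Fin d) : ∀ a a' : SimpleIdx n, t a.fst = t a.snd →
    a'.fst = sortPos t a.fst → Hecke.psi Q a * thetaL p Q t = thetaL p Q t * Hecke.psi Q a' := by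
  induction t using descent_induction with
  | mono t ht =>
    intro a a' ha ha'
    rw [sortPos_of_monotone ht, Equiv.Perm.one_apply] at ha'
    obtain rfl : a' = a := Subtype.ext (congrArg Fin.val ha')
    rw [thetaL_of_monotone ht, psi_mul_colorE, permAct_simplePerm_of_eq ha]
  | step t ih h =>
    obtain ⟨b, hb⟩ := h
    intro a a' ha ha'
    have mb := sortMeasure_lt hb
    have hne : a ≠ b := fun h => hb.ne (h ▸ ha.symm)
    rw [thetaL_descent hdisj hb]
    by_cases h1 : b.1 = a.1 + 1
    · have h1' : b.fst = a.snd := Fin.ext h1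
      have h2 : a.fst ≠ b.snd := by
        simp only [SimpleIdx.fst, SimpleIdx.snd, ne_eq, Fin.mk.injEq]; omega
      have e1 : simplePerm b a.fst = a.fst := simplePerm_of_ne b (h1' ▸ a.fst_ne_snd) h2
      have e2 : simplePerm a b.snd = b.snd :=
        simplePerm_of_ne a h2.symm (h1' ▸ b.fst_ne_snd.symm)
      have e3 : simplePerm b a.snd = b.snd := by rw [← h1', simplePerm_fst]
      have e4 := simplePerm_fst a
      have e5 := simplePerm_snd a
      have e6 : simplePerm b b.snd = a.snd := by rw [← h1', simplePerm_snd]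
      have d1 : permAct (simplePerm b) t a.snd < permAct (simplePerm b) t a.fst := by
        simp only [permAct_simplePerm, e1, e3]
        rwa [ha, ← h1']
      have hi := ih _ ((sortMeasure_lt d1).trans mb) b a'
        (by simp only [permAct_simplePerm, h1', e5, e1, e2, e6, ha])
        (by rw [sortPos_permAct_of_ne d1.ne', sortPos_permAct_of_ne hb.ne', h1', e5, e1, ha'])
      rw [thetaL_descent hdisj d1, ← braid_thetaL hdisj h1, hi]
      · simp only [mul_assoc]
      · left
        simp only [permAct_simplePerm, e4, e3, e5, e1]
        rw [ha, ← h1']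
        exact hb.ne
    by_cases h2 : a.1 = b.1 + 1
    · have h1' : a.fst = b.snd := Fin.ext h2
      have h3 : b.fst ≠ a.snd := by
        simp only [SimpleIdx.fst, SimpleIdx.snd, ne_eq, Fin.mk.injEq]; omega
      have e1 : simplePerm a b.fst = b.fst := simplePerm_of_ne a (h1' ▸ b.fst_ne_snd) h3
      have e2 : simplePerm b a.snd = a.snd :=
        simplePerm_of_ne b h3.symm (h1' ▸ a.fst_ne_snd.symm)
      have e3 : simplePerm a b.snd = a.snd := by rw [← h1', simplePerm_fst]
      have e4 := simplePerm_fst b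
      have e5 := simplePerm_snd b
      have e6 : simplePerm a a.snd = b.snd := by rw [← h1', simplePerm_snd]
      have d1 : permAct (simplePerm b) t a.snd < permAct (simplePerm b) t a.fst := by
        simp only [permAct_simplePerm, h1', e2, e5]
        rwa [← ha, h1']
      have hi := ih _ ((sortMeasure_lt d1).trans mb) b a'
        (by simp only [permAct_simplePerm, e1, e4, e3, e2, ← ha, h1'])
        (by rw [sortPos_permAct_of_ne d1.ne', sortPos_permAct_of_ne hb.ne', e1, e4, ha', h1'])
      rw [thetaL_descent hdisj d1, braid_thetaL hdisj h2, hi]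
      · simp only [mul_assoc]
      · right
        simp only [permAct_simplePerm, e1, e4, e6, e5]
        exact hb.ne
    have far : a.1 + 1 < b.1 ∨ b.1 + 1 < a.1 := by
      have : a.1 ≠ b.1 := fun h => hne (Subtype.ext h)
      omega
    have f3 : simplePerm b a.fst = a.fst := simplePerm_of_ne b
      (by simp only [SimpleIdx.fst, ne_eq, Fin.mk.injEq]; omega)
      (by simp only [SimpleIdx.fst, SimpleIdx.snd, ne_eq, Fin.mk.injEq]; omega)
    have f4 : simplePerm b a.snd = a.snd := simplePerm_of_ne b
      (by simp only [SimpleIdx.fst, SimpleIdx.snd, ne_eq, Fin.mk.injEq]; omega)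
      (by simp only [SimpleIdx.snd, ne_eq, Fin.mk.injEq]; omega)
    rw [← mul_assoc, (Hecke.isRep Q n).psi_psi a b trivial trivial far, mul_assoc,
      ih _ mb a a' (by simpa only [permAct_simplePerm, f3, f4] using ha)
        (by rw [sortPos_permAct_of_ne hb.ne', f3, ha']), mul_assoc]

theorem y_thetaL (t : Fin n → Fin d) : ∀ i : Fin n,
    Hecke.y Q i * thetaL p Q t = thetaL p Q t * Hecke.y Q (sortPos t i) := by
  induction t using descent_induction with
  | mono t ht =>
    intro i
    rw [thetaL_of_monotone ht, sortPos_of_monotone ht, y_mul_colorE, Equiv.Perm.one_apply]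
  | step t ih h =>
    obtain ⟨b, hb⟩ := h
    intro i
    have hi := ih _ (sortMeasure_lt hb) (simplePerm b i)
    rw [sortPos_permAct_of_ne hb.ne', simplePerm_simplePerm] at hi
    have hy := congrArg (· * thetaL p Q (permAct (simplePerm b) t))
      (y_psi_colorE (p := p) (Q := Q) (t := permAct (simplePerm b) t) (a := b)
        (by rw [permAct_simplePerm, permAct_simplePerm, simplePerm_fst, simplePerm_snd]
            exact hb.ne) i)
    simp only [mul_assoc, colorE_mul_thetaL] at hy
    rw [thetaL_descent hdisj hb, hy, hi, mul_assoc]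

theorem e_thetaL (t : Fin n → Fin d) : ∀ k : Fin n → K,
    Hecke.e Q k * thetaL p Q t = thetaL p Q t * Hecke.e Q (permAct (sortPos t) k) := by
  induction t using descent_induction with
  | mono t ht =>
    intro k
    rw [thetaL_of_monotone ht, sortPos_of_monotone ht, e_mul_colorE, permAct_one]
  | step t ih h =>
    obtain ⟨b, hb⟩ := h
    intro k
    have hi := ih _ (sortMeasure_lt hb) (permAct (simplePerm b) k)
    rw [permAct_sortPos_of_ne hb.ne'] at hi
    have he := (Hecke.isRep Q n).psi_e b (permAct (simplePerm b) k) trivial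
    rw [permAct_permAct_simplePerm] at he
    rw [thetaL_descent hdisj hb, ← mul_assoc, ← he, mul_assoc, hi, mul_assoc]

/-- Both elements use the same choices of descents in opposite order, so the `ψ`s cancel in pairs
from the inside, always between distinct colours. -/
theorem thetaL_mul_thetaR (t : Fin n → Fin d) :
    thetaL p Q t * thetaR p Q t = colorE p Q t := by
  induction t using descent_induction with
  | mono t ht =>
    have h : ¬ ∃ b : SimpleIdx n, t b.snd < t b.fst := by
      rintro ⟨b, hb⟩
      exact absurd hb (not_lt.2 (ht b.fst_lt_snd.le))
    rw [thetaL, thetaR, dif_neg h, dif_neg h, colorE_mul_self]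
  | step t ih h =>
    rw [thetaL, thetaR, dif_pos h, dif_pos h, ← mul_assoc, mul_assoc (Hecke.psi Q h.choose),
      ih _ (sortMeasure_lt h.choose_spec), mul_assoc, ← psi_mul_colorE, ← mul_assoc,
      psi_psi_colorE hdisj h.choose_spec.ne']

/-- Moving `e(t)` from the left of `thetaL` to its right replaces each `k` by `π_t · k`, a bijection
from the tuples of colour `t` to those of colour `t^λ`. -/
theorem thetaL_mul_colorE {l : Comp d n} (t : Shape l) :
    thetaL p Q t.1 * colorE p Q (trivialTuple l) = thetaL p Q t.1 := by
  conv_rhs => rw [← colorE_mul_thetaL t.1]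
  rw [colorE, colorE, Finset.mul_sum, Finset.sum_mul]
  refine Finset.sum_bij' (fun k _ => ⟨permAct (sortPos t.1)⁻¹ k.1, fun i => ?_⟩)
    (fun k _ => ⟨permAct (sortPos t.1) k.1, fun i => ?_⟩) (by simp) (by simp) ?_ ?_ ?_
  · have := k.2 (sortPos t.1 i)
    rw [trivialTuple_sortPos] at this
    simpa [permAct] using this
  · have := k.2 ((sortPos t.1)⁻¹ i)
    rw [← trivialTuple_sortPos t] at this
    simpa [permAct] using this
  · intro k _
    simp [← permAct_mul, permAct_one]
  · intro k _
    simp [← permAct_mul, permAct_one]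
  · intro k _
    rw [e_thetaL hdisj, ← permAct_mul, mul_inv_cancel, permAct_one]

end relations

end Theta

/-! ### The isomorphism -/

section Words

variable {d n : ℕ} {B : Type*} [Ring B]

/-- The coefficient of the monomial matrix of `ψ_{a_1} ⋯ ψ_{a_r}` in column `t`. -/
def wordCoeff (P : SimpleIdx n → B) : List (SimpleIdx n) → (Fin n → Fin d) → B
  | [], _ => 1
  | a :: w, t => psiCoeff P a (permAct (wordPerm w) t) * wordCoeff P w t

theorem wordPerm_cons (a : SimpleIdx n) (w : List (SimpleIdx n)) :
    wordPerm (a :: w) = simplePerm a * wordPerm w := by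
  simp [wordPerm]

/-- Along a word of minimal length moving `t` to its end point, only distinct entries are
exchanged. -/
theorem wordCoeff_eq_one (P : SimpleIdx n → B) (t : Fin n → Fin d) :
    ∀ w : List (SimpleIdx n), (∀ w' : List (SimpleIdx n),
      permAct (wordPerm w') t = permAct (wordPerm w) t → w.length ≤ w'.length) →
    wordCoeff P w t = 1
  | [], _ => rfl
  | a :: w, h => by
    have hne : permAct (wordPerm w) t a.fst ≠ permAct (wordPerm w) t a.snd := by
      intro heq
      have := h w (by rw [wordPerm_cons, permAct_mul, permAct_simplePerm_of_eq heq])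
      simp at this
    rw [wordCoeff, psiCoeff_of_ne P hne, one_mul]
    refine wordCoeff_eq_one P t w fun w' hw' => ?_
    have := h (a :: w') (by rw [wordPerm_cons, wordPerm_cons, permAct_mul, permAct_mul, hw'])
    simpa using this

theorem exists_word (t : Fin n → Fin d) :
    ∃ w : List (SimpleIdx n), Monotone (permAct (wordPerm w) t) := by
  induction t using descent_induction with
  | mono t ht => exact ⟨[], by simpa [wordPerm, permAct_one] using ht⟩
  | step t ih h =>
    obtain ⟨b, hb⟩ := h
    obtain ⟨w, hw⟩ := ih _ (sortMeasure_lt hb)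
    refine ⟨w ++ [b], ?_⟩
    have : wordPerm (w ++ [b]) = wordPerm w * simplePerm b := by simp [wordPerm]
    rwa [this, permAct_mul]

theorem eq_trivialShape_of_monotone {l : Comp d n} (t : Shape l) (h : Monotone t.1) :
    t = trivialShape l := by
  refine Subtype.ext (funext fun i => ?_)
  rw [← trivialTuple_sortPos t i, sortPos_of_monotone h]
  rfl

theorem wordPerm_reverse (w : List (SimpleIdx n)) : wordPerm w.reverse = (wordPerm w)⁻¹ := by
  induction w with
  | nil => simp [wordPerm]
  | cons a w ih =>
    have h1 : wordPerm (a :: w).reverse = wordPerm w.reverse * simplePerm a := by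
      simp [wordPerm]
    rw [h1, ih, wordPerm_cons, mul_inv_rev, simplePerm_inv]

theorem permLength_wordPerm_le (w : List (SimpleIdx n)) : permLength (wordPerm w) ≤ w.length :=
  Nat.sInf_le ⟨w, rfl, rfl⟩

/-- Reduced expressions of a sorting permutation have minimal length among all words that sort
the tuple. -/
theorem IsSortingPerm.length_le {l : Comp d n} {t : Shape l} {π : Equiv.Perm (Fin n)}
    (h : IsSortingPerm t π) {w : List (SimpleIdx n)} (hw : w.length = permLength π)
    {w' : List (SimpleIdx n)} (hw' : permAct (wordPerm w') t.1 = trivialTuple l) :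
    w.length ≤ w'.length :=
  hw ▸ (h.2 _ hw').trans (permLength_wordPerm_le w')

theorem permLength_inv (π : Equiv.Perm (Fin n)) : permLength π⁻¹ = permLength π := by
  unfold permLength
  congr 1
  ext r
  constructor <;> rintro ⟨w, hw, hr⟩ <;>
    exact ⟨w.reverse, by simp [wordPerm_reverse, hw], by rw [List.length_reverse, hr]⟩

end Words

/-! ### The homomorphism `Ψ` and its surjectivity. -/

section Iso

variable {A : Type*} [CommRing A] {K : Type*} [Fintype K] {d n : ℕ}
  (p : K → Fin d) (Q : K → K → MvPolynomial (Fin 2) A)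
  (hdisj : ∀ k k', p k ≠ p k' → Q k k' = 1)

/-- The component of `Ψ` indexed by `λ`. -/
def matHom (l : Comp d n) :
    Hecke Q n →ₐ[A] Matrix (Shape l) (Shape l) (TensorHecke p Q l) :=
  ((flat_isBlockRep p Q l).matRep hdisj).lift

/-- The homomorphism `Ψ`. -/
def psiHom : Hecke Q n →ₐ[A]
    ((l : Comp d n) → Matrix (Shape l) (Shape l) (TensorHecke p Q l)) :=
  AlgHom.pi (matHom p Q hdisj)

variable {p Q}

theorem psiHom_apply (x : Hecke Q n) (l : Comp d n) :
    psiHom p Q hdisj x l = matHom p Q hdisj l x := rfl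

theorem matHom_e (l : Comp d n) (k : Fin n → K) :
    matHom p Q hdisj l (Hecke.e Q k) = matE l (flatE p Q l) k := IsRep.lift_e _ k

theorem matHom_y (l : Comp d n) (i : Fin n) :
    matHom p Q hdisj l (Hecke.y Q i) = matY l (flatY p Q l) i := IsRep.lift_y _ i

theorem matHom_psi (l : Comp d n) (a : SimpleIdx n) :
    matHom p Q hdisj l (Hecke.psi Q a) = matPsi l (flatPsi p Q l) a := IsRep.lift_psi _ a

theorem matHom_psiWord (l : Comp d n) (w : List (SimpleIdx n)) :
    matHom p Q hdisj l (Hecke.psiWord Q w) =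
      mono (shapeAct (wordPerm w)) fun t => wordCoeff (flatPsi p Q l) w t.1 := by
  induction w with
  | nil =>
    have h1 : (shapeAct (wordPerm []) : Shape l → Shape l) = id := funext fun t => by
      simp [wordPerm, shapeAct_one]
    rw [h1, mono_id]
    simp [Hecke.psiWord, wordCoeff]
  | cons a w ih =>
    have h1 : Hecke.psiWord Q (a :: w) = Hecke.psi Q a * Hecke.psiWord Q w := by
      simp [Hecke.psiWord]
    rw [h1, map_mul, ih, matHom_psi, matPsi, mono_mul_mono]
    congr 1

theorem sortPos_trivialShape (l : Comp d n) : sortPos (trivialShape l).1 = 1 :=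
  sortPos_of_monotone (monotone_trivialTuple l)

/-- The concatenation has colours `t^λ`, so only the column `t^λ` survives, and there sorting is the
identity. -/
theorem matHom_e_concat (l : Comp d n) (k : (j : Fin d) → Fin (l.1 j) → Part p j) :
    matHom p Q hdisj l (Hecke.e Q (concat p l k)) =
      Matrix.single (trivialShape l) (trivialShape l) (tensorE p Q l k) := by
  rw [matHom_e, matE]
  ext s t
  rw [mono_apply, id, Matrix.single_apply]
  by_cases ht : t = trivialShape l
  · subst ht
    rw [sortPos_trivialShape, permAct_one, flatE_concat]
    by_cases hs : s = trivialShape l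
    · simp [hs]
    · simp [hs, Ne.symm hs]
  · rw [(flat_isBlockRep p Q l).supp_sortPos, ite_self, if_neg fun h => ht h.2.symm]
    intro h
    exact ht (Subtype.ext (funext fun i => (h i).symm.trans (p_concat l p k i)))

theorem matHom_colorE (l : Comp d n) :
    matHom p Q hdisj l (colorE p Q (trivialTuple l)) =
      Matrix.single (trivialShape l) (trivialShape l) 1 := by
  classical
  rw [← blockEmb_one, ← sum_tensorE, map_sum, map_sum, ← Matrix.singleAddMonoidHom_apply,
    map_sum]
  refine Finset.sum_congr rfl fun k _ => ?_
  rw [blockEmb_tensorE, matHom_e_concat, Matrix.singleAddMonoidHom_apply]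

theorem matHom_colorE_of_ne {l l' : Comp d n} (h : l' ≠ l) :
    matHom p Q hdisj l' (colorE p Q (trivialTuple l)) = 0 := by
  rw [colorE, map_sum]
  refine Finset.sum_eq_zero fun k _ => ?_
  rw [matHom_e, matE]
  ext s t
  rw [mono_apply, (flat_isBlockRep p Q l').supp_sortPos]
  · simp
  · intro hk
    refine h (Subtype.ext (funext fun j => ?_))
    rw [← t.2 j, ← card_trivialTuple l j]
    congr 1
    ext i
    rw [Finset.mem_filter, Finset.mem_filter, ← hk, k.2]

/-- `Ψ` maps `ι_λ(v)` to `v E_{t^λ, t^λ}`. -/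
theorem matHom_blockEmb (l : Comp d n) (v : TensorHecke p Q l) :
    matHom p Q hdisj l (blockEmb p Q l v) =
      Matrix.single (trivialShape l) (trivialShape l) v := by
  let S : Subalgebra A (TensorHecke p Q l) :=
    { carrier := {v | matHom p Q hdisj l (blockEmb p Q l v) =
        Matrix.single (trivialShape l) (trivialShape l) v}
      mul_mem' := by
        intro x y hx hy
        rw [Set.mem_ofPred_eq] at *
        rw [map_mul, map_mul, hx, hy, Matrix.single_mul_single_same]
      add_mem' := by
        intro x y hx hy
        rw [Set.mem_ofPred_eq] at *
        rw [map_add, map_add, hx, hy, Matrix.single_add]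
      algebraMap_mem' := by
        intro r
        rw [Set.mem_ofPred_eq, Algebra.algebraMap_eq_smul_one, map_smul, map_smul, blockEmb_one,
          matHom_colorE, Matrix.smul_single] }
  refine tensorHecke_mem_of_gen S (fun k => ?_) (fun j b => ?_) (fun j b => ?_) v
  · change matHom p Q hdisj l _ = _
    rw [blockEmb_tensorE, matHom_e_concat]
  · change matHom p Q hdisj l _ = _
    rw [blockEmb_tensorY, map_mul, matHom_colorE, matHom_y, matY, mono_mul_single,
      sortPos_trivialShape, Equiv.Perm.one_apply, flatY_blockEquiv, mul_one, id]
  · change matHom p Q hdisj l _ = _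
    have hin := inBlock_blockSimple l j b
    rw [blockEmb_tensorPsi, map_mul, matHom_colorE, matHom_psi, matPsi, mono_mul_single,
      shapeAct_of_eq (t := trivialShape l) hin, psiCoeff_of_eq (b := blockSimple l j b) (t := (trivialShape l).1) _ hin, flatPsi_blockSimple,
      mul_one]
    rw [sortPos_trivialShape, Equiv.Perm.one_apply]

theorem psiHom_blockEmb (l : Comp d n) (v : TensorHecke p Q l) :
    psiHom p Q hdisj (blockEmb p Q l v) =
      Pi.single l (Matrix.single (trivialShape l) (trivialShape l) v) := by
  funext l'
  rw [psiHom_apply]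
  by_cases h : l' = l
  · subst h
    rw [Pi.single_eq_same, matHom_blockEmb]
  · rw [Pi.single_eq_of_ne h, ← colorE_mul_blockEmb, map_mul, matHom_colorE_of_ne hdisj h,
      zero_mul]

/-- Minimality makes both words act with coefficient `1`, so they only move the entry from `(t^λ,
t^λ)` to `(t', t)`. Minimality is imposed among words with the given effect on tuples, which covers
both the reduced expressions of the theorem and the words chosen for surjectivity. -/
theorem psiHom_word (l : Comp d n) (t' t : Shape l) (w' w : List (SimpleIdx n))
    (hw' : permAct (wordPerm w') (trivialTuple l) = t'.1)
    (hw'min : ∀ u : List (SimpleIdx n), permAct (wordPerm u) (trivialTuple l) = t'.1 →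
      w'.length ≤ u.length)
    (hw : permAct (wordPerm w) t.1 = trivialTuple l)
    (hwmin : ∀ u : List (SimpleIdx n), permAct (wordPerm u) t.1 = trivialTuple l →
      w.length ≤ u.length) (v : TensorHecke p Q l) :
    psiHom p Q hdisj (Hecke.psiWord Q w' * blockEmb p Q l v * Hecke.psiWord Q w) =
      Pi.single l (Matrix.single t' t v) := by
  funext l'
  rw [map_mul, map_mul, psiHom_blockEmb, Pi.mul_apply, Pi.mul_apply, psiHom_apply, psiHom_apply]
  by_cases h : l' = l
  · subst h
    have h1 : shapeAct (wordPerm w') (trivialShape l') = t' := Subtype.ext hw'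
    have h2 : shapeAct (wordPerm w) t = trivialShape l' := Subtype.ext hw
    have h3 : wordCoeff (flatPsi p Q l') w' (trivialShape l').1 = 1 :=
      wordCoeff_eq_one _ _ _ fun u hu => hw'min u (hu.trans hw')
    have h4 : wordCoeff (flatPsi p Q l') w t.1 = 1 :=
      wordCoeff_eq_one _ _ _ fun u hu => hwmin u (hu.trans hw)
    rw [Pi.single_eq_same, Pi.single_eq_same, matHom_psiWord, matHom_psiWord, mono_mul_single,
      single_mul_mono (shapeAct_injective _) _ _ _ t h2, h1, h3, h4, one_mul, mul_one]
  · rw [Pi.single_eq_of_ne h, Pi.single_eq_of_ne h, mul_zero, zero_mul]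

theorem exists_minimal_word (l : Comp d n) (t : Shape l) :
    ∃ w : List (SimpleIdx n), permAct (wordPerm w) t.1 = trivialTuple l ∧
      ∀ u : List (SimpleIdx n), permAct (wordPerm u) t.1 = trivialTuple l →
        w.length ≤ u.length := by
  have hex : ∃ r, ∃ w : List (SimpleIdx n),
      permAct (wordPerm w) t.1 = trivialTuple l ∧ w.length = r := by
    obtain ⟨w, hw⟩ := exists_word t.1
    exact ⟨_, w, congrArg Subtype.val
      (eq_trivialShape_of_monotone (shapeAct (wordPerm w) t) hw), rfl⟩
  classical
  obtain ⟨w, hw, hr⟩ := Nat.find_spec hex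
  exact ⟨w, hw, fun u hu => hr ▸ Nat.find_min' hex ⟨u, hu, rfl⟩⟩

theorem permAct_wordPerm_reverse {X : Type*} {w : List (SimpleIdx n)} {x y : Fin n → X} :
    permAct (wordPerm w.reverse) x = y ↔ permAct (wordPerm w) y = x := by
  rw [wordPerm_reverse]
  constructor
  · rintro rfl
    rw [← permAct_mul, mul_inv_cancel, permAct_one]
  · rintro rfl
    rw [← permAct_mul, inv_mul_cancel, permAct_one]

theorem exists_psiHom_eq_single (l : Comp d n) (t' t : Shape l) (v : TensorHecke p Q l) :
    ∃ x, psiHom p Q hdisj x = Pi.single l (Matrix.single t' t v) := by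
  obtain ⟨w, hw, hwmin⟩ := exists_minimal_word l t
  obtain ⟨w', hw', hwmin'⟩ := exists_minimal_word l t'
  refine ⟨_, psiHom_word hdisj l t' t w'.reverse w (permAct_wordPerm_reverse.2 hw')
    (fun u hu => ?_) hw hwmin v⟩
  rw [List.length_reverse, ← List.length_reverse (as := u)]
  exact hwmin' _ (permAct_wordPerm_reverse.2 hu)

instance : Finite (Comp d n) :=
  Finite.of_injective (fun (l : Comp d n) (j : Fin d) => (⟨l.1 j, by
    have := Finset.single_le_sum (f := l.1) (fun _ _ => Nat.zero_le _) (Finset.mem_univ j)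
    rw [l.2] at this
    omega⟩ : Fin (n + 1))) fun l l' h => Subtype.ext <| funext fun j => by
      simpa using congrArg Fin.val (congrFun h j)

instance : Fintype (Comp d n) := Fintype.ofFinite _

theorem eq_sum_single {R : Comp d n → Type*} [∀ l, Ring (R l)]
    (x : (l : Comp d n) → Matrix (Shape l) (Shape l) (R l)) :
    x = ∑ l, ∑ t', ∑ t, Pi.single l (Matrix.single t' t (x l t' t)) := by
  have e : ∀ l m, Pi.single l m = AddMonoidHom.single
    (fun l : Comp d n => Matrix (Shape l) (Shape l) (R l)) l m := fun _ _ => rfl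
  conv_lhs => rw [← Finset.univ_sum_single x]
  refine Finset.sum_congr rfl fun l _ => ?_
  conv_lhs => rw [Matrix.matrix_eq_sum_single (x l), e, map_sum]
  refine Finset.sum_congr rfl fun t' _ => ?_
  rw [map_sum]
  rfl

/-- Every family of matrices is a sum of matrices with one entry. -/
theorem single_induction {R : Comp d n → Type*} [∀ l, Ring (R l)]
    {motive : ((l : Comp d n) → Matrix (Shape l) (Shape l) (R l)) → Prop}
    (zero : motive 0) (add : ∀ x y, motive x → motive y → motive (x + y))
    (x : (l : Comp d n) → Matrix (Shape l) (Shape l) (R l))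
    (single : ∀ (l : Comp d n) (t' t : Shape l),
      motive (Pi.single l (Matrix.single t' t (x l t' t)))) : motive x := by
  rw [eq_sum_single x]
  exact Finset.sum_induction _ motive add zero fun l _ =>
    Finset.sum_induction _ motive add zero fun t' _ =>
      Finset.sum_induction _ motive add zero fun t _ => single l t' t

theorem psiHom_surjective : Function.Surjective (psiHom (n := n) p Q hdisj) := by
  intro x
  induction x using single_induction with
  | zero => exact ⟨0, map_zero _⟩
  | add x y hx hy =>
    obtain ⟨x, rfl⟩ := hx
    obtain ⟨y, rfl⟩ := hy
    exact ⟨x + y, map_add _ x y⟩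
  | single l t' t => exact exists_psiHom_eq_single hdisj l t' t _

end Iso

/-! ### Injectivity of `Ψ` by means of an explicit left inverse. -/

section Inverse

variable {A : Type*} [CommRing A] {K : Type*} [Fintype K] {d n : ℕ}
  (p : K → Fin d) (Q : K → K → MvPolynomial (Fin 2) A)

/-- The inverse of `Ψ` as a linear map. -/
def invHom : ((l : Comp d n) → Matrix (Shape l) (Shape l) (TensorHecke p Q l)) →ₗ[A]
    Hecke Q n where
  toFun M := ∑ l, ∑ t' : Shape l, ∑ t : Shape l,
    thetaL p Q t'.1 * blockEmb p Q l (M l t' t) * thetaR p Q t.1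
  map_add' M N := by
    simp only [Pi.add_apply, Matrix.add_apply, map_add, mul_add, add_mul, Finset.sum_add_distrib]
  map_smul' a M := by
    simp only [Pi.smul_apply, Matrix.smul_apply, map_smul, mul_smul_comm, smul_mul_assoc,
      Finset.smul_sum, RingHom.id_apply]

variable {p Q}

theorem invHom_apply (M : (l : Comp d n) → Matrix (Shape l) (Shape l) (TensorHecke p Q l)) :
    invHom p Q M = ∑ l, ∑ t' : Shape l, ∑ t : Shape l,
      thetaL p Q t'.1 * blockEmb p Q l (M l t' t) * thetaR p Q t.1 := rfl

theorem invHom_single (l : Comp d n) (t' t : Shape l) (v : TensorHecke p Q l) :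
    invHom p Q (Pi.single l (Matrix.single t' t v)) =
      thetaL p Q t'.1 * blockEmb p Q l v * thetaR p Q t.1 := by
  rw [invHom_apply, Finset.sum_eq_single l, Finset.sum_eq_single t', Finset.sum_eq_single t]
  · rw [Pi.single_eq_same, Matrix.single_apply_same]
  · intro s _ hs
    rw [Pi.single_eq_same, Matrix.single_apply, if_neg fun h => hs h.2.symm, map_zero, mul_zero,
      zero_mul]
  · simp
  · intro s _ hs
    refine Finset.sum_eq_zero fun s' _ => ?_
    rw [Pi.single_eq_same, Matrix.single_apply, if_neg fun h => hs h.1.symm, map_zero, mul_zero,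
      zero_mul]
  · simp
  · intro l' _ hl
    refine Finset.sum_eq_zero fun s _ => Finset.sum_eq_zero fun s' _ => ?_
    rw [Pi.single_eq_of_ne hl, Matrix.zero_apply, map_zero, mul_zero, zero_mul]
  · simp

theorem mul_single_eq {R : Comp d n → Type*} [∀ l, Ring (R l)]
    (x : (l : Comp d n) → Matrix (Shape l) (Shape l) (R l)) (l : Comp d n)
    (m : Matrix (Shape l) (Shape l) (R l)) : x * Pi.single l m = Pi.single l (x l * m) := by
  funext l'
  rw [Pi.mul_apply]
  by_cases h : l' = l
  · subst h
    rw [Pi.single_eq_same, Pi.single_eq_same]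
  · rw [Pi.single_eq_of_ne h, Pi.single_eq_of_ne h, mul_zero]

theorem single_mul_eq {R : Comp d n → Type*} [∀ l, Ring (R l)]
    (x : (l : Comp d n) → Matrix (Shape l) (Shape l) (R l)) (l : Comp d n)
    (m : Matrix (Shape l) (Shape l) (R l)) : Pi.single l m * x = Pi.single l (m * x l) := by
  funext l'
  rw [Pi.mul_apply]
  by_cases h : l' = l
  · subst h
    rw [Pi.single_eq_same, Pi.single_eq_same]
  · rw [Pi.single_eq_of_ne h, Pi.single_eq_of_ne h, zero_mul]

theorem shape_bijective : Function.Bijective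
    (fun s : (l : Comp d n) × Shape l => (s.2.1 : Fin n → Fin d)) := by
  constructor
  · rintro ⟨l, t⟩ ⟨l', t'⟩ h
    have hl : l = l' := Subtype.ext <| funext fun j => by
      rw [← t.2 j, ← t'.2 j]
      simp only at h
      rw [h]
    subst hl
    simp only at h
    rw [Subtype.ext h]
  · intro t
    refine ⟨⟨⟨fun j => (Finset.univ.filter fun a => t a = j).card, ?_⟩, ⟨t, fun j => rfl⟩⟩, rfl⟩
    rw [← Finset.card_eq_sum_card_fiberwise (fun a _ => Finset.mem_univ _), Finset.card_univ,
      Fintype.card_fin]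

variable (hdisj : ∀ k k', p k ≠ p k' → Q k k' = 1)
include hdisj

/-- The diagonal place `t` contributes `θ_t e_λ θ'_t = e(t)`, and every colour tuple lies in exactly
one `J^λ`. -/
theorem invHom_one : invHom p Q (1 : (l : Comp d n) → _) = 1 := by
  rw [invHom_apply, ← sum_colorE (p := p) (Q := Q) (n := n),
    ← Fintype.sum_bijective _ (shape_bijective (d := d) (n := n))
      (fun s => colorE p Q s.2.1) _ (fun _ => rfl), Fintype.sum_sigma]
  refine Finset.sum_congr rfl fun l _ => Finset.sum_congr rfl fun t' _ => ?_
  rw [Finset.sum_eq_single t']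
  · rw [Pi.one_apply, Matrix.one_apply_eq, blockEmb_one, thetaL_mul_colorE hdisj,
      thetaL_mul_thetaR hdisj]
  · intro t _ ht
    rw [Pi.one_apply, Matrix.one_apply_ne (Ne.symm ht), map_zero, mul_zero, zero_mul]
  · simp

/-- Each generator acts by a monomial matrix, so compatibility with `invHom` reduces to one
commutation rule past `thetaL` for each column. -/
theorem mul_invHom_of_mono (g : Hecke Q n) (σ : ∀ l : Comp d n, Shape l → Shape l)
    (c : ∀ l : Comp d n, Shape l → TensorHecke p Q l)
    (hg : ∀ l, matHom p Q hdisj l g = mono (σ l) (c l))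
    (hc : ∀ l t, g * thetaL p Q t.1 = thetaL p Q (σ l t).1 * blockEmb p Q l (c l t))
    (M : (l : Comp d n) → Matrix (Shape l) (Shape l) (TensorHecke p Q l)) :
    g * invHom p Q M = invHom p Q (psiHom p Q hdisj g * M) := by
  induction M using single_induction with
  | zero => rw [map_zero, mul_zero, mul_zero, map_zero]
  | add x y hx hy => rw [map_add, mul_add, mul_add, map_add, hx, hy]
  | single l t' t =>
    rw [mul_single_eq, psiHom_apply, hg, mono_mul_single, invHom_single, invHom_single, map_mul,
      ← mul_assoc, ← mul_assoc, hc, ← mul_assoc]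

theorem mul_invHom (x : Hecke Q n)
    (M : (l : Comp d n) → Matrix (Shape l) (Shape l) (TensorHecke p Q l)) :
    x * invHom p Q M = invHom p Q (psiHom p Q hdisj x * M) := by
  let S : Subalgebra A (Hecke Q n) :=
    { carrier := {x | ∀ M : (l : Comp d n) → Matrix (Shape l) (Shape l) (TensorHecke p Q l),
        x * invHom p Q M = invHom p Q (psiHom p Q hdisj x * M)}
      mul_mem' := by
        intro x y hx hy M
        rw [mul_assoc, hy M, hx (psiHom p Q hdisj y * M), map_mul (psiHom p Q hdisj) x y,
          mul_assoc]
      add_mem' := by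
        intro x y hx hy M
        rw [add_mul, hy, hx, map_add, add_mul, map_add]
      algebraMap_mem' := by
        intro r M
        rw [AlgHom.commutes, Algebra.algebraMap_eq_smul_one, Algebra.algebraMap_eq_smul_one,
          smul_mul_assoc, smul_mul_assoc, one_mul, one_mul, map_smul] }
  refine Hecke.mem_of_gen S (fun k => ?_) (fun i => ?_) (fun a => ?_) x M
  · refine mul_invHom_of_mono hdisj _ _ _ (fun l => matHom_e hdisj l k) fun l t => ?_
    rw [e_thetaL hdisj, blockEmb_flatE, id, e_mul_colorE, ← mul_assoc, thetaL_mul_colorE hdisj]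
  · refine mul_invHom_of_mono hdisj _ _ _ (fun l => matHom_y hdisj l i) fun l t => ?_
    rw [y_thetaL hdisj, blockEmb_flatY, id, y_mul_colorE, ← mul_assoc, thetaL_mul_colorE hdisj]
  · refine mul_invHom_of_mono hdisj _ _ _ (fun l => matHom_psi hdisj l a) fun l t => ?_
    by_cases h : t.1 a.fst = t.1 a.snd
    · obtain ⟨b, hb, hb1, hb2⟩ := exists_sortIdx h
      rw [shapeAct_of_eq h, psiCoeff_of_eq _ h hb1, psi_thetaL_of_eq hdisj t.1 a b h hb1,
        blockEmb_flatPsi p Q l hb, psi_mul_colorE, permAct_simplePerm_of_eq hb, ← mul_assoc,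
        thetaL_mul_colorE hdisj]
    · rw [psiCoeff_of_ne _ h, psi_thetaL_of_ne hdisj h, blockEmb_one, thetaL_mul_colorE hdisj,
        shapeAct_val]

/-- Taking `M = 1` in `mul_invHom` gives `x = invHom (Ψ x)`. -/
theorem psiHom_injective : Function.Injective (psiHom (n := n) p Q hdisj) := by
  intro x y h
  rw [← mul_one x, ← mul_one y, ← invHom_one hdisj, mul_invHom hdisj, mul_invHom hdisj, h]

/-- The isomorphism `Ψ`. -/
def psiEquiv : Hecke Q n ≃ₐ[A]
    ((l : Comp d n) → Matrix (Shape l) (Shape l) (TensorHecke p Q l)) :=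
  AlgEquiv.ofBijective (psiHom p Q hdisj) ⟨psiHom_injective hdisj, psiHom_surjective hdisj⟩

theorem psiEquiv_apply (x : Hecke Q n) (l : Comp d n) :
    psiEquiv hdisj x l = matHom p Q hdisj l x := rfl

theorem psiEquiv_isDisjointIso : IsDisjointIso p Q (psiEquiv (n := n) hdisj) := by
  refine fun l => ⟨blockEmb p Q l, blockEmb_isBlockEmbedding p Q l, ?_⟩
  rintro t' t π' π hπ' hπ w' w ⟨hw', hlw'⟩ ⟨hw, hlw⟩ v
  rw [AlgEquiv.symm_apply_eq]
  refine (psiHom_word hdisj l t' t w' w ?_ (fun u hu => ?_) ?_ (fun u hu => ?_) v).symm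
  · rw [hw', ← hπ'.1, ← permAct_mul, inv_mul_cancel, permAct_one]
  · rw [permLength_inv] at hlw'
    rw [← List.length_reverse (as := u)]
    exact hπ'.length_le hlw' (permAct_wordPerm_reverse.2 hu)
  · rw [hw, hπ.1]
  · exact hπ.length_le hlw hu

end Inverse

/-! ### Counting -/

section Counting

variable {d n : ℕ}

/-- Orbit-stabilizer: `𝔖_n` acts transitively on `J^λ`, and the stabilizer of `t^λ` has order `∏
λ_j!`. -/
theorem card_shape_mul (l : Comp d n) : Fintype.card (Shape l) * ∏ j, (l.1 j)! = n ! := by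
  have hex : ∀ t : Shape l, ∃ σ : Equiv.Perm (Fin n), shapeAct σ (trivialShape l) = t := by
    intro t
    obtain ⟨σ, hσ⟩ := exists_perm_comp (t := trivialTuple l) (t' := t.1)
      fun j => by rw [t.2 j, card_trivialTuple l j]
    exact ⟨σ⁻¹, Subtype.ext (by rw [← hσ]; funext i; simp [shapeAct, permAct, trivialShape])⟩
  choose σ hσ using hex
  have hstab : ∀ g : Equiv.Perm (Fin n), trivialTuple l ∘ g = trivialTuple l →
      shapeAct g (trivialShape l) = trivialShape l := by
    intro g hg
    refine Subtype.ext (funext fun i => ?_)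
    have := congrFun hg (g⁻¹ i)
    have e : g (g⁻¹ i) = i := g.apply_symm_apply i
    rw [Function.comp_apply, e] at this
    exact this.symm
  have hbij : Function.Bijective
      (fun s : Shape l × {g : Equiv.Perm (Fin n) // trivialTuple l ∘ g = trivialTuple l} =>
        σ s.1 * s.2.1) := by
    constructor
    · rintro ⟨t, g⟩ ⟨t', g'⟩ h
      have h1 := congrArg (fun π => shapeAct π (trivialShape l)) h
      simp only [shapeAct_mul, hstab _ g.2, hstab _ g'.2, hσ] at h1
      subst h1
      simp only [mul_right_inj] at h
      rw [Subtype.ext h]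
    · intro π
      refine ⟨⟨shapeAct π (trivialShape l), ⟨(σ (shapeAct π (trivialShape l)))⁻¹ * π, ?_⟩⟩, ?_⟩
      · have h1 : shapeAct (π⁻¹ * σ (shapeAct π (trivialShape l))) (trivialShape l) =
            trivialShape l := by
          rw [shapeAct_mul, hσ, ← shapeAct_mul, inv_mul_cancel, shapeAct_one]
        have h2 := congrArg Subtype.val h1
        funext i
        have h3 := congrFun h2 i
        simpa [shapeAct, permAct, trivialShape] using h3
      · simp
  have hcard := Fintype.card_of_bijective hbij
  rw [Fintype.card_prod, DomMulAct.stabilizer_card, Fintype.card_perm, Fintype.card_fin] at hcard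
  rw [← hcard]
  congr 1
  refine Finset.prod_congr rfl fun j _ => ?_
  rw [Fintype.card_subtype, card_trivialTuple]

theorem card_shape (l : Comp d n) : Fintype.card (Shape l) = n ! / ∏ j, (l.1 j)! := by
  rw [← card_shape_mul l, Nat.mul_div_cancel _ (Finset.prod_pos fun j _ => Nat.factorial_pos _)]

end Counting

/-! ### Cyclotomic quotients -/

section TensorMap

variable {A : Type*} [CommRing A] {d : ℕ} {H G : Fin d → Type*} [∀ j, Ring (H j)]
  [∀ j, Algebra A (H j)] [∀ j, Ring (G j)] [∀ j, Algebra A (G j)]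

theorem tensorMap_mul (f : ∀ j, H j →ₐ[A] G j) (x y : ⨂[A] j, H j) :
    PiTensorProduct.map (fun j => (f j).toLinearMap) (x * y) =
      PiTensorProduct.map (fun j => (f j).toLinearMap) x *
        PiTensorProduct.map (fun j => (f j).toLinearMap) y := by
  have htprod (u v : ∀ j, H j) : PiTensorProduct.map (fun j => (f j).toLinearMap)
      (PiTensorProduct.tprod A u * PiTensorProduct.tprod A v) =
      PiTensorProduct.map (fun j => (f j).toLinearMap) (PiTensorProduct.tprod A u) *
        PiTensorProduct.map (fun j => (f j).toLinearMap) (PiTensorProduct.tprod A v) := by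
    rw [PiTensorProduct.tprod_mul_tprod, PiTensorProduct.map_tprod, PiTensorProduct.map_tprod,
      PiTensorProduct.map_tprod, PiTensorProduct.tprod_mul_tprod]
    exact congrArg (PiTensorProduct.tprod A) (funext fun j => map_mul (f j) (u j) (v j))
  induction x using PiTensorProduct.induction_on with
  | smul_tprod r u =>
    induction y using PiTensorProduct.induction_on with
    | smul_tprod s v =>
      simp only [Algebra.smul_mul_assoc, Algebra.mul_smul_comm, map_smul, htprod]
    | add y y' hy hy' => rw [mul_add, map_add, map_add, mul_add, hy, hy']
  | add x x' hx hx' => rw [add_mul, map_add, map_add, add_mul, hx, hx']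

/-- The tensor product of algebra homomorphisms. -/
def tensorMap (f : ∀ j, H j →ₐ[A] G j) : (⨂[A] j, H j) →ₐ[A] ⨂[A] j, G j :=
  AlgHom.ofLinearMap (PiTensorProduct.map fun j => (f j).toLinearMap)
    (by
      rw [PiTensorProduct.one_def, PiTensorProduct.map_tprod, PiTensorProduct.one_def]
      exact congrArg (PiTensorProduct.tprod A) (funext fun j => map_one (f j)))
    (tensorMap_mul f)

theorem tensorMap_single (f : ∀ j, H j →ₐ[A] G j) (j : Fin d) (x : H j) :
    tensorMap f (PiTensorProduct.singleAlgHom (R := A) j x) =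
      PiTensorProduct.singleAlgHom (R := A) j (f j x) := by
  refine (PiTensorProduct.map_tprod _ _).trans
    (congrArg (PiTensorProduct.tprod A) (funext fun i => ?_))
  rcases eq_or_ne i j with rfl | h
  · simp
  · simp [h]

/-- A homomorphism whose restriction to every tensor factor factors through the surjection `f j`
vanishes on the kernel of the tensor product of the `f j`. -/
theorem eq_zero_of_tensorMap_eq_zero {B : Type*} [Ring B] [Algebra A B] (f : ∀ j, H j →ₐ[A] G j)
    (hf : ∀ j, Function.Surjective (f j)) (g : ∀ j, G j →ₐ[A] B) (q : (⨂[A] j, H j) →ₐ[A] B)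
    (hg : ∀ j y, g j (f j y) = q (PiTensorProduct.singleAlgHom (R := A) j y)) {x : ⨂[A] j, H j}
    (hx : tensorMap f x = 0) : q x = 0 := by
  -- Surjectivity of the `f j` brings the commutation back to distinct factors of the original
  -- tensor product.
  have hcomm : Pairwise fun i j => ∀ y z, Commute (g i y) (g j z) := by
    intro i j hij y z
    obtain ⟨y, rfl⟩ := hf i y
    obtain ⟨z, rfl⟩ := hf j z
    rw [hg, hg]
    exact (commute_singleAlgHom hij y z).map q
  have hcomp : (liftCommuting g hcomm).comp (tensorMap f) = q := by
    refine PiTensorProduct.algHom_ext fun j => AlgHom.ext fun y => ?_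
    rw [AlgHom.comp_apply, AlgHom.comp_apply, tensorMap_single, liftCommuting_single, hg,
      AlgHom.comp_apply]
  rw [← hcomp, AlgHom.comp_apply, hx, map_zero]

end TensorMap

/-! ### The image of the cyclotomic ideal, and the isomorphism of the quotients. -/

section Cyclotomic

variable {A : Type*} [CommRing A] {K : Type*} [Fintype K] {d n : ℕ}
  {p : K → Fin d} {Q : K → K → MvPolynomial (Fin 2) A} (Λ : K → ℕ) (c : K → ℕ → A)

theorem sortPos_lt {t : Fin n → Fin d} {i i' : Fin n} (hlt : i < i') (h : t i = t i') :
    sortPos t i < sortPos t i' := by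
  obtain ⟨-, h2⟩ := (Tuple.eq_sort_iff (f := t) (σ := Tuple.sort t)).1 rfl
  have e1 : Tuple.sort t (sortPos t i) = i := by simp [sortPos]
  have e2 : Tuple.sort t (sortPos t i') = i' := by simp [sortPos]
  by_contra hcon
  have hne : sortPos t i' ≠ sortPos t i := fun h' => hlt.ne' ((sortPos t).injective h')
  have := h2 _ _ (lt_of_le_of_ne (not_lt.1 hcon) hne) (by rw [e1, e2, h])
  rw [e1, e2] at this
  exact absurd this (not_lt.2 hlt.le)

/-- Stable sorting sends the first position to the beginning of its block. -/
theorem sortPos_zero {l : Comp d n} (t : Shape l) (hn : 0 < n) {j : Fin d} (hj : 0 < l.1 j)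
    (h : t.1 ⟨0, hn⟩ = j) : sortPos t.1 ⟨0, hn⟩ = blockEquiv l ⟨j, ⟨0, hj⟩⟩ := by
  -- If the start of block `j` came from a position `i > 0`, stability would put position `0`
  -- strictly before it in the same block.
  obtain ⟨i, hi⟩ := (sortPos t.1).surjective (blockEquiv l ⟨j, ⟨0, hj⟩⟩)
  rw [← hi]
  by_contra hne
  have hti : t.1 i = j := by rw [← trivialTuple_sortPos t i, hi, trivialTuple_blockEquiv]
  have h0 : (⟨0, hn⟩ : Fin n) < i := by
    rw [Fin.lt_def]
    refine Nat.pos_of_ne_zero fun h' => hne ?_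
    congr 1
    exact Fin.ext h'.symm
  have hlt := sortPos_lt h0 (h.trans hti.symm)
  obtain ⟨j', b, hb⟩ := exists_blockEquiv l (sortPos t.1 ⟨0, hn⟩)
  have hj' : j' = j := by
    rw [← trivialTuple_blockEquiv l j' b, hb, trivialTuple_sortPos, h]
  subst hj'
  rw [hi, ← hb, Fin.lt_def, blockEquiv_val, blockEquiv_val] at hlt
  simp at hlt

theorem mono_id_pow {ι B : Type*} [Ring B] [DecidableEq ι] [Fintype ι] (v : ι → B) (m : ℕ) :
    mono id v ^ m = mono id fun t => v t ^ m := by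
  rw [mono_id, mono_id, Matrix.diagonal_pow]
  rfl

/-- The generators of the cyclotomic ideal of `H_n(Q)`. -/
def cycGen (Q : K → K → MvPolynomial (Fin 2) A) (hn : 0 < n) (k : Fin n → K) : Hecke Q n :=
  ∑ m ∈ Finset.range (Λ (k ⟨0, hn⟩) + 1),
    c (k ⟨0, hn⟩) m • (Hecke.y Q ⟨0, hn⟩ ^ m * Hecke.e Q k)

/-- The generators of the cyclotomic ideal of `H_λ(Q)`. -/
def tensorCycGen (Q : K → K → MvPolynomial (Fin 2) A) {l : Comp d n} {j : Fin d}
    (hj : 0 < l.1 j) (k : (j : Fin d) → Fin (l.1 j) → Part p j) : TensorHecke p Q l :=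
  ∑ m ∈ Finset.range (Λ (k j ⟨0, hj⟩).1 + 1),
    c (k j ⟨0, hj⟩).1 m • (tensorY p Q l j ⟨0, hj⟩ ^ m * tensorE p Q l k)

theorem cycGen_mem (hn : 0 < n) (k : Fin n → K) : cycGen Λ c Q hn k ∈ cycIdeal Q Λ c n :=
  TwoSidedIdeal.subset_span ⟨hn, k, rfl⟩

theorem tensorCycGen_mem {l : Comp d n} {j : Fin d} (hj : 0 < l.1 j)
    (k : (j : Fin d) → Fin (l.1 j) → Part p j) :
    tensorCycGen Λ c Q hj k ∈ tensorCycIdeal p Q Λ c l :=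
  TwoSidedIdeal.subset_span ⟨j, hj, k, rfl⟩

variable (hdisj : ∀ k k', p k ≠ p k' → Q k k' = 1)

theorem matHom_cycGen (l : Comp d n) (hn : 0 < n) (k : Fin n → K) :
    matHom p Q hdisj l (cycGen Λ c Q hn k) = mono id fun t =>
      ∑ m ∈ Finset.range (Λ (k ⟨0, hn⟩) + 1), c (k ⟨0, hn⟩) m •
        (flatY p Q l (sortPos t.1 ⟨0, hn⟩) ^ m * flatE p Q l (permAct (sortPos t.1) k)) := by
  rw [cycGen, map_sum]
  simp only [map_smul, map_mul, map_pow, matHom_e, matHom_y, matY, matE, mono_id_pow,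
    mono_mul_mono, Function.comp_id, id_eq]
  ext s t
  rw [Matrix.sum_apply, mono_apply]
  split_ifs with h
  · refine Finset.sum_congr rfl fun m _ => ?_
    rw [Matrix.smul_apply, mono_apply, if_pos h]
  · refine Finset.sum_eq_zero fun m _ => ?_
    rw [Matrix.smul_apply, mono_apply, if_neg h, smul_zero]

theorem matHom_cycGen_coeff_of_ne (l : Comp d n) (hn : 0 < n) (k : Fin n → K) (t : Shape l)
    (h : ¬ ∀ i, p (k i) = t.1 i) :
    ∑ m ∈ Finset.range (Λ (k ⟨0, hn⟩) + 1), c (k ⟨0, hn⟩) m •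
      (flatY p Q l (sortPos t.1 ⟨0, hn⟩) ^ m * flatE p Q l (permAct (sortPos t.1) k)) = 0 := by
  rw [(flat_isBlockRep p Q l).supp_sortPos h]
  simp

theorem matHom_cycGen_coeff (l : Comp d n) (hn : 0 < n) (k : Fin n → K) (t : Shape l)
    {j : Fin d} (hj : 0 < l.1 j) (htj : t.1 ⟨0, hn⟩ = j)
    (kk : (j : Fin d) → Fin (l.1 j) → Part p j)
    (hk : permAct (sortPos t.1) k = concat p l kk) :
    ∑ m ∈ Finset.range (Λ (k ⟨0, hn⟩) + 1), c (k ⟨0, hn⟩) m •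
      (flatY p Q l (sortPos t.1 ⟨0, hn⟩) ^ m * flatE p Q l (permAct (sortPos t.1) k)) =
        tensorCycGen Λ c Q hj kk := by
  have h0 : k ⟨0, hn⟩ = (kk j ⟨0, hj⟩).1 := by
    rw [← permAct_sortPos t.1 k, hk, sortPos_zero t hn hj htj, concat_blockEquiv]
  rw [tensorCycGen, h0, hk, flatE_concat, sortPos_zero t hn hj htj, flatY_blockEquiv]

theorem Shape.pos {l : Comp d n} (t : Shape l) (i : Fin n) : 0 < l.1 (t.1 i) := by
  rw [← t.2, Finset.card_pos]
  exact ⟨i, by simp⟩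

/-- Matrices with entries in an ideal form an ideal, so generators suffice. The generator at `k` has
a diagonal matrix, with a generator of `𝔍_λ` in the column of the colours of `k` and `0` elsewhere.
-/
theorem matHom_mem_of_mem_cycIdeal {x : Hecke Q n} (hx : x ∈ cycIdeal Q Λ c n) (l : Comp d n)
    (t' t : Shape l) : matHom p Q hdisj l x t' t ∈ tensorCycIdeal p Q Λ c l := by
  have hle : cycIdeal Q Λ c n ≤
      ((tensorCycIdeal p Q Λ c l).matrix (Shape l)).comap (matHom p Q hdisj l) := by
    rw [cycIdeal, TwoSidedIdeal.span_le]
    rintro _ ⟨hn, k, rfl⟩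
    rw [SetLike.mem_coe, TwoSidedIdeal.mem_comap, TwoSidedIdeal.mem_matrix]
    intro s t
    have := matHom_cycGen (p := p) (Q := Q) Λ c hdisj l hn k
    rw [cycGen] at this
    rw [this, mono_apply]
    split_ifs
    · by_cases h : ∀ i, p (k i) = t.1 i
      · obtain ⟨kk, hkk⟩ := exists_concat l p (permAct (sortPos t.1) k) fun i => by
          have h1 := h ((sortPos t.1)⁻¹ i)
          rw [← trivialTuple_sortPos t] at h1
          simpa [permAct] using h1
        rw [matHom_cycGen_coeff Λ c l hn k t (t.pos ⟨0, hn⟩) rfl kk hkk.symm]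
        exact tensorCycGen_mem Λ c _ _
      · rw [matHom_cycGen_coeff_of_ne Λ c l hn k t h]
        exact TwoSidedIdeal.zero_mem _
    · exact TwoSidedIdeal.zero_mem _
  have := hle hx
  rw [TwoSidedIdeal.mem_comap, TwoSidedIdeal.mem_matrix] at this
  exact this t' t

/-- The `v` for which all `v E_{t',t}` come from the cyclotomic ideal form a two-sided ideal `J`,
because these elements multiply like matrix units. A generator of `𝔍_λ` for the factor `j` is
recognised as an entry of the image of a cyclotomic generator at a tuple whose first letter has
colour `j`. -/
theorem psiEquiv_symm_single_mem {l : Comp d n} {v : TensorHecke p Q l}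
    (hv : v ∈ tensorCycIdeal p Q Λ c l) (t' t : Shape l) :
    (psiEquiv hdisj).symm (Pi.single l (Matrix.single t' t v)) ∈ cycIdeal Q Λ c n := by
  let F : TensorHecke p Q l → Shape l → Shape l → Hecke Q n := fun v t' t =>
    (psiEquiv hdisj).symm (Pi.single l (Matrix.single t' t v))
  have hF : ∀ x y t' s t, F x t' s * F y s t = F (x * y) t' t := by
    intro x y t' s t
    simp only [F]
    rw [← map_mul, single_mul_eq, Pi.single_eq_same, Matrix.single_mul_single_same]
  let J : TwoSidedIdeal (TensorHecke p Q l) := TwoSidedIdeal.mk'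
    {v | ∀ t' t, F v t' t ∈ cycIdeal Q Λ c n}
    (fun t' t => by
      simp only [F, Matrix.single_zero, Pi.single_zero, map_zero]
      exact TwoSidedIdeal.zero_mem _)
    (fun {x y} hx hy t' t => by
      have : F (x + y) t' t = F x t' t + F y t' t := by
        simp only [F]
        rw [Matrix.single_add, Pi.single_add, map_add]
      rw [this]
      exact TwoSidedIdeal.add_mem _ (hx t' t) (hy t' t))
    (fun {x} hx t' t => by
      have : F (-x) t' t = - F x t' t := by
        simp only [F]
        rw [← Matrix.single_neg, Pi.single_neg, map_neg]
      rw [this]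
      exact TwoSidedIdeal.neg_mem _ (hx t' t))
    (fun {x y} hy t' t => by
      rw [← hF x y t' t' t]
      exact TwoSidedIdeal.mul_mem_left _ _ _ (hy t' t))
    (fun {x y} hx t' t => by
      rw [← hF x y t' t t]
      exact TwoSidedIdeal.mul_mem_right _ _ _ (hx t' t))
  have hle : tensorCycIdeal p Q Λ c l ≤ J := by
    rw [tensorCycIdeal, TwoSidedIdeal.span_le]
    rintro _ ⟨j, hj, kk, rfl⟩
    change tensorCycGen Λ c Q hj kk ∈ J
    rw [TwoSidedIdeal.mem_mk']
    have hn : 0 < n := (blockEquiv l ⟨j, ⟨0, hj⟩⟩).pos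
    -- Some element of `J^λ` beginning with `j` is needed; exchanging the first position of `t^λ`
    -- with the start of block `j` yields one.
    let s : Shape l := shapeAct (Equiv.swap ⟨0, hn⟩ (blockEquiv l ⟨j, ⟨0, hj⟩⟩)) (trivialShape l)
    have hs : s.1 ⟨0, hn⟩ = j := by
      simp only [s, shapeAct, permAct, Equiv.swap_inv, Equiv.swap_apply_left]
      exact trivialTuple_blockEquiv l j _
    have hmem : F (tensorCycGen Λ c Q hj kk) s s ∈ cycIdeal Q Λ c n := by
      -- The tuple with colours `s` whose stably sorted form is the concatenation of the `k^i`.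
      let k : Fin n → K := permAct (sortPos s.1)⁻¹ (concat p l kk)
      have hk : permAct (sortPos s.1) k = concat p l kk := by
        simp only [k]
        rw [← permAct_mul, mul_inv_cancel, permAct_one]
      have hpk : ∀ i, p (k i) = s.1 i := fun i => by
        rw [← permAct_sortPos s.1 k, hk, p_concat l p kk, trivialTuple_sortPos]
      have : F (tensorCycGen Λ c Q hj kk) s s = cycGen Λ c Q hn k := by
        simp only [F]
        rw [AlgEquiv.symm_apply_eq]
        funext l'
        rw [psiEquiv_apply, matHom_cycGen]
        by_cases hl : l' = l
        · subst hl
          rw [Pi.single_eq_same]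
          ext t' t
          rw [mono_apply, Matrix.single_apply, id]
          by_cases ht : t = s
          · subst ht
            rw [matHom_cycGen_coeff Λ c l' hn k _ hj hs kk hk]
            by_cases ht' : t' = s
            · simp [ht']
            · simp [ht', Ne.symm ht']
          · rw [matHom_cycGen_coeff_of_ne Λ c l' hn k t, ite_self, if_neg fun h => ht h.2.symm]
            exact fun h => ht (Subtype.ext (funext fun i => by rw [← h i, hpk]))
        · rw [Pi.single_eq_of_ne hl]
          ext t' t
          rw [mono_apply, matHom_cycGen_coeff_of_ne Λ c l' hn k t, ite_self, Matrix.zero_apply]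
          intro h
          refine hl (congrArg Sigma.fst (shape_bijective.1 (a₁ := ⟨l', t⟩) (a₂ := ⟨l, s⟩) ?_))
          exact funext fun i => (h i).symm.trans (hpk i)
      rw [this]
      exact cycGen_mem Λ c hn k
    intro t' t
    -- Multiplication by `E_{t',s}` and `E_{s,t}` moves the entry from `(s, s)` to `(t', t)`.
    have h1 := hF 1 (tensorCycGen Λ c Q hj kk * 1) t' s t
    rw [← hF _ 1 s s t, one_mul, mul_one] at h1
    rw [← h1]
    exact TwoSidedIdeal.mul_mem_left _ _ _ (TwoSidedIdeal.mul_mem_right _ _ _ hmem)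
  have := hle hv
  rw [TwoSidedIdeal.mem_mk'] at this
  exact this t' t

theorem mem_cycIdeal_iff (x : Hecke Q n) : x ∈ cycIdeal Q Λ c n ↔
    ∀ (l : Comp d n) (t' t : Shape l), psiEquiv hdisj x l t' t ∈ tensorCycIdeal p Q Λ c l := by
  refine ⟨fun hx l t' t => matHom_mem_of_mem_cycIdeal Λ c hdisj hx l t' t, fun h => ?_⟩
  rw [← (psiEquiv hdisj).symm_apply_apply x, eq_sum_single (psiEquiv hdisj x)]
  simp only [map_sum]
  exact TwoSidedIdeal.finsetSum_mem _ _ _ fun l _ =>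
    TwoSidedIdeal.finsetSum_mem _ _ _ fun t' _ =>
      TwoSidedIdeal.finsetSum_mem _ _ _ fun t _ =>
        psiEquiv_symm_single_mem Λ c hdisj (h l t' t) t' t

variable (p Q)

/-- The algebra homomorphism `H_λ(Q) → H_λ^Λ(Q)`. -/
def tensorCycHom (l : Comp d n) : TensorHecke p Q l →ₐ[A] TensorCycHecke p Q Λ c l :=
  tensorMap fun j => cycMk (subQ p Q j) (fun k : Part p j => Λ k.1) (fun k : Part p j => c k.1)
    (l.1 j)

theorem tensorCycHom_apply (l : Comp d n) (x : TensorHecke p Q l) :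
    tensorCycHom p Q Λ c l x = tensorCycMk p Q Λ c l x := rfl

/-- The restriction of the quotient map to a tensor factor. -/
def factorCycMk (l : Comp d n) (j : Fin d) : Hecke (subQ p Q j) (l.1 j) →ₐ[A]
    CycHecke (subQ p Q j) (fun k : Part p j => Λ k.1) (fun k : Part p j => c k.1) (l.1 j) :=
  cycMk (subQ p Q j) (fun k : Part p j => Λ k.1) (fun k : Part p j => c k.1) (l.1 j)

theorem factorCycMk_surjective (l : Comp d n) (j : Fin d) :
    Function.Surjective (factorCycMk p Q Λ c l j) :=
  RingCon.mkₐ_surjective _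

theorem tensorCycHom_single (l : Comp d n) (j : Fin d) (x : Hecke (subQ p Q j) (l.1 j)) :
    tensorCycHom p Q Λ c l (PiTensorProduct.singleAlgHom (R := A)
      (A := fun j => Hecke (subQ p Q j) (l.1 j)) j x) =
    PiTensorProduct.singleAlgHom (R := A) (A := fun j => CycHecke (subQ p Q j)
      (fun k : Part p j => Λ k.1) (fun k : Part p j => c k.1) (l.1 j)) j
        (factorCycMk p Q Λ c l j x) :=
  tensorMap_single (H := fun j => Hecke (subQ p Q j) (l.1 j)) (factorCycMk p Q Λ c l) j x

theorem tensorCycHom_surjective (l : Comp d n) :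
    Function.Surjective (tensorCycHom p Q Λ c l) := by
  intro x
  refine tensor_mem_of_single (AlgHom.range (tensorCycHom p Q Λ c l)) (fun j x => ?_) x
  obtain ⟨x, rfl⟩ := factorCycMk_surjective p Q Λ c l j x
  exact ⟨_, tensorCycHom_single p Q Λ c l j x⟩

theorem factorCycMk_eq_zero_iff (l : Comp d n) (j : Fin d) (x : Hecke (subQ p Q j) (l.1 j)) :
    factorCycMk p Q Λ c l j x = 0 ↔ x ∈ cycIdeal (subQ p Q j) (fun k : Part p j => Λ k.1)
      (fun k : Part p j => c k.1) (l.1 j) :=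
  (RingCon.eq _).trans (TwoSidedIdeal.mem_iff _ x).symm

variable {p Q}

theorem tensorCycGen_eq {l : Comp d n} {j : Fin d} (hj : 0 < l.1 j)
    (k : (j : Fin d) → Fin (l.1 j) → Part p j) :
    tensorCycGen Λ c Q hj k = PiTensorProduct.singleAlgHom (R := A)
      (A := fun j => Hecke (subQ p Q j) (l.1 j)) j
      (cycGen (fun k : Part p j => Λ k.1) (fun k : Part p j => c k.1) (subQ p Q j) hj (k j)) *
        tensorE p Q l k := by
  rw [tensorCycGen, cycGen, map_sum, Finset.sum_mul]
  refine Finset.sum_congr rfl fun m _ => ?_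
  rw [map_smul, map_mul, map_pow, smul_mul_assoc, mul_assoc, single_e_mul_tensorE]
  rfl

theorem tensorCycHom_eq_zero_of_mem {l : Comp d n} {x : TensorHecke p Q l}
    (hx : x ∈ tensorCycIdeal p Q Λ c l) : tensorCycHom p Q Λ c l x = 0 := by
  have hle : tensorCycIdeal p Q Λ c l ≤ TwoSidedIdeal.ker (tensorCycHom p Q Λ c l) := by
    rw [tensorCycIdeal, TwoSidedIdeal.span_le]
    rintro _ ⟨j, hj, k, rfl⟩
    change tensorCycGen Λ c Q hj k ∈ _
    rw [SetLike.mem_coe, TwoSidedIdeal.mem_ker, tensorCycGen_eq, map_mul, tensorCycHom_single,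
      (factorCycMk_eq_zero_iff p Q Λ c l j _).2 (cycGen_mem _ _ hj (k j)), map_zero, zero_mul]
  exact (TwoSidedIdeal.mem_ker _).1 (hle hx)

/-- Multiplying a generator at `κ` by `1 = ∑ e^⊗(k)` leaves the terms with `k^j = κ`, and these are
generators of `𝔍_λ`. -/
theorem single_mem_tensorCycIdeal {l : Comp d n} {j : Fin d} {x : Hecke (subQ p Q j) (l.1 j)}
    (hx : x ∈ cycIdeal (subQ p Q j) (fun k : Part p j => Λ k.1)
      (fun k : Part p j => c k.1) (l.1 j)) :
    PiTensorProduct.singleAlgHom (R := A) (A := fun j => Hecke (subQ p Q j) (l.1 j)) j x ∈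
      tensorCycIdeal p Q Λ c l := by
  classical
  have hle : cycIdeal (subQ p Q j) (fun k : Part p j => Λ k.1)
      (fun k : Part p j => c k.1) (l.1 j) ≤ (tensorCycIdeal p Q Λ c l).comap
        (PiTensorProduct.singleAlgHom (R := A) (A := fun j => Hecke (subQ p Q j) (l.1 j)) j) := by
    rw [cycIdeal, TwoSidedIdeal.span_le]
    rintro _ ⟨hj, κ, rfl⟩
    rw [SetLike.mem_coe, TwoSidedIdeal.mem_comap]
    change PiTensorProduct.singleAlgHom (R := A) (A := fun j => Hecke (subQ p Q j) (l.1 j)) j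
      (cycGen (fun k : Part p j => Λ k.1) (fun k : Part p j => c k.1) (subQ p Q j) hj κ) ∈ _
    rw [← mul_one (PiTensorProduct.singleAlgHom (R := A)
      (A := fun j => Hecke (subQ p Q j) (l.1 j)) j _), ← sum_tensorE, Finset.mul_sum]
    refine TwoSidedIdeal.finsetSum_mem _ _ _ fun k _ => ?_
    by_cases hk : k j = κ
    · subst hk
      rw [← tensorCycGen_eq]
      exact tensorCycGen_mem Λ c hj k
    · rw [← single_e_mul_tensorE j k, ← mul_assoc, ← map_mul]
      have : cycGen (fun k : Part p j => Λ k.1) (fun k : Part p j => c k.1) (subQ p Q j) hj κ *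
          Hecke.e (subQ p Q j) (k j) = 0 := by
        rw [cycGen, Finset.sum_mul]
        refine Finset.sum_eq_zero fun m _ => ?_
        rw [smul_mul_assoc, mul_assoc, (Hecke.isRep _ _).e_mul_ne _ _ (Ne.symm hk), mul_zero,
          smul_zero]
      rw [this, map_zero, zero_mul]
      exact TwoSidedIdeal.zero_mem _
  have := hle hx
  rwa [TwoSidedIdeal.mem_comap] at this

/-- The kernel of `H_λ(Q) → H_λ^Λ(Q)` is the cyclotomic ideal. -/
theorem tensorCycHom_eq_zero_iff {l : Comp d n} {x : TensorHecke p Q l} :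
    tensorCycHom p Q Λ c l x = 0 ↔ x ∈ tensorCycIdeal p Q Λ c l := by
  refine ⟨fun hx => ?_, tensorCycHom_eq_zero_of_mem Λ c⟩
  let I := tensorCycIdeal p Q Λ c l
  let q : TensorHecke p Q l →ₐ[A] I.ringCon.Quotient := RingCon.mkₐ A I.ringCon
  have hq : ∀ y, q y = 0 ↔ y ∈ I := fun y =>
    (RingCon.eq _).trans (TwoSidedIdeal.mem_iff _ y).symm
  -- Every cyclotomic factor maps to `H_λ(Q)/𝔍_λ`, so the quotient map by `𝔍_λ` factors through
  -- `H_λ^Λ(Q)`. This gives the harder inclusion of the kernel in `𝔍_λ`.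
  let g : ∀ j, CycHecke (subQ p Q j) (fun k : Part p j => Λ k.1) (fun k : Part p j => c k.1)
      (l.1 j) →ₐ[A] I.ringCon.Quotient := fun j =>
    RingCon.liftₐ _ (q.comp (PiTensorProduct.singleAlgHom (R := A)
      (A := fun j => Hecke (subQ p Q j) (l.1 j)) j)) (by
        intro y z hyz
        rw [TwoSidedIdeal.rel_iff] at hyz
        have h1 := (hq _).2 (single_mem_tensorCycIdeal Λ c hyz)
        rw [map_sub, map_sub, sub_eq_zero] at h1
        exact h1)
  have hg : ∀ j y, g j (factorCycMk p Q Λ c l j y) = q (PiTensorProduct.singleAlgHom (R := A)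
      (A := fun j => Hecke (subQ p Q j) (l.1 j)) j y) := fun j y => rfl
  rw [← hq]
  exact eq_zero_of_tensorMap_eq_zero (H := fun j => Hecke (subQ p Q j) (l.1 j))
    (factorCycMk p Q Λ c l) (factorCycMk_surjective p Q Λ c l) g q hg hx

/-- The composition of `Ψ` with the quotient maps of the entries. -/
def psiCycHom : Hecke Q n →ₐ[A]
    ((l : Comp d n) → Matrix (Shape l) (Shape l) (TensorCycHecke p Q Λ c l)) :=
  AlgHom.pi fun l => (tensorCycHom p Q Λ c l).mapMatrix.comp (matHom p Q hdisj l)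

theorem psiCycHom_apply (x : Hecke Q n) (l : Comp d n) (t' t : Shape l) :
    psiCycHom Λ c hdisj x l t' t =
      tensorCycMk p Q Λ c l (psiEquiv hdisj x l t' t) := rfl

theorem psiCycHom_surjective : Function.Surjective (psiCycHom (n := n) Λ c hdisj) := by
  intro M
  choose N hN using fun (l : Comp d n) (t' t : Shape l) =>
    tensorCycHom_surjective p Q Λ c l (M l t' t)
  refine ⟨(psiEquiv hdisj).symm fun l => Matrix.of (N l), ?_⟩
  funext l
  ext t' t
  rw [psiCycHom_apply, AlgEquiv.apply_symm_apply]
  exact hN l t' t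

theorem psiCycHom_eq_zero_iff (x : Hecke Q n) :
    psiCycHom Λ c hdisj x = 0 ↔ x ∈ cycIdeal Q Λ c n := by
  rw [mem_cycIdeal_iff Λ c hdisj]
  constructor
  · intro h l t' t
    rw [← tensorCycHom_eq_zero_iff, tensorCycHom_apply, ← psiCycHom_apply, h]
    rfl
  · intro h
    funext l
    ext t' t
    rw [psiCycHom_apply, ← tensorCycHom_apply, (tensorCycHom_eq_zero_iff Λ c).2 (h l t' t)]
    rfl

theorem psiCycHom_eq_iff (x y : Hecke Q n) :
    psiCycHom Λ c hdisj x = psiCycHom Λ c hdisj y ↔ (cycIdeal Q Λ c n).ringCon x y := by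
  rw [TwoSidedIdeal.rel_iff, ← psiCycHom_eq_zero_iff Λ c hdisj, map_sub, sub_eq_zero]

/-- The isomorphism `Ψ^Λ`. -/
def psiCycEquiv : CycHecke Q Λ c n ≃ₐ[A]
    ((l : Comp d n) → Matrix (Shape l) (Shape l) (TensorCycHecke p Q Λ c l)) :=
  AlgEquiv.ofBijective
    (RingCon.liftₐ (cycIdeal Q Λ c n).ringCon (psiCycHom Λ c hdisj) fun _ _ h =>
      (psiCycHom_eq_iff Λ c hdisj _ _).2 h)
    (by
      constructor
      · intro x y
        obtain ⟨x, rfl⟩ := RingCon.mkₐ_surjective (α := A) _ x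
        obtain ⟨y, rfl⟩ := RingCon.mkₐ_surjective (α := A) _ y
        intro h
        exact (RingCon.eq _).2 ((psiCycHom_eq_iff Λ c hdisj x y).1 h)
      · intro M
        obtain ⟨x, hx⟩ := psiCycHom_surjective Λ c hdisj M
        exact ⟨cycMk Q Λ c n x, hx⟩)

theorem psiCycEquiv_cycMk (x : Hecke Q n) (l : Comp d n) (t' t : Shape l) :
    psiCycEquiv Λ c hdisj (cycMk Q Λ c n x) l t' t =
      tensorCycMk p Q Λ c l (psiEquiv hdisj x l t' t) := rfl

end Cyclotomic

end QuiverHecke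

end

theorem mainTheorem4 {A : Type*} [CommRing A] {K : Type*} [Fintype K] {d n : ℕ}
    (p : K → Fin d) (Q : K → K → MvPolynomial (Fin 2) A)
    (hsymm : ∀ k k', Q k k' = MvPolynomial.rename (Equiv.swap 0 1) (Q k' k))
    (hdiag : ∀ k, Q k k = 0)
    (hdisj : ∀ k k', p k ≠ p k' → Q k k' = 1)
    (Λ : K → ℕ) (c : K → ℕ → A) (hc : ∀ k, c k (Λ k) = 1) :
    (∀ l : Comp d n, Fintype.card (Shape l) = n ! / ∏ j, (l.1 j)!) ∧
    ∃ (Ψ : Hecke Q n ≃ₐ[A]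
          ((l : Comp d n) → Matrix (Shape l) (Shape l) (TensorHecke p Q l)))
      (ΨΛ : CycHecke Q Λ c n ≃ₐ[A]
          ((l : Comp d n) → Matrix (Shape l) (Shape l) (TensorCycHecke p Q Λ c l))),
      IsDisjointIso p Q Ψ ∧
      (∀ (x : Hecke Q n), x ∈ cycIdeal Q Λ c n ↔
        ∀ (l : Comp d n) (t' t : Shape l), Ψ x l t' t ∈ tensorCycIdeal p Q Λ c l) ∧
      (∀ (x : Hecke Q n) (l : Comp d n) (t' t : Shape l),
        ΨΛ (cycMk Q Λ c n x) l t' t = tensorCycMk p Q Λ c l (Ψ x l t' t)) :=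
  ⟨card_shape, psiEquiv hdisj, psiCycEquiv Λ c hdisj, psiEquiv_isDisjointIso hdisj,
    mem_cycIdeal_iff Λ c hdisj, psiCycEquiv_cycMk Λ c hdisj⟩
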